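/- Let $\mathbb{F}$ be a field and $\mathbb{D}$ a division ring that is an $\mathbb{F}$-algebra (so that $\mathbb{F}$ is a subfield of the center of $\mathbb{D}$) of finite degree $d=[\mathbb{D}:\mathbb{F}]$. The algebra $\mathbb{D}$ is of quadratic type over $\mathbb{F}$ if one of the following holds: (i) $d=1$; (ii) $d=2$ and $\mathbb{D}$ is a separable field extension of $\mathbb{F}$; (iii) $d=4$ and $\mathbb{D}$ is a quaternion algebra (with center $\mathbb{F}$); (iv) $\mathbb{F}$ has characteristic $2$, $d=2^m$ with $m\geq 1$, and $\mathbb{D}$ is a field such that $x^2\in\mathbb{F}$ for all $x\in\mathbb{D}$. In that case $(\sigma,e)$ is an associated pair if $\sigma:\mathbb{D}\to\mathbb{D}$ is the identity in cases (i) and (iv), the non-identity $\mathbb{F}$-automorphism in case (ii) and the quaternionic conjugation in case (iii), and $e:\mathbb{D}\to\mathbb{F}$ is the trace of $\mathbb{D}$ over $\mathbb{F}$ in cases (i) and (ii), the reduced trace $x\mapsto x+\sigma(x)$ in case (iii), and an arbitrary nonzero $\mathbb{F}$-linear form in case (iv). For a matrix $A$ over $\mathbb{D}$, denote by $A^\star$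 the transpose of the matrix obtained by applying $\sigma$ to the entries of $A$. A matrix $P\in \mathrm{Mat}_k(\mathbb{D})$ is $e$-nonisotropic if $e(X^\star P X)\neq 0$ for every nonzero column $X\in\mathbb{D}^k$. Put $$\mathcal{SH}_k(\mathbb{D}):=\{M\in \mathrm{Mat}_k(\mathbb{D}) : M^\star=-M \text{ and } e(m_{i,i})=0 \text{ for all } i\}.$$ Given an ordered partition $n=n_1+\cdots+n_p$ into positive integers and sets $\mathcal{X}_i\subseteq \mathrm{Mat}_{n_i}(\mathbb{D})$, the joint $\mathcal{X}_1\vee\cdots\vee\mathcal{X}_p$ is the set of all block upper-triangular matrices of $\mathrm{Mat}_n(\mathbb{D})$ whose $i$-th diagonal block belongs to $\mathcal{X}_i$ for all $i$ (the blocks above the diagonal being arbitrary). Two subsets $\mathcal{X},\mathcal{Y}$ of $\mathrm{Mat}_n(\mathbb{D})$ are equivalent if $\mathcal{Y}=U\mathcal{X}V$ for some $U,V\in \mathrm{GL}_n(\mathbb{D})$. An optimal $\mathbb{F}$-affine subspace of invertible matrices of $\mathrm{Mat}_n(\mathbb{D})$ is a nonempty $\mathbb{F}$-affine subspace of $\mathrm{Mat}_n(\mathbb{D})$,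 all of whose elements are invertible, with the greatest possible dimension over $\mathbb{F}$ among such subspaces. Theorem. Let $n\geq 1$. Assume that $\mathbb{D}$ is of quadratic type over $\mathbb{F}$ and $|\mathbb{F}|\geq nd$, and let $(\sigma,e)$ be an associated pair. (a) Let $\mathcal{M}$ be an optimal $\mathbb{F}$-affine subspace of invertible matrices of $\mathrm{Mat}_n(\mathbb{D})$. Then there are an ordered partition $n=n_1+\cdots+n_p$ into positive integers and $e$-nonisotropic matrices $P_i\in \mathrm{GL}_{n_i}(\mathbb{D})$, $1\leq i\leq p$, such that $\mathcal{M}$ is equivalent to $(P_1+\mathcal{SH}_{n_1}(\mathbb{D}))\vee\cdots\vee(P_p+\mathcal{SH}_{n_p}(\mathbb{D}))$. (b) Conversely, for every ordered partition $n=n_1+\cdots+n_p$ into positive integers and all $e$-nonisotropic matrices $P_i\in \mathrm{GL}_{n_i}(\mathbb{D})$, the set $(P_1+\mathcal{SH}_{n_1}(\mathbb{D}))\vee\cdots\vee(P_p+\mathcal{SH}_{n_p}(\mathbb{D}))$ is an optimal $\mathbb{F}$-affine subspace of invertible matrices of $\mathrm{Mat}_n(\mathbb{D})$. (c) Let $n=n_1+\cdots+n_p=m_1+\cdots+m_q$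 be two ordered partitions into positive integers, and let $P_i\in \mathrm{GL}_{n_i}(\mathbb{D})$ ($1\leq i\leq p$) and $P'_j\in \mathrm{GL}_{m_j}(\mathbb{D})$ ($1\leq j\leq q$) be $e$-nonisotropic. Then $(P_1+\mathcal{SH}_{n_1}(\mathbb{D}))\vee\cdots\vee(P_p+\mathcal{SH}_{n_p}(\mathbb{D}))$ is equivalent to $(P'_1+\mathcal{SH}_{m_1}(\mathbb{D}))\vee\cdots\vee(P'_q+\mathcal{SH}_{m_q}(\mathbb{D}))$ if and only if $(n_1,\dots,n_p)=(m_1,\dots,m_q)$ and, for every $k\in\{1,\dots,p\}$, there are a matrix $Q_k\in \mathrm{GL}_{n_k}(\mathbb{D})$ and a scalar $\alpha_k\in\mathbb{F}\setminus\{0\}$ such that $$\forall X\in\mathbb{D}^{n_k},\quad e(X^\star P'_kX)=\alpha_k\, e\big((Q_kX)^\star P_k(Q_kX)\big).$$ -/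

import Mathlib

namespace InvertibleAffine

section Types

variable (F D : Type*) [Field F] [DivisionRing D] [Algebra F D]

/-- `D` is a separable quadratic field extension of `F`. -/
def IsSeparableQuadratic : Prop :=
  Module.finrank F D = 2 ∧ (∀ x y : D, x * y = y * x) ∧ Algebra.IsSeparable F D

/-- `D` is a quaternion algebra over `F`, in any characteristic. Centrality matters: in
characteristic two `QuaternionAlgebra F a 0 c` can be a commutative field. -/
def IsQuaternion : Prop :=
  Module.finrank F D = 4 ∧ Algebra.IsCentral F D ∧
    ∃ a b c : F, Nonempty (D ≃ₐ[F] QuaternionAlgebra F a b c)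

/-- `D` is a nontrivial hyper-radicial extension of `F`: the characteristic is two, `D` is a field
of degree `2 ^ m` over `F` with `m ≥ 1`, and all squares of elements of `D` lie in `F`. -/
def IsHyperRadicial : Prop :=
  CharP F 2 ∧ (∃ m : ℕ, 1 ≤ m ∧ Module.finrank F D = 2 ^ m) ∧ (∀ x y : D, x * y = y * x) ∧
    ∀ x : D, ∃ a : F, x ^ 2 = algebraMap F D a

/-- `D` is of quadratic type over `F`. The four cases are mutually exclusive. -/
def IsQuadraticType : Prop :=
  Module.finrank F D = 1 ∨ IsSeparableQuadratic F D ∨ IsQuaternion F D ∨ IsHyperRadicial F D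

variable {D}

/-- `σ` is the standard involution of the division algebra `D` of quadratic type over `F`:
the identity in degree one and in the hyper-radicial case, the non-identity automorphism in the
separable quadratic case, quaternionic conjugation in the quaternion case. -/
structure IsStandardInvolution (σ : D → D) : Prop where
  quadraticType : IsQuadraticType F D
  degree_one : Module.finrank F D = 1 → σ = id
  separable : IsSeparableQuadratic F D →
    ∃ τ : D ≃ₐ[F] D, τ ≠ AlgEquiv.refl ∧ ∀ x, σ x = τ x
  quaternion : IsQuaternion F D →
    ∃ (a b c : F) (φ : D ≃ₐ[F] QuaternionAlgebra F a b c), ∀ x, φ (σ x) = star (φ x)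
  hyperRadicial : IsHyperRadicial F D → σ = id

variable {F}

/-- `(σ, e)` is an associated pair for `D` over `F`: `σ` is the standard involution, and `e` is the
trace in degree one and in the separable quadratic case, the reduced trace `x ↦ x + σ x` in the
quaternion case, and an arbitrary nonzero linear form in the hyper-radicial case. -/
structure IsAssociatedPair (σ : D → D) (e : D →ₗ[F] F) : Prop where
  involution : IsStandardInvolution F σ
  degree_one : Module.finrank F D = 1 → ∀ x, e x = LinearMap.trace F D (LinearMap.mulLeft F x)
  separable : IsSeparableQuadratic F D →
    ∀ x, e x = LinearMap.trace F D (LinearMap.mulLeft F x)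
  quaternion : IsQuaternion F D → ∀ x, algebraMap F D (e x) = x + σ x
  hyperRadicial : IsHyperRadicial F D → e ≠ 0

end Types

section Matrices

variable {F D : Type*} [Field F] [DivisionRing D] [Algebra F D]

/-- The map `X ↦ e (X⋆ P X)` on column vectors, where `X⋆` is the transpose of `σ` applied
entrywise to `X`. -/
def starForm (σ : D → D) (e : D →ₗ[F] F) {k : ℕ} (P : Matrix (Fin k) (Fin k) D)
    (X : Fin k → D) : F :=
  e ((fun i => σ (X i)) ⬝ᵥ P.mulVec X)

/-- The matrix `P` is `e`-nonisotropic. -/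
def IsNonisotropic (σ : D → D) (e : D →ₗ[F] F) {k : ℕ} (P : Matrix (Fin k) (Fin k) D) : Prop :=
  ∀ X : Fin k → D, X ≠ 0 → starForm σ e P X ≠ 0

/-- The set of all skew-Hermitian `k × k` matrices with diagonal entries in the kernel of `e`. -/
def skewHermitian (σ : D → D) (e : D →ₗ[F] F) (k : ℕ) : Set (Matrix (Fin k) (Fin k) D) :=
  {M | M.transpose.map σ = -M ∧ ∀ i, e (M i i) = 0}

/-- The translate `P + SH_k(D)` of the set of skew-Hermitian matrices with diagonal entries in the
kernel of `e`. -/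
def skewHermitianTranslate (σ : D → D) (e : D →ₗ[F] F) {k : ℕ} (P : Matrix (Fin k) (Fin k) D) :
    Set (Matrix (Fin k) (Fin k) D) :=
  {N | ∃ M ∈ skewHermitian σ e k, N = P + M}

/-- The joint of the matrix sets `S 0, S 1, …` along an ordered partition `c` of `n` into positive
integers: all block upper-triangular matrices whose `i`-th diagonal block belongs to `S i`. -/
def joint {n : ℕ} (c : Composition n)
    (S : ∀ i : Fin c.length, Set (Matrix (Fin (c.blocksFun i)) (Fin (c.blocksFun i)) D)) :
    Set (Matrix (Fin n) (Fin n) D) :=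
  {M | (∀ i j : Fin c.length, j < i → M.submatrix (c.embedding i) (c.embedding j) = 0) ∧
    ∀ i : Fin c.length, M.submatrix (c.embedding i) (c.embedding i) ∈ S i}

/-- Two sets of matrices are equivalent: `T = U S V` with `U` and `V` invertible. -/
def MatEquivalent {n : ℕ} (S T : Set (Matrix (Fin n) (Fin n) D)) : Prop :=
  ∃ U V : (Matrix (Fin n) (Fin n) D)ˣ,
    T = (fun M => (U : Matrix (Fin n) (Fin n) D) * M * (V : Matrix (Fin n) (Fin n) D)) '' S

/-- `A` is a (nonempty) affine space of invertible matrices. -/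
def IsAffineInvertible {n : ℕ} (A : AffineSubspace F (Matrix (Fin n) (Fin n) D)) : Prop :=
  (A : Set (Matrix (Fin n) (Fin n) D)).Nonempty ∧ ∀ M ∈ A, IsUnit M

/-- `A` is an optimal affine space of invertible matrices: its dimension over `F` is the greatest
possible one among such spaces. -/
def IsOptimalAffineInvertible {n : ℕ} (A : AffineSubspace F (Matrix (Fin n) (Fin n) D)) : Prop :=
  IsAffineInvertible A ∧ ∀ B : AffineSubspace F (Matrix (Fin n) (Fin n) D),
    IsAffineInvertible B → Module.finrank F B.direction ≤ Module.finrank F A.direction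

/-- A list of invertible matrices, one for each part of the ordered partition `c`, of the
corresponding size. -/
abbrev InvertibleFamily (D : Type*) [DivisionRing D] {n : ℕ} (c : Composition n) : Type _ :=
  ∀ i : Fin c.length, (Matrix (Fin (c.blocksFun i)) (Fin (c.blocksFun i)) D)ˣ

/-- The joint of the sets `P_i + SH_{n_i}(D)`. -/
def jointTranslate (σ : D → D) (e : D →ₗ[F] F) {n : ℕ} (c : Composition n)
    (P : InvertibleFamily D c) : Set (Matrix (Fin n) (Fin n) D) :=
  joint c fun i => skewHermitianTranslate σ e (P i).val

end Matrices

end InvertibleAffine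

open InvertibleAffine

/-! Fix M₀ in an affine space of invertible matrices. For N in the direction, M₀ - N is invertible,
so N M₀⁻¹, acting on rows, fixes no nonzero vector. The problem thus concerns F-spaces V of
endomorphisms of an n-dimensional D-space E without nonzero fixed vectors (`TrivSpec`). A finite set
`s` of at least nd scalars carries the assumption on the cardinality of F.

Bound: 2 dim V + 2n ≤ d n(n+1). Since x ∉ V x, the space V x has dimension at most nd - 1, and a
semicontinuity argument (`TrivSpec.exists_good`) yields an x such that the elements of V killing x
are determined by what they induce on E/Dx, where induction applies. The joints of the sets P_i + SH
consist of invertible matrices and have at least this dimension, whence (b).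

Structure: in case of equality (`IsOpt`), V x is a hyperplane ker f for some x. If one vector w lies
in V(z - ax) for all scalars a, then f w = 0 (`TrivSpec.persistence`). Hence the elements killing x
have their range in the complement `formKer D f` of Dx and form an optimal space there. Induction
then gives a nonzero sesquilinear form B, nonisotropic modulo its radical, such that B(u, Mu) = 0
for all M in V (`IsOpt.exists_form`). The heart is the extension of a form B' from the complement to
E: if S_g in V sends x to g, then f(S_g z) = ν B'(z, g) for a constant ν. If ν = 0 the complement is
stable and B is read off the x-coordinate. If ν ≠ 0, the linear forms killing V(ax + z) have a slope
τ(z); it is semilinear in z and supplies the missing part of B.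

The radical of B is stable, and V restricts to an optimal space on it. Iterating, one gets an
adapted basis and a block-diagonal Gram matrix P such that every M P is block-triangular with
diagonal blocks in SH (`IsOpt.exists_triangular`). Equality of dimensions turns this inclusion into
an equality, whence (a).

Classification: if k is the lowest level at which a row x is nonzero, the columns y with x M y = 0
for all M are those supported on the levels below k. An equivalence therefore preserves the flag,
hence the partition. On each diagonal block, testing against SH forces the right factor to be a
scalar multiple of the conjugate transpose of the left one, whence (c). -/

namespace InvertibleAffine

/-! ### Linear algebra over a large field: pencils, eigenvalues, proportional maps. -/

section Prelim

/-- An endomorphism has at most as many eigenvalues as the dimension of the space. -/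
theorem card_le_finrank_of_forall_eigenvalue {F X : Type*} [Field F] [AddCommGroup X] [Module F X]
    [FiniteDimensional F X] (C : X →ₗ[F] X) (s : Finset F)
    (h : ∀ a ∈ s, ∃ v, v ≠ 0 ∧ C v = a • v) : s.card ≤ Module.finrank F X := by
  choose! v hv0 hv using h
  have := Module.End.eigenvectors_linearIndependent' C (fun a : s => (a : F))
    Subtype.val_injective (fun a => v a)
    (fun a => ⟨Module.End.mem_eigenspace_iff.2 (hv a a.2), hv0 a a.2⟩)
  simpa using this.fintype_card_le_finrank

/-- An affine pencil `A + t B` of linear maps with `A` injective is injective for some nonzero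
`t`, provided that the field is large enough. -/
theorem exists_pencil_injective {F X Y : Type*} [Field F] [AddCommGroup X] [Module F X]
    [FiniteDimensional F X] [AddCommGroup Y] [Module F Y] (A B : X →ₗ[F] Y)
    (hA : Function.Injective A) (s : Finset F) (hs : Module.finrank F X + 2 ≤ s.card) :
    ∃ t : F, t ≠ 0 ∧ ∀ v, A v + t • B v = 0 → v = 0 := by
  classical
  obtain ⟨L, hL⟩ := A.exists_leftInverse_of_injective (LinearMap.ker_eq_bot.2 hA)
  by_contra! hcon
  -- With t = -a⁻¹, applying L to A v + t B v = 0 gives L B v = a v. If every nonzero t failed,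
  -- every nonzero element of `s` would be an eigenvalue of L B: too many.
  have := card_le_finrank_of_forall_eigenvalue (L ∘ₗ B) (s.erase 0) (by
    intro a ha
    have ha0 : a ≠ 0 := (Finset.mem_erase.1 ha).1
    obtain ⟨v, hv, hv0⟩ := hcon (-a⁻¹) (by simpa using ha0)
    refine ⟨v, hv0, ?_⟩
    have h1 := congrArg L hv
    have h2 : L (A v) = v := LinearMap.congr_fun hL v
    simp only [map_add, map_smul, h2, map_zero] at h1
    have h3 : v = a⁻¹ • L (B v) := by
      rw [neg_smul] at h1
      exact eq_of_sub_eq_zero (by rw [sub_eq_add_neg]; exact h1)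
    simp only [LinearMap.comp_apply]
    nth_rewrite 2 [h3]
    rw [smul_smul, mul_inv_cancel₀ ha0, one_smul])
  have h2 := Finset.pred_card_le_card_erase (s := s) (a := (0 : F))
  omega

/-- Semicontinuity of the dimension of the kernel along a pencil `A + t B`: if the kernels for
`t ≠ 0` lie in a small subspace `H` which does not contain the kernel of `A`, then some of them has
a smaller dimension than the kernel of `A`. -/
theorem exists_pencil_finrank_ker_lt {F X Y : Type*} [Field F] [AddCommGroup X] [Module F X]
    [FiniteDimensional F X] [AddCommGroup Y] [Module F Y] (A B : X →ₗ[F] Y) (H : Submodule F X)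
    (hA : ¬ LinearMap.ker A ≤ H) (hH : ∀ t : F, t ≠ 0 → LinearMap.ker (A + t • B) ≤ H)
    (s : Finset F) (hs : Module.finrank F H + 2 ≤ s.card) :
    ∃ t : F, t ≠ 0 ∧
      Module.finrank F (LinearMap.ker (A + t • B)) < Module.finrank F (LinearMap.ker A) := by
  let N : Submodule F H := (LinearMap.ker A).comap H.subtype
  obtain ⟨Z, hZ⟩ := Submodule.exists_isCompl N
  have hZdim := Submodule.finrank_add_eq_of_isCompl hZ
  have hNlt : Module.finrank F N < Module.finrank F (LinearMap.ker A) := by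
    rw [← Submodule.finrank_map_subtype_eq, Submodule.map_comap_subtype]
    refine Submodule.finrank_lt_finrank_of_lt (lt_of_le_of_ne inf_le_right fun h => hA ?_)
    rw [← h]
    exact inf_le_left
  obtain ⟨t, ht, hinj⟩ := exists_pencil_injective (A ∘ₗ H.subtype ∘ₗ Z.subtype)
    (B ∘ₗ H.subtype ∘ₗ Z.subtype) (by
      rw [← LinearMap.ker_eq_bot, LinearMap.ker_eq_bot']
      intro φ hφ
      have : (φ : H) ∈ N ⊓ Z := ⟨hφ, φ.2⟩
      rw [hZ.inf_eq_bot] at this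
      exact Subtype.ext ((Submodule.mem_bot _).1 this)) s (by
      have := Submodule.finrank_le Z
      omega)
  refine ⟨t, ht, ?_⟩
  have hdis : Disjoint ((LinearMap.ker (A + t • B)).comap H.subtype) Z := by
    rw [Submodule.disjoint_def]
    intro φ hφ hφZ
    exact congrArg Subtype.val (hinj ⟨φ, hφZ⟩ hφ)
  have hd := Submodule.finrank_add_finrank_le_of_disjoint hdis
  have hd' : Module.finrank F ((LinearMap.ker (A + t • B)).comap H.subtype) =
      Module.finrank F (LinearMap.ker (A + t • B)) :=
    (Submodule.comapSubtypeEquivOfLe (hH t ht)).finrank_eq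
  omega

/-- If `T₁ z` is a multiple of `T₂ z` whenever `T₂ z ≠ 0`, and `T₂` has rank at least two, then
`T₁` is a multiple of `T₂`. -/
theorem exists_eq_smul_of_forall {F X Y : Type*} [Field F] [AddCommGroup X] [Module F X]
    [AddCommGroup Y] [Module F Y] (T₁ T₂ : X →ₗ[F] Y)
    (h : ∀ z, T₂ z ≠ 0 → ∃ a : F, T₁ z = a • T₂ z) {z₁ z₂ : X}
    (hz₁ : T₂ z₁ ≠ 0) (hz₂ : ∀ a : F, T₂ z₂ ≠ a • T₂ z₁) : ∃ a : F, ∀ z, T₁ z = a • T₂ z := by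
  -- When T₂ u and T₂ w are independent, the ratios of T₁ to T₂ at u, w and u + w must agree.
  have key : ∀ u w : X, T₂ u ≠ 0 → (∀ a : F, T₂ w ≠ a • T₂ u) → ∀ a : F, T₁ u = a • T₂ u →
      T₁ w = a • T₂ w := by
    intro u w hu hw a ha
    have hw0 : T₂ w ≠ 0 := by simpa using hw 0
    obtain ⟨b, hb⟩ := h w hw0
    obtain ⟨c, hc⟩ := h (u + w) (fun h0 => hw (-1) (by
      rw [map_add] at h0; rw [neg_one_smul]; exact eq_neg_of_add_eq_zero_right h0))
    rw [map_add, map_add, ha, hb, smul_add] at hc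
    have h1 : (b - c) • T₂ w = (c - a) • T₂ u := by
      rw [sub_smul, sub_smul, sub_eq_sub_iff_add_eq_add, add_comm, hc, add_comm]
    have hbc : b = c := by
      by_contra hne
      have hne' : b - c ≠ 0 := sub_ne_zero.2 hne
      apply hw ((b - c)⁻¹ * (c - a))
      rw [mul_smul, ← h1, smul_smul, inv_mul_cancel₀ hne', one_smul]
    have hca : c = a := by
      rw [hbc, sub_self, zero_smul] at h1
      exact sub_eq_zero.1 ((smul_eq_zero.1 h1.symm).resolve_right hu)
    rw [hb, hbc, hca]
  obtain ⟨a, ha⟩ := h z₁ hz₁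
  have ha₂ := key z₁ z₂ hz₁ hz₂ a ha
  have hz₂0 : T₂ z₂ ≠ 0 := by simpa using hz₂ 0
  have main : ∀ z, T₂ z ≠ 0 → T₁ z = a • T₂ z := by
    intro z hz
    by_cases hd : ∃ b : F, T₂ z = b • T₂ z₁
    · obtain ⟨b, hb⟩ := hd
      refine key z₂ z hz₂0 (fun c hc => ?_) a ha₂
      have hc0 : c ≠ 0 := by rintro rfl; exact hz (by simpa using hc)
      apply hz₂ (c⁻¹ * b)
      rw [mul_smul, ← hb, hc, smul_smul, inv_mul_cancel₀ hc0, one_smul]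
    · push Not at hd
      exact key z₁ z hz₁ hd a ha
  refine ⟨a, fun z => ?_⟩
  by_cases hz : T₂ z = 0
  · have := main (z₁ + z) (by rwa [map_add, hz, add_zero])
    rw [map_add, map_add, ha, hz, add_zero] at this
    rw [hz, smul_zero]
    simpa using this
  · exact main z hz

/-- If `T : X → Y*` is injective then every linear form on `X` is evaluation at some `c : Y`. -/
theorem exists_forall_apply_eq {F X Y : Type*} [Field F] [AddCommGroup X] [Module F X]
    [AddCommGroup Y] [Module F Y] [FiniteDimensional F Y] (T : X →ₗ[F] Module.Dual F Y)
    (hT : Function.Injective T) (χ : Module.Dual F X) : ∃ c : Y, ∀ a, T a c = χ a := by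
  obtain ⟨ψ, hψ⟩ := LinearMap.dualMap_surjective_of_injective hT χ
  obtain ⟨c, hc⟩ := (Module.evalEquiv F Y).surjective ψ
  refine ⟨c, fun a => ?_⟩
  rw [← hψ, ← hc]
  rfl

theorem exists_dual_ne_zero {F X : Type*} [Field F] [AddCommGroup X] [Module F X] {v : X}
    (hv : v ≠ 0) : ∃ f : Module.Dual F X, f v ≠ 0 := by
  by_contra! h
  exact hv ((Module.forall_dual_apply_eq_zero_iff F v).1 h)

variable {F D : Type*} [Field F] [DivisionRing D] [Algebra F D] [FiniteDimensional F D]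

/-- Every linear form on `D` is a left translate of a given nonzero one. -/
theorem exists_left_translate (g : D →ₗ[F] F) (hg : g ≠ 0) (h : D →ₗ[F] F) :
    ∃ a : D, ∀ q, h q = g (a * q) := by
  let T : D →ₗ[F] Module.Dual F D := LinearMap.mk₂ F (fun a q => g (a * q))
    (by intros; simp [add_mul]) (by intros; simp) (by intros; simp [mul_add]) (by intros; simp)
  have hT : Function.Injective T := by
    rw [← LinearMap.ker_eq_bot, LinearMap.ker_eq_bot']
    intro a ha
    by_contra ha0
    apply hg
    ext q
    have := LinearMap.congr_fun ha (a⁻¹ * q)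
    simpa [T, mul_inv_cancel_left₀ ha0] using this
  have hs : Function.Surjective T :=
    (LinearMap.injective_iff_surjective_of_finrank_eq_finrank
      (Subspace.dual_finrank_eq).symm).1 hT
  obtain ⟨a, ha⟩ := hs h
  exact ⟨a, fun q => by rw [← ha]; rfl⟩

/-- Every linear form on `D` is a right translate of a given nonzero one. -/
theorem exists_right_translate (g : D →ₗ[F] F) (hg : g ≠ 0) (h : D →ₗ[F] F) :
    ∃ a : D, ∀ q, h q = g (q * a) := by
  let T : D →ₗ[F] Module.Dual F D := LinearMap.mk₂ F (fun a q => g (q * a))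
    (by intros; simp [mul_add]) (by intros; simp) (by intros; simp [add_mul]) (by intros; simp)
  have hT : Function.Injective T := by
    rw [← LinearMap.ker_eq_bot, LinearMap.ker_eq_bot']
    intro a ha
    by_contra ha0
    apply hg
    ext q
    have := LinearMap.congr_fun ha (q * a⁻¹)
    simpa [T, inv_mul_cancel_right₀ ha0] using this
  have hs : Function.Surjective T :=
    (LinearMap.injective_iff_surjective_of_finrank_eq_finrank
      (Subspace.dual_finrank_eq).symm).1 hT
  obtain ⟨a, ha⟩ := hs h
  exact ⟨a, fun q => by rw [← ha]; rfl⟩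

variable {E E' : Type*} [AddCommGroup E] [Module D E]
  [FiniteDimensional D E] [AddCommGroup E'] [Module F E'] [Module D E'] [IsScalarTower F D E']
  [FiniteDimensional D E']

variable (F D E E') in
theorem finrank_hom :
    Module.finrank F (E →ₗ[D] E') =
      Module.finrank D E * (Module.finrank F D * Module.finrank D E') := by
  let b := Module.finBasis D E
  have : FiniteDimensional F E' := FiniteDimensional.trans F D E'
  rw [← (b.constr (M' := E') F).finrank_eq, Module.finrank_mul_finrank F D E']
  simp [Module.finrank_pi_fintype]

variable (F D E E') in
theorem finiteDimensional_hom : FiniteDimensional F (E →ₗ[D] E') := by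
  let b := Module.finBasis D E
  have : FiniteDimensional F E' := FiniteDimensional.trans F D E'
  exact Module.Finite.equiv (b.constr (M' := E') F)

end Prelim

end InvertibleAffine

namespace InvertibleAffine

/-! ### The dimension bound for operator spaces without fixed vectors. -/

section Abstract

variable {F D : Type*} [Field F] [DivisionRing D] [Algebra F D]
variable {E : Type*} [AddCommGroup E] [Module F E] [Module D E] [IsScalarTower F D E]

/-- No element of `V` has a nonzero fixed vector. -/
def TrivSpec (V : Submodule F (E →ₗ[D] E)) : Prop :=
  ∀ M ∈ V, ∀ x, M x = x → x = 0

/-- The largest `D`-subspace on which a given `F`-linear form vanishes. -/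
def formKer (D : Type*) [DivisionRing D] [Algebra F D] [Module D E] [IsScalarTower F D E]
    (f : Module.Dual F E) : Submodule D E where
  carrier := {z | ∀ a : D, f (a • z) = 0}
  add_mem' := by
    intro u v hu hv a
    simp [smul_add, hu a, hv a]
  zero_mem' := by simp
  smul_mem' := by
    intro c u hu a
    rw [smul_smul]
    exact hu _

theorem apply_eq_zero_of_mem_formKer {f : Module.Dual F E} {z : E} (hz : z ∈ formKer D f) :
    f z = 0 := by
  simpa using hz 1

/-- The evaluation at a vector, as a linear map on endomorphisms. -/
def evalAt (F : Type*) [Field F] [Algebra F D] [Module F E] [IsScalarTower F D E] (x : E) :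
    (E →ₗ[D] E) →ₗ[F] E where
  toFun M := M x
  map_add' _ _ := rfl
  map_smul' _ _ := rfl

@[simp] theorem evalAt_apply (x : E) (M : E →ₗ[D] E) : evalAt F x M = M x := rfl

/-- The linear map `q ↦ q • x`. -/
def spanMap (F : Type*) [Field F] [Algebra F D] [Module F E] [IsScalarTower F D E] (x : E) :
    D →ₗ[F] E :=
  (LinearMap.toSpanSingleton D E x).restrictScalars F

@[simp] theorem spanMap_apply (x : E) (q : D) : spanMap F x q = q • x := rfl

/-- The absence of fixed vectors means exactly that x lies outside the subspace V x, so a linear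
form separates them. -/
theorem TrivSpec.exists_form {V : Submodule F (E →ₗ[D] E)} (hV : TrivSpec V) {x : E}
    (hx : x ≠ 0) : ∃ f : Module.Dual F E, (∀ M ∈ V, f (M x) = 0) ∧ f x = 1 := by
  have hnot : x ∉ V.map (evalAt F x) := by
    rintro ⟨M, hM, hMx⟩
    exact hx (hV M hM x hMx)
  obtain ⟨f, hfx, hf⟩ := Submodule.exists_le_ker_of_notMem hnot
  refine ⟨(f x)⁻¹ • f, fun M hM => ?_, by simp [hfx]⟩
  have : f (M x) = 0 := hf ⟨M, hM, rfl⟩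
  simp [this]

theorem form_ne_zero {f : Module.Dual F E} {x : E} (hx : f x ≠ 0) :
    f ∘ₗ spanMap (D := D) F x ≠ 0 := by
  intro h
  have := LinearMap.congr_fun h 1
  simp [hx] at this

variable [FiniteDimensional F D]

/-- If `f x ≠ 0`, then `E` is the direct sum of `D x` and of the kernel `formKer D f`. -/
theorem exists_coord {f : Module.Dual F E} {x : E} (hx : f x ≠ 0) :
    ∃ c : E →ₗ[D] D, c x = 1 ∧ (∀ z ∈ formKer D f, c z = 0) ∧
      ∀ v, v - c v • x ∈ formKer D f := by
  have hg := form_ne_zero (D := D) hx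
  -- The coordinate of v along x is the unique a such that f (q v) = f (q a x) for all q.
  have hex : ∀ v : E, ∃ a : D, ∀ q : D, f (q • v) = f ((q * a) • x) := fun v => by
    obtain ⟨a, ha⟩ := exists_right_translate _ hg (f ∘ₗ spanMap F v)
    exact ⟨a, ha⟩
  choose c hc using hex
  have huniq : ∀ a b : D, (∀ q : D, f ((q * a) • x) = f ((q * b) • x)) → a = b := by
    intro a b hab
    by_contra hne
    have hne' : a - b ≠ 0 := sub_ne_zero.2 hne
    have := hab (a - b)⁻¹
    rw [← sub_eq_zero, ← map_sub, ← sub_smul, ← mul_sub, inv_mul_cancel₀ hne', one_smul] at this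
    exact hx this
  refine ⟨⟨⟨c, fun u v => huniq _ _ fun q => ?_⟩, fun a v => huniq _ _ fun q => ?_⟩, ?_, ?_, ?_⟩
  · rw [← hc, mul_add, add_smul, map_add, ← hc, ← hc, smul_add, map_add]
  · rw [← hc, RingHom.id_apply, smul_eq_mul, ← mul_assoc, ← hc, smul_smul]
  · exact huniq _ _ fun q => by rw [mul_one]; exact (hc x q).symm
  · intro z hz
    refine huniq _ _ fun q => ?_
    change f ((q * c z) • x) = _
    rw [← hc, hz q]
    simp
  · intro v a
    change f (a • (v - c v • x)) = 0
    rw [smul_sub, smul_smul, map_sub, hc, sub_self]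

variable [FiniteDimensional D E]

/-- A vector `x` such that `V` contains no nonzero operator of rank one with image and kernel
containing `x`. -/
theorem TrivSpec.exists_good {V : Submodule F (E →ₗ[D] E)} (hV : TrivSpec V)
    (hE : 0 < Module.finrank D E) (s : Finset F)
    (hs : Module.finrank D E * Module.finrank F D ≤ s.card) :
    ∃ x : E, x ≠ 0 ∧ ∀ φ : E →ₗ[D] D, φ x = 0 → φ.smulRight x ∈ V → φ = 0 := by
  classical
  have hfin := finiteDimensional_hom F D E D
  -- The kernel of `T x` consists of the rank-one obstructions at x. A nonzero x is taken for which
  -- this kernel has least dimension; a nonzero φ₀ in it will allow a perturbation x + tw with a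
  -- smaller kernel.
  let T : E → (E →ₗ[D] D) →ₗ[F] D × ((E →ₗ[D] E) ⧸ V) := fun x =>
    { toFun := fun φ => (φ x, V.mkQ (φ.smulRight x))
      map_add' := fun φ ψ => by
        have : (φ + ψ).smulRight x = φ.smulRight x + ψ.smulRight x := by
          ext v; simp [add_smul]
        rw [this, map_add]; rfl
      map_smul' := fun a φ => by
        have : (a • φ).smulRight x = a • φ.smulRight x := by
          ext v; simp
        rw [this, map_smul]; rfl }
  have hT : ∀ x φ, T x φ = 0 ↔ φ x = 0 ∧ φ.smulRight x ∈ V := by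
    intro x φ
    rw [Prod.ext_iff]
    simp [T]
  have hTadd : ∀ (x w : E) (t : F) (φ : E →ₗ[D] D), T (x + t • w) φ = T x φ + t • T w φ := by
    intro x w t φ
    have : φ.smulRight (x + t • w) = φ.smulRight x + t • φ.smulRight w := by
      ext v
      change φ v • (x + t • w) = φ v • x + t • φ v • w
      rw [smul_add, smul_comm]
    ext
    · change φ (x + t • w) = φ x + t • φ w
      rw [map_add, LinearMap.map_smul_of_tower]
    · change V.mkQ (φ.smulRight (x + t • w)) = V.mkQ _ + t • V.mkQ _
      rw [this, map_add, map_smul]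
  have hne : ∃ m, ∃ x : E, x ≠ 0 ∧ Module.finrank F (LinearMap.ker (T x)) = m := by
    have := Module.finrank_pos_iff.1 hE
    obtain ⟨x, hx⟩ := exists_ne (0 : E)
    exact ⟨_, x, hx, rfl⟩
  obtain ⟨x, hx, hxm⟩ := Nat.find_spec hne
  have hmin : ∀ y : E, y ≠ 0 → Module.finrank F (LinearMap.ker (T x)) ≤
      Module.finrank F (LinearMap.ker (T y)) := by
    intro y hy
    rw [hxm]
    exact Nat.find_min' hne ⟨y, hy, rfl⟩
  refine ⟨x, hx, fun φ₀ h1 h2 => ?_⟩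
  by_contra hφ₀
  obtain ⟨f, hfV, hfx⟩ := hV.exists_form hx
  have hfx0 : f x ≠ 0 := by rw [hfx]; exact one_ne_zero
  obtain ⟨c, hcx, hcG, hcv⟩ := exists_coord (D := D) hfx0
  obtain ⟨v, hv⟩ : ∃ v, φ₀ v ≠ 0 := by
    by_contra! h
    exact hφ₀ (LinearMap.ext h)
  obtain ⟨w, hwG, hw1⟩ : ∃ w ∈ formKer D f, φ₀ w = 1 := by
    refine ⟨(φ₀ v)⁻¹ • (v - c v • x), Submodule.smul_mem _ _ (hcv v), ?_⟩
    simp [h1, hv]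
  -- For t ≠ 0, an obstruction φ at x + tw satisfies two conditions that do not involve t: f (φ(x)
  -- x) = 0, since f kills V x and w lies in `formKer D f`, and then f (φ(w) x) = 0, since φ(x) = -t
  -- φ(w). The second fails for φ₀. The codimension two of H matches the bound required by
  -- `exists_pencil_finrank_ker_lt`.
  let Ψ : (E →ₗ[D] D) →ₗ[F] F × F :=
    { toFun := fun φ => (f (φ x • x), f (φ w • x))
      map_add' := fun φ ψ => by simp [add_smul]
      map_smul' := fun a φ => by simp }
  have hΨ : Function.Surjective Ψ := by
    rintro ⟨a, b⟩
    refine ⟨a • c + b • φ₀, ?_⟩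
    simp [Ψ, hcx, h1, hcG w hwG, hw1, hfx]
  set H := LinearMap.ker Ψ with hH
  have hHdim : Module.finrank F H + 2 = Module.finrank D E * Module.finrank F D := by
    have := LinearMap.finrank_range_add_finrank_ker Ψ
    rw [LinearMap.range_eq_top.2 hΨ, finrank_top, finrank_hom F D E D] at this
    simp at this
    rw [← this, add_comm]
  have hker : ∀ t : F, t ≠ 0 → LinearMap.ker (T (x + t • w)) ≤ H := by
    intro t ht φ hφ
    obtain ⟨ha, hb⟩ := (hT _ _).1 (LinearMap.mem_ker.1 hφ)
    have e1 := hfV _ hb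
    have hwx : f (φ x • w) = 0 := hwG _
    rw [LinearMap.smulRight_apply, smul_add, map_add, smul_comm (φ x) t w, map_smul f t, hwx, smul_zero,
      add_zero] at e1
    rw [map_add, LinearMap.map_smul_of_tower] at ha
    have e2 : f (φ w • x) = 0 := by
      have : φ x = -(t • φ w) := eq_neg_of_add_eq_zero_left ha
      rw [this, neg_smul, map_neg, neg_eq_zero, smul_assoc, map_smul, smul_eq_mul] at e1
      exact (mul_eq_zero.1 e1).resolve_left ht
    rw [hH, LinearMap.mem_ker]
    exact Prod.ext e1 e2
  have hxw : ∀ t : F, x + t • w ≠ 0 := by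
    intro t h
    have := congrArg c h
    rw [map_add, LinearMap.map_smul_of_tower, hcx, hcG w hwG, smul_zero, add_zero, map_zero] at this
    exact one_ne_zero this
  have hTeq : ∀ t : F, T x + t • T w = T (x + t • w) := fun t =>
    LinearMap.ext fun φ => (hTadd x w t φ).symm
  obtain ⟨t, ht, hlt⟩ := exists_pencil_finrank_ker_lt (T x) (T w) H (fun h => by
      have := congrArg Prod.snd (LinearMap.mem_ker.1 (h ((hT _ _).2 ⟨h1, h2⟩)))
      simp [Ψ, hw1, hfx] at this)
    (fun t ht => by rw [hTeq]; exact hker t ht) s (by omega)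
  rw [hTeq] at hlt
  exact absurd (hmin _ (hxw t)) (not_le.2 hlt)

/-- The operators which `M` induces on the quotient by the line `D x`, for `M ∈ V` with
`M x = 0`. -/
def lineQuotient (V : Submodule F (E →ₗ[D] E)) (x : E) :
    Submodule F ((E ⧸ Submodule.span D {x}) →ₗ[D] (E ⧸ Submodule.span D {x})) where
  carrier := {N | ∃ M ∈ V, M x = 0 ∧ ∀ v, N (Submodule.Quotient.mk v) = Submodule.Quotient.mk (M v)}
  add_mem' := by
    rintro N N' ⟨M, hM, hx, h⟩ ⟨M', hM', hx', h'⟩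
    exact ⟨M + M', V.add_mem hM hM', by simp [hx, hx'], fun v => by simp [h, h']⟩
  zero_mem' := ⟨0, V.zero_mem, rfl, fun v => by simp⟩
  smul_mem' := by
    rintro a N ⟨M, hM, hx, h⟩
    exact ⟨a • M, V.smul_mem a hM, by simp [hx], fun v => by simp [h]⟩

-- If M x = 0 and M v = v + a x, then M (M v) = M v. Hence M v = 0 and v is a multiple of x.
omit [FiniteDimensional F D] [FiniteDimensional D E] in
theorem TrivSpec.lineQuotient {V : Submodule F (E →ₗ[D] E)} (hV : TrivSpec V) (x : E) :
    TrivSpec (lineQuotient V x) := by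
  rintro N ⟨M, hM, hx, h⟩ u hu
  obtain ⟨v, rfl⟩ := Submodule.Quotient.mk_surjective _ u
  rw [h, Submodule.Quotient.eq, Submodule.mem_span_singleton] at hu
  obtain ⟨a, ha⟩ := hu
  have hv := hV M hM (M v) (by
    have : M v = v + a • x := by rw [ha]; abel
    conv_lhs => rw [this]
    simp [hx])
  rw [hv, zero_sub] at ha
  rw [Submodule.Quotient.mk_eq_zero, Submodule.mem_span_singleton]
  exact ⟨-a, by rw [neg_smul, ha, neg_neg]⟩

omit [FiniteDimensional F D] [FiniteDimensional D E] in
theorem finrank_map_evalAt_lt [FiniteDimensional F E] {V : Submodule F (E →ₗ[D] E)} {x : E}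
    {f : Module.Dual F E} (hf : ∀ M ∈ V, f (M x) = 0) (hfx : f x ≠ 0) :
    V.map (evalAt F x) ≤ LinearMap.ker f ∧
    Module.finrank F (LinearMap.ker f) + 1 = Module.finrank F E := by
  refine ⟨?_, ?_⟩
  · rintro _ ⟨M, hM, rfl⟩
    exact hf M hM
  · have hs : Function.Surjective f := LinearMap.surjective (by rintro rfl; simp at hfx)
    have := LinearMap.finrank_range_add_finrank_ker f
    rw [LinearMap.range_eq_top.2 hs, finrank_top, Module.finrank_self] at this
    omega

theorem finrank_eq_evalAt (V : Submodule F (E →ₗ[D] E)) (x : E) :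
    Module.finrank F V = Module.finrank F (V.map (evalAt F x)) +
      Module.finrank F (V ⊓ LinearMap.ker (evalAt F x) : Submodule F (E →ₗ[D] E)) := by
  have := finiteDimensional_hom F D E E
  have h := LinearMap.finrank_range_add_finrank_ker ((evalAt F x).domRestrict V)
  rw [LinearMap.range_domRestrict] at h
  rw [← h, LinearMap.ker_domRestrict, ← Submodule.map_comap_subtype,
    Submodule.finrank_map_subtype_eq]

/-- There are a vector `x` and a form `f` vanishing on `V x` but not at `x`, such that the elements
of `V` that vanish at `x` are determined by the operators that they induce on `E ⧸ D x`. -/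
theorem TrivSpec.exists_good_line {V : Submodule F (E →ₗ[D] E)} (hV : TrivSpec V)
    (hE : 0 < Module.finrank D E) (s : Finset F)
    (hs : Module.finrank D E * Module.finrank F D ≤ s.card) :
    ∃ (x : E) (f : Module.Dual F E), x ≠ 0 ∧ f x = 1 ∧ (∀ M ∈ V, f (M x) = 0) ∧
      Module.finrank F (V ⊓ LinearMap.ker (evalAt F x) : Submodule F (E →ₗ[D] E)) ≤
        Module.finrank F (InvertibleAffine.lineQuotient V x) := by
  obtain ⟨x, hx, hgood⟩ := hV.exists_good hE s hs
  obtain ⟨f, hfV, hfx⟩ := hV.exists_form hx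
  have hfin := finiteDimensional_hom F D (E ⧸ Submodule.span D {x}) (E ⧸ Submodule.span D {x})
  refine ⟨x, f, hx, hfx, hfV, ?_⟩
  obtain ⟨c, hcx, -, -⟩ := exists_coord (D := D) (f := f) (x := x)
    (by rw [hfx]; exact one_ne_zero)
  have hle : ∀ M : E →ₗ[D] E, M x = 0 →
      Submodule.span D {x} ≤ (Submodule.span D {x}).comap M := by
    intro M hM
    rw [Submodule.span_singleton_le_iff_mem, Submodule.mem_comap, hM]
    exact Submodule.zero_mem _
  let Φ : (V ⊓ LinearMap.ker (evalAt F x) : Submodule F (E →ₗ[D] E)) →ₗ[F]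
      InvertibleAffine.lineQuotient V x :=
    { toFun := fun M => ⟨Submodule.mapQ _ _ M.1 (hle M.1 M.2.2), M.1, M.2.1, M.2.2,
        fun v => rfl⟩
      map_add' := fun M N => by
        ext v; rfl
      map_smul' := fun a M => by
        ext v; rfl }
  refine LinearMap.finrank_le_finrank_of_injective (f := Φ)
    ((injective_iff_map_eq_zero Φ).2 ?_)
  rintro ⟨M, hMV, hMx⟩ hM
  -- An operator that kills x and induces zero on the quotient has the form v ↦ φ(v) x with φ(x) =
  -- 0; the choice of x excludes it unless φ = 0.
  have hMv : ∀ v, M v = c (M v) • x := by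
    intro v
    have h8 := LinearMap.congr_fun (congrArg Subtype.val hM) (Submodule.Quotient.mk v)
    have h9 : M v ∈ Submodule.span D {x} :=
      (Submodule.Quotient.mk_eq_zero _).1 h8
    obtain ⟨a, ha⟩ := Submodule.mem_span_singleton.1 h9
    rw [← ha, map_smul, hcx, smul_eq_mul, mul_one]
  have hM' : M = (c ∘ₗ M).smulRight x := LinearMap.ext hMv
  have hMx' : M x = 0 := hMx
  have hφ := hgood (c ∘ₗ M) (by simp [hMx']) (hM' ▸ hMV)
  apply Subtype.ext
  change M = 0
  rw [hM', hφ]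
  ext v
  simp

/-- The dimension bound for spaces of operators without nonzero fixed vectors. -/
theorem TrivSpec.finrank_le_aux (s : Finset F) (n : ℕ) :
    ∀ {E : Type*} [AddCommGroup E] [Module F E] [Module D E] [IsScalarTower F D E]
      [FiniteDimensional D E] {V : Submodule F (E →ₗ[D] E)}, TrivSpec V →
      Module.finrank D E = n → n * Module.finrank F D ≤ s.card →
      2 * Module.finrank F V + 2 * n ≤ Module.finrank F D * (n * (n + 1)) := by
  induction n with
  | zero =>
    intro E _ _ _ _ _ V hV hn hs
    have h1 := finrank_hom F D E E
    have := finiteDimensional_hom F D E E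
    have h2 := Submodule.finrank_le V
    rw [h1, hn] at h2
    simp at h2
    simp [h2]
  | succ n ih =>
    intro E _ _ _ _ _ V hV hn hs
    have := finiteDimensional_hom F D E E
    have : FiniteDimensional F E := FiniteDimensional.trans F D E
    obtain ⟨x, f, hx, hfx, hfV, h4⟩ := hV.exists_good_line (by omega) s (by rwa [hn])
    obtain ⟨h1, h2⟩ := finrank_map_evalAt_lt hfV (by rw [hfx]; exact one_ne_zero)
    have h1' := Submodule.finrank_mono h1
    have h3 := finrank_eq_evalAt V x
    have h5 := Submodule.finrank_quotient_add_finrank (Submodule.span D {x})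
    rw [finrank_span_singleton hx, hn] at h5
    -- The space V x contributes at most (n+1)d - 1 and the operators killing x are bounded on the
    -- quotient, of dimension n. The sum is exactly the bound for n + 1.
    have h6 := ih (hV.lineQuotient x) (by omega) (le_trans (Nat.mul_le_mul_right _ (by omega)) hs)
    have h7 := Module.finrank_mul_finrank F D E
    rw [hn] at h7
    rw [← h7] at h2
    nlinarith

theorem TrivSpec.finrank_le {V : Submodule F (E →ₗ[D] E)} (hV : TrivSpec V) (s : Finset F)
    (hs : Module.finrank D E * Module.finrank F D ≤ s.card) :
    2 * Module.finrank F V + 2 * Module.finrank D E ≤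
      Module.finrank F D * (Module.finrank D E * (Module.finrank D E + 1)) :=
  TrivSpec.finrank_le_aux s _ hV rfl hs

end Abstract

end InvertibleAffine

namespace InvertibleAffine

/-! ### Optimal operator spaces: hyperplanes V x, persistence, compression. -/

section Optimal

variable {F D : Type*} [Field F] [DivisionRing D] [Algebra F D]
variable {E : Type*} [AddCommGroup E] [Module F E] [Module D E] [IsScalarTower F D E]

/-- `V` has no nonzero fixed vectors and the greatest possible dimension. -/
structure IsOpt (V : Submodule F (E →ₗ[D] E)) : Prop where
  triv : TrivSpec V
  dim : 2 * Module.finrank F V + 2 * Module.finrank D E =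
    Module.finrank F D * (Module.finrank D E * (Module.finrank D E + 1))

/-- The operators on the direct summand `G` whose extension by zero belongs to `V`. -/
def compress (G : Submodule D E) (p : E →ₗ[D] G) (V : Submodule F (E →ₗ[D] E)) :
    Submodule F (G →ₗ[D] G) where
  carrier := {N | G.subtype ∘ₗ N ∘ₗ p ∈ V}
  add_mem' := by
    intro N N' h h'
    simpa [LinearMap.add_comp, LinearMap.comp_add] using V.add_mem h h'
  zero_mem' := by simp
  smul_mem' := by
    intro a N h
    have : G.subtype ∘ₗ (a • N) ∘ₗ p = a • (G.subtype ∘ₗ N ∘ₗ p) := rfl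
    change _ ∈ V
    rw [this]
    exact V.smul_mem a h

theorem TrivSpec.compress {V : Submodule F (E →ₗ[D] E)} (hV : TrivSpec V) {G : Submodule D E}
    {p : E →ₗ[D] G} (hp : ∀ g : G, p g = g) : TrivSpec (compress G p V) := by
  intro N hN z hz
  have := hV _ hN z (by simp [hp, hz])
  exact Subtype.ext this

/-- The projection on `formKer D f` along `x`. -/
def projKer {f : Module.Dual F E} {x : E} {c : E →ₗ[D] D}
    (h : ∀ v, v - c v • x ∈ formKer D f) : E →ₗ[D] formKer D f :=
  LinearMap.codRestrict _ (LinearMap.id - c.smulRight x) h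

theorem coe_projKer {f : Module.Dual F E} {x : E} {c : E →ₗ[D] D}
    (h : ∀ v, v - c v • x ∈ formKer D f) (v : E) : (projKer h v : E) = v - c v • x := rfl

theorem add_projKer {f : Module.Dual F E} {x : E} {c : E →ₗ[D] D}
    (h : ∀ v, v - c v • x ∈ formKer D f) (v : E) : c v • x + (projKer h v : E) = v := by
  rw [coe_projKer, add_sub_cancel]

theorem projKer_coe {f : Module.Dual F E} {x : E} {c : E →ₗ[D] D}
    (h : ∀ v, v - c v • x ∈ formKer D f) (hG : ∀ z ∈ formKer D f, c z = 0)
    (g : formKer D f) : projKer h g = g := by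
  apply Subtype.ext
  rw [coe_projKer, hG g g.2, zero_smul, sub_zero]

theorem projKer_self {f : Module.Dual F E} {x : E} {c : E →ₗ[D] D}
    (h : ∀ v, v - c v • x ∈ formKer D f) (hx : c x = 1) : projKer h x = 0 := by
  apply Subtype.ext
  rw [coe_projKer, hx, one_smul, sub_self]
  rfl

variable [FiniteDimensional D E]

theorem finrank_formKer {f : Module.Dual F E} {x : E} {c : E →ₗ[D] D}
    (h : ∀ v, v - c v • x ∈ formKer D f) (hG : ∀ z ∈ formKer D f, c z = 0) (hx : c x = 1) :
    Module.finrank D (formKer D f) + 1 = Module.finrank D E := by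
  have hker : formKer D f = LinearMap.ker c := by
    ext v
    refine ⟨fun hv => hG v hv, fun hv => ?_⟩
    have := h v
    rwa [LinearMap.mem_ker.1 hv, zero_smul, sub_zero] at this
  have hs : Function.Surjective c := fun a => ⟨a • x, by rw [map_smul, hx, smul_eq_mul, mul_one]⟩
  have := LinearMap.finrank_range_add_finrank_ker c
  rw [LinearMap.range_eq_top.2 hs, finrank_top, Module.finrank_self, ← hker] at this
  omega

variable [FiniteDimensional F D]

/-- The elements killing x have their range in `formKer D f`, because f kills M (a z) = a M z for
every a. Such an element is the same as an operator on this complement, extended by zero at x. -/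
theorem finrank_compress_formKer {V : Submodule F (E →ₗ[D] E)} {f : Module.Dual F E} {x : E}
    {c : E →ₗ[D] D} (h : ∀ v, v - c v • x ∈ formKer D f) (hG : ∀ z ∈ formKer D f, c z = 0)
    (hx : c x = 1) (hV : ∀ M ∈ V, M x = 0 → ∀ z, f (M z) = 0) :
    Module.finrank F (V ⊓ LinearMap.ker (evalAt F x) : Submodule F (E →ₗ[D] E)) =
      Module.finrank F (compress (formKer D f) (projKer h) V) := by
  have := finiteDimensional_hom F D E E
  have := finiteDimensional_hom F D (formKer D f) (formKer D f)
  have hmem : ∀ M ∈ V, M x = 0 → ∀ z, M z ∈ formKer D f := by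
    intro M hM hMx z a
    rw [← map_smul]
    exact hV M hM hMx _
  have hMeq : ∀ (M : E →ₗ[D] E) (hM : M ∈ V) (hMx : M x = 0),
      (formKer D f).subtype ∘ₗ (LinearMap.codRestrict (formKer D f) (M ∘ₗ (formKer D f).subtype)
        (fun z => hmem M hM hMx z)) ∘ₗ projKer h = M := by
    intro M hM hMx
    ext v
    change M (projKer h v) = M v
    conv_rhs => rw [← add_projKer h v, map_add, map_smul, hMx, smul_zero, zero_add]
  let Φ : (V ⊓ LinearMap.ker (evalAt F x) : Submodule F (E →ₗ[D] E)) →ₗ[F]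
      compress (formKer D f) (projKer h) V :=
    { toFun := fun M => ⟨LinearMap.codRestrict (formKer D f) (M.1 ∘ₗ (formKer D f).subtype)
        (fun z => hmem M.1 M.2.1 M.2.2 z), by
          change _ ∈ V
          rw [hMeq M.1 M.2.1 M.2.2]
          exact M.2.1⟩
      map_add' := fun M N => rfl
      map_smul' := fun a M => rfl }
  let Ψ : compress (formKer D f) (projKer h) V →ₗ[F]
      (V ⊓ LinearMap.ker (evalAt F x) : Submodule F (E →ₗ[D] E)) :=
    { toFun := fun N => ⟨(formKer D f).subtype ∘ₗ N.1 ∘ₗ projKer h, N.2, by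
        change ((N.1 (projKer h x) : formKer D f) : E) = 0
        rw [projKer_self h hx, map_zero]
        rfl⟩
      map_add' := fun M N => by
        ext v
        simp
      map_smul' := fun a M => rfl }
  refine le_antisymm (LinearMap.finrank_le_finrank_of_injective (f := Φ)
    ((injective_iff_map_eq_zero Φ).2 ?_)) (LinearMap.finrank_le_finrank_of_injective (f := Ψ) ?_)
  · rintro ⟨M, hM, hMx⟩ h0
    apply Subtype.ext
    change M = 0
    rw [← hMeq M hM hMx]
    have : LinearMap.codRestrict (formKer D f) (M ∘ₗ (formKer D f).subtype)
        (fun z => hmem M hM hMx z) = 0 := congrArg Subtype.val h0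
    rw [this]
    rfl
  · rintro ⟨N, hN⟩ ⟨N', hN'⟩ h0
    apply Subtype.ext
    ext z
    have h1 := LinearMap.congr_fun (congrArg Subtype.val h0) (z : E)
    change ((N (projKer h z) : formKer D f) : E) = N' (projKer h z) at h1
    rw [projKer_coe h hG] at h1
    exact h1

/-- If `V x` is a hyperplane, the kernel of `f`, then `f` vanishes at every vector that belongs to
`V (z - a x)` for all scalars `a`. -/
theorem TrivSpec.persistence {V : Submodule F (E →ₗ[D] E)} (hV : TrivSpec V) {x z w : E}
    {f : Module.Dual F E} (hf : V.map (evalAt F x) = LinearMap.ker f) (s : Finset F)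
    (hs : Module.finrank D E * Module.finrank F D ≤ s.card)
    (h : ∀ a : F, ∃ M ∈ V, M (z - a • x) = w) : f w = 0 := by
  by_contra hfw
  have : FiniteDimensional F E := FiniteDimensional.trans F D E
  have := finiteDimensional_hom F D E E
  have hV1 : ∀ M ∈ V, M x ∈ LinearMap.ker f := fun M hM => hf ▸ ⟨M, hM, rfl⟩
  let q : V →ₗ[F] LinearMap.ker f :=
    LinearMap.codRestrict _ ((evalAt F x).domRestrict V) (fun M => hV1 M.1 M.2)
  have hq : Function.Surjective q := by
    rintro ⟨v, hv⟩
    rw [← hf] at hv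
    obtain ⟨M, hM, hMv⟩ := hv
    exact ⟨⟨M, hM⟩, Subtype.ext hMv⟩
  obtain ⟨S, hS⟩ := q.exists_rightInverse_of_surjective (LinearMap.range_eq_top.2 hq)
  have hSx : ∀ v : LinearMap.ker f, (S v).1 x = v := fun v =>
    congrArg Subtype.val (LinearMap.congr_fun hS v)
  let p : E →ₗ[F] LinearMap.ker f :=
    LinearMap.codRestrict _ (LinearMap.id - ((f w)⁻¹ • f).smulRight w) (fun v => by
      simp [mul_right_comm, hfw])
  have hp : ∀ v, (p v : E) = v - ((f w)⁻¹ * f v) • w := fun v => rfl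
  have hpk : ∀ v : LinearMap.ker f, p v = v := by
    rintro ⟨v, hv⟩
    apply Subtype.ext
    rw [hp, LinearMap.mem_ker.1 hv]
    simp
  have hdim : Module.finrank F (LinearMap.ker f) + 1 = Module.finrank F E := by
    have hs : Function.Surjective f := LinearMap.surjective (by rintro rfl; simp at hfw)
    have := LinearMap.finrank_range_add_finrank_ker f
    rw [LinearMap.range_eq_top.2 hs, finrank_top, Module.finrank_self] at this
    omega
  -- Modulo w, evaluation at y along a section of M ↦ M x is an endomorphism `R y` of ker f, and R
  -- (z - a x) = R z - a. If a is not an eigenvalue of `R z`, then V (z - a x) together with w fills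
  -- E, so it contains z - a x. The absence of fixed vectors gives z - a x = 0, hence w = 0. Since
  -- dim ker f = nd - 1, some a in `s` is not an eigenvalue.
  let R : E → LinearMap.ker f →ₗ[F] LinearMap.ker f := fun y =>
    p ∘ₗ (evalAt F y) ∘ₗ V.subtype ∘ₗ S
  have hR : ∀ y v, R y v = p ((S v).1 y) := fun y v => rfl
  have := card_le_finrank_of_forall_eigenvalue (R z) s (by
    intro a _
    by_contra! hcon
    obtain ⟨M, hM, hMw⟩ := h a
    have hRa : ∀ v, R (z - a • x) v = R z v - a • v := by
      intro v
      rw [hR, hR, map_sub, LinearMap.map_smul_of_tower, hSx, map_sub, map_smul, hpk]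
    have hinj : Function.Injective (R (z - a • x)) := by
      refine (injective_iff_map_eq_zero _).2 fun v hv => ?_
      by_contra hv0
      rw [hRa, sub_eq_zero] at hv
      exact hcon v hv0 hv
    have hsurj := LinearMap.injective_iff_surjective.1 hinj
    have hall : ∀ e : E, ∃ N ∈ V, N (z - a • x) = e := by
      intro e
      obtain ⟨v, hv⟩ := hsurj (p e)
      have h1 := congrArg Subtype.val hv
      rw [hR, hp, hp] at h1
      refine ⟨(S v).1 + ((f w)⁻¹ * f e - (f w)⁻¹ * f ((S v).1 (z - a • x))) • M,
        V.add_mem (S v).2 (V.smul_mem _ hM), ?_⟩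
      rw [LinearMap.add_apply, LinearMap.smul_apply, hMw, sub_smul]
      rw [sub_eq_sub_iff_add_eq_add] at h1
      rw [← add_sub_assoc, h1, add_sub_cancel_right]
    obtain ⟨N, hN, hNz⟩ := hall (z - a • x)
    have hz0 := hV N hN _ hNz
    rw [hz0, map_zero] at hMw
    rw [← hMw, map_zero] at hfw
    exact hfw rfl)
  have h7 := Module.finrank_mul_finrank F D E
  rw [mul_comm] at h7
  omega

/-- Persistence with a constant choice: M (z - a x) = M z for all a. -/
theorem TrivSpec.apply_eq_zero_of_apply_eq_zero {V : Submodule F (E →ₗ[D] E)} (hV : TrivSpec V)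
    {x : E} {f : Module.Dual F E} (hf : V.map (evalAt F x) = LinearMap.ker f) (s : Finset F)
    (hs : Module.finrank D E * Module.finrank F D ≤ s.card) {M : E →ₗ[D] E} (hM : M ∈ V)
    (hMx : M x = 0) (z : E) : f (M z) = 0 :=
  hV.persistence hf s hs (z := z) fun a => ⟨M, hM, by
    rw [map_sub, LinearMap.map_smul_of_tower, hMx, smul_zero, sub_zero]⟩

/-- Persistence with the operators M₁ - a M₀: at z - a x the term in a is -(M₁ x + M₀ z) = 0 and the
term in a² involves M₀ x = 0, so the value is M₁ z for all a. -/
theorem TrivSpec.apply_eq_zero_of_add_eq_zero {V : Submodule F (E →ₗ[D] E)} (hV : TrivSpec V)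
    {x : E} {f : Module.Dual F E} (hf : V.map (evalAt F x) = LinearMap.ker f) (s : Finset F)
    (hs : Module.finrank D E * Module.finrank F D ≤ s.card) {M₀ M₁ : E →ₗ[D] E} (hM₀ : M₀ ∈ V)
    (hM₁ : M₁ ∈ V) (hx : M₀ x = 0) {z : E} (hz : M₀ z + M₁ x = 0) : f (M₁ z) = 0 :=
  hV.persistence hf s hs (z := z) fun a => ⟨M₁ - a • M₀, V.sub_mem hM₁ (V.smul_mem a hM₀), by
    rw [LinearMap.sub_apply, LinearMap.smul_apply, map_sub, map_sub, LinearMap.map_smul_of_tower,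
      LinearMap.map_smul_of_tower, hx, smul_zero, sub_zero, eq_neg_of_add_eq_zero_left hz, smul_neg]
    abel⟩

/-- An optimal space has a vector `x` such that `V x` is a hyperplane not containing `x`. -/
theorem IsOpt.exists_hyperplane {V : Submodule F (E →ₗ[D] E)} (hV : IsOpt V)
    (hE : 0 < Module.finrank D E) (s : Finset F)
    (hs : Module.finrank D E * Module.finrank F D ≤ s.card) :
    ∃ (x : E) (f : Module.Dual F E), f x = 1 ∧ V.map (evalAt F x) = LinearMap.ker f := by
  have : FiniteDimensional F E := FiniteDimensional.trans F D E
  obtain ⟨x, f, hx, hfx, hfV, h4⟩ := hV.triv.exists_good_line hE s hs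
  refine ⟨x, f, hfx, ?_⟩
  obtain ⟨h1, h2⟩ := finrank_map_evalAt_lt hfV (by rw [hfx]; exact one_ne_zero)
  -- The operators killing x obey the bound for the quotient by D x, so equality in the bound leaves
  -- at least nd - 1 for dim V x.
  refine Submodule.eq_of_le_of_finrank_le h1 ?_
  have h3 := finrank_eq_evalAt V x
  have h5 := Submodule.finrank_quotient_add_finrank (Submodule.span D {x})
  rw [finrank_span_singleton hx] at h5
  have h6 := (hV.triv.lineQuotient x).finrank_le s
    (le_trans (Nat.mul_le_mul_right _ (by omega)) hs)
  have h7 := Module.finrank_mul_finrank F D E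
  rw [← h7] at h2
  have h8 := hV.dim
  generalize Module.finrank D (E ⧸ Submodule.span D {x}) = m at *
  rw [← h5] at h2 h8
  nlinarith

/-- In an optimal space, if `V x` is the hyperplane `ker f`, then the elements of `V` which vanish
at `x` form an optimal space on `formKer D f`. -/
theorem IsOpt.compress {V : Submodule F (E →ₗ[D] E)} (hV : IsOpt V) (s : Finset F)
    (hs : Module.finrank D E * Module.finrank F D ≤ s.card) {x : E} {f : Module.Dual F E}
    (hf : V.map (evalAt F x) = LinearMap.ker f) (hfx : f x ≠ 0) {c : E →ₗ[D] D}
    (h : ∀ v, v - c v • x ∈ formKer D f) (hG : ∀ z ∈ formKer D f, c z = 0) (hx : c x = 1) :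
    IsOpt (InvertibleAffine.compress (formKer D f) (projKer h) V) := by
  have : FiniteDimensional F E := FiniteDimensional.trans F D E
  refine ⟨hV.triv.compress (projKer_coe h hG), ?_⟩
  rw [← finrank_compress_formKer h hG hx
    (fun M hM hMx z => hV.triv.apply_eq_zero_of_apply_eq_zero hf s hs hM hMx z)]
  obtain ⟨h1, h2⟩ := finrank_map_evalAt_lt (V := V) (x := x) (f := f)
    (fun M hM => by
      have : M x ∈ LinearMap.ker f := hf ▸ ⟨M, hM, rfl⟩
      exact this) hfx
  have h3 := finrank_eq_evalAt V x
  rw [hf] at h3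
  have h5 := finrank_formKer h hG hx
  have h7 := Module.finrank_mul_finrank F D E
  have h8 := hV.dim
  rw [← h7] at h2
  rw [← h5] at h2 h8
  nlinarith

end Optimal

end InvertibleAffine

namespace InvertibleAffine

/-! ### Involutions and forms that are nonisotropic modulo their radical. -/

section Forms

variable {F D : Type*} [Field F] [DivisionRing D] [Algebra F D]
variable {E : Type*} [AddCommGroup E] [Module F E] [Module D E] [IsScalarTower F D E]

/-- `σ` is an involution of the division algebra `D` for which all norms `σ a * a` are scalars. -/
structure IsInvol (σ : D →ₗ[F] D) : Prop where
  mul : ∀ a b, σ (a * b) = σ b * σ a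
  invol : ∀ a, σ (σ a) = a
  norm : ∀ a, ∃ ν : F, σ a * a = algebraMap F D ν

theorem IsInvol.map_ne_zero {σ : D →ₗ[F] D} (hσ : IsInvol σ) {a : D} (ha : a ≠ 0) : σ a ≠ 0 :=
  fun h => ha (by rw [← hσ.invol a, h, map_zero])

theorem IsInvol.map_one {σ : D →ₗ[F] D} (hσ : IsInvol σ) : σ 1 = 1 := by
  have h := hσ.mul 1 1
  rw [mul_one] at h
  exact (mul_eq_left₀ (hσ.map_ne_zero one_ne_zero)).1 h.symm

theorem IsInvol.map_algebraMap {σ : D →ₗ[F] D} (hσ : IsInvol σ) (a : F) :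
    σ (algebraMap F D a) = algebraMap F D a := by
  rw [Algebra.algebraMap_eq_smul_one, map_smul, hσ.map_one]

/-- A sesquilinear form (with values in `F`) which is nonisotropic modulo its radical. -/
structure NIForm (σ : D →ₗ[F] D) (B : E →ₗ[F] Module.Dual F E) : Prop where
  sesq : ∀ (a : D) u w, B (a • u) w = B u (σ a • w)
  left : ∀ u, B u u = 0 → B u = 0
  right : ∀ u, B u u = 0 → ∀ w, B w u = 0

/-- An isotropic vector pairs to zero on both sides, so B z z depends only on z modulo such vectors.
In particular they form a subspace. -/
theorem NIForm.add_self {σ : D →ₗ[F] D} {B : E →ₗ[F] Module.Dual F E} (hB : NIForm σ B) {u : E}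
    (hu : B u u = 0) (z : E) : B (z + u) (z + u) = B z z := by
  rw [map_add B, hB.left u hu, add_zero, map_add, hB.right u hu, add_zero]

theorem NIForm.smul_self_eq_zero {σ : D →ₗ[F] D} {B : E →ₗ[F] Module.Dual F E} (hB : NIForm σ B)
    {u : E} (h : B u u = 0) (a : D) : B (a • u) (a • u) = 0 := by
  rw [hB.sesq, hB.left u h]
  rfl

/-- Testing B (a u) on (σ a)⁻¹ u returns B u u. Hence q ↦ B (q u) is injective, and scalars of D can
be recovered from linear forms. -/
theorem NIForm.smul_eq_zero {σ : D →ₗ[F] D} (hσ : IsInvol σ) {B : E →ₗ[F] Module.Dual F E}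
    (hB : NIForm σ B) {u : E} (hu : B u u ≠ 0) {a : D} (h : B (a • u) = 0) : a = 0 := by
  by_contra ha
  apply hu
  have h1 := LinearMap.congr_fun h ((σ a)⁻¹ • u)
  rwa [hB.sesq, smul_smul, mul_inv_cancel₀ (hσ.map_ne_zero ha), one_smul] at h1

/-- The radical of the form, as a subspace over `D`. -/
def NIForm.radical {σ : D →ₗ[F] D} {B : E →ₗ[F] Module.Dual F E} (hB : NIForm σ B) :
    Submodule D E where
  carrier := {u | B u u = 0}
  add_mem' := by
    intro u v hu hv
    change B (u + v) (u + v) = 0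
    rw [hB.add_self hv]
    exact hu
  zero_mem' := by simp
  smul_mem' := fun a u hu => hB.smul_self_eq_zero hu a

variable [FiniteDimensional F D] [FiniteDimensional D E]

/-- In an optimal space `V` such that `B u (M u) = 0` for all `M ∈ V`, the space `V u` is the whole
kernel of `B u` as soon as `u` is not in the radical of `B`. -/
theorem IsOpt.exists_apply_eq {V : Submodule F (E →ₗ[D] E)} (hV : IsOpt V) (s : Finset F)
    (hs : Module.finrank D E * Module.finrank F D ≤ s.card) {B : E →ₗ[F] Module.Dual F E}
    (hBV : ∀ M ∈ V, ∀ u, B u (M u) = 0) {u w : E} (hu : B u u ≠ 0) (hw : B u w = 0) :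
    ∃ M ∈ V, M u = w := by
  have : FiniteDimensional F E := FiniteDimensional.trans F D E
  obtain ⟨c, hcx, hcG, hc⟩ := exists_coord (D := D) hu
  have h0 := finrank_compress_formKer (V := V) hc hcG hcx (fun M hM hMx z => by
    have h1 := hBV M hM (u + z)
    rwa [map_add M, hMx, zero_add, map_add, LinearMap.add_apply, hBV M hM z, add_zero] at h1)
  obtain ⟨h1, h2⟩ := finrank_map_evalAt_lt (V := V) (x := u) (f := B u)
    (fun M hM => hBV M hM u) hu
  have h3 := finrank_eq_evalAt V u
  have h5 := finrank_formKer hc hcG hcx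
  have h6 := (hV.triv.compress (projKer_coe hc hcG)).finrank_le s
    (le_trans (Nat.mul_le_mul_right _ (by omega)) hs)
  rw [← h0] at h6
  have h7 := Module.finrank_mul_finrank F D E
  have h8 := hV.dim
  rw [← h7] at h2
  generalize Module.finrank D (formKer D (B u)) = m at *
  rw [← h5] at h2 h8
  have h9 := Submodule.eq_of_le_of_finrank_le h1 (by nlinarith)
  have hw' : w ∈ LinearMap.ker (B u) := hw
  rw [← h9] at hw'
  exact hw'

end Forms

/-! ### Splitting E along x and gluing a form on the complement. -/

section Frame

variable {F D : Type*} [Field F] [DivisionRing D] [Algebra F D]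
variable {E : Type*} [AddCommGroup E] [Module F E] [Module D E] [IsScalarTower F D E]

/-- A vector `x` for which `V x` is the hyperplane `ker f`, and the coordinate `c` along `x` for the
decomposition of `E` as the direct sum of `D x` and `formKer D f`. -/
structure Frame (V : Submodule F (E →ₗ[D] E)) (x : E) (f : Module.Dual F E) (c : E →ₗ[D] D) :
    Prop where
  opt : IsOpt V
  form_self : f x = 1
  hyper : V.map (evalAt F x) = LinearMap.ker f
  coord_self : c x = 1
  coord_ker : ∀ z ∈ formKer D f, c z = 0
  sub_mem : ∀ v, v - c v • x ∈ formKer D f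

variable {V : Submodule F (E →ₗ[D] E)} {x : E} {f : Module.Dual F E} {c : E →ₗ[D] D}

theorem Frame.form_ne_zero (fr : Frame V x f c) : f x ≠ 0 := by
  rw [fr.form_self]; exact one_ne_zero

theorem Frame.form_apply (fr : Frame V x f c) {M : E →ₗ[D] E} (hM : M ∈ V) : f (M x) = 0 := by
  have : M x ∈ LinearMap.ker f := fr.hyper ▸ ⟨M, hM, rfl⟩
  exact this

theorem Frame.form_smul (fr : Frame V x f c) (a : D) (v : E) : f (a • v) = f ((a * c v) • x) := by
  have h := fr.sub_mem v a
  rw [smul_sub, map_sub, sub_eq_zero, smul_smul] at h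
  exact h

theorem Frame.mem_formKer_of_coord (fr : Frame V x f c) {v : E} (h : c v = 0) :
    v ∈ formKer D f := by
  have := fr.sub_mem v
  rwa [h, zero_smul, sub_zero] at this

/-- The complement lies in ker f = V x, and the surjection M ↦ M x onto ker f splits linearly. -/
theorem Frame.exists_section (fr : Frame V x f c) :
    ∃ S : formKer D f →ₗ[F] (E →ₗ[D] E), (∀ g, S g ∈ V) ∧ ∀ g, S g x = g := by
  let q : V →ₗ[F] LinearMap.ker f :=
    LinearMap.codRestrict _ ((evalAt F x).domRestrict V) (fun M => fr.form_apply M.2)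
  have hq : Function.Surjective q := by
    rintro ⟨v, hv⟩
    rw [← fr.hyper] at hv
    obtain ⟨M, hM, hMv⟩ := hv
    exact ⟨⟨M, hM⟩, Subtype.ext hMv⟩
  obtain ⟨S, hS⟩ := q.exists_rightInverse_of_surjective (LinearMap.range_eq_top.2 hq)
  let ι : formKer D f →ₗ[F] LinearMap.ker f :=
    LinearMap.codRestrict _ ((formKer D f).subtype.restrictScalars F)
      (fun g => apply_eq_zero_of_mem_formKer g.2)
  refine ⟨V.subtype ∘ₗ S ∘ₗ ι, fun g => (S (ι g)).2, fun g => ?_⟩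
  exact congrArg Subtype.val (LinearMap.congr_fun hS (ι g))

/-- The form `(s x + z, t x + w) ↦ κ f ((τ z - σ s) t x) + B' z w`. -/
def glue (σ : D →ₗ[F] D) {V : Submodule F (E →ₗ[D] E)} {x : E} {f : Module.Dual F E}
    {c : E →ₗ[D] D} (fr : Frame V x f c) (κ : F) (τ : formKer D f →ₗ[F] D)
    (B' : formKer D f →ₗ[F] Module.Dual F (formKer D f)) : E →ₗ[F] Module.Dual F E :=
  LinearMap.mk₂ F (fun u v => κ * f (((τ (projKer fr.sub_mem u) - σ (c u)) * c v) • x) +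
      B' (projKer fr.sub_mem u) (projKer fr.sub_mem v))
    (by intro u v w; simp only [map_add, LinearMap.add_apply, add_sub_add_comm, add_mul, add_smul]
        ring)
    (by intro a u v
        simp only [LinearMap.map_smul_of_tower, LinearMap.smul_apply, ← smul_sub, smul_mul_assoc,
          smul_assoc, smul_eq_mul]
        ring)
    (by intro u v w; simp only [map_add, mul_add, add_smul]
        ring)
    (by intro a u v
        simp only [LinearMap.map_smul_of_tower, mul_smul_comm, smul_assoc, smul_eq_mul]
        ring)

theorem glue_apply (σ : D →ₗ[F] D) (fr : Frame V x f c) (κ : F) (τ : formKer D f →ₗ[F] D)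
    (B' : formKer D f →ₗ[F] Module.Dual F (formKer D f)) (u v : E) :
    glue σ fr κ τ B' u v = κ * f (((τ (projKer fr.sub_mem u) - σ (c u)) * c v) • x) +
      B' (projKer fr.sub_mem u) (projKer fr.sub_mem v) := rfl

theorem form_norm {σ : D →ₗ[F] D} (hσ : IsInvol σ) (fr : Frame V x f c) {s : D}
    (h : f ((σ s * s) • x) = 0) : s = 0 := by
  obtain ⟨ν, hν⟩ := hσ.norm s
  rw [hν, algebraMap_smul, map_smul, fr.form_self, smul_eq_mul, mul_one] at h
  rw [h, map_zero] at hν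
  by_contra hs
  exact mul_ne_zero (hσ.map_ne_zero hs) hs hν

/-- By `hne`, an isotropic vector s x + z of the glued form has z in the radical of B'. Then τ z = 0
and only the norm term -κ f (σ(s) s x) remains, which forces s = 0. Hence the new radical is that of
B'. -/
theorem glue_niForm {σ : D →ₗ[F] D} (hσ : IsInvol σ) (fr : Frame V x f c) {κ : F} (hκ : κ ≠ 0)
    {τ : formKer D f →ₗ[F] D} {B' : formKer D f →ₗ[F] Module.Dual F (formKer D f)}
    (hB' : NIForm σ B') (hτ : ∀ (a : D) z, τ (a • z) = τ z * σ a)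
    (hτ0 : ∀ z, B' z z = 0 → τ z = 0)
    (hne : ∀ u, B' (projKer fr.sub_mem u) (projKer fr.sub_mem u) ≠ 0 →
      glue σ fr κ τ B' u u ≠ 0) : NIForm σ (glue σ fr κ τ B') ∧ glue σ fr κ τ B' ≠ 0 := by
  have key : ∀ u, glue σ fr κ τ B' u u = 0 →
      c u = 0 ∧ B' (projKer fr.sub_mem u) (projKer fr.sub_mem u) = 0 := by
    intro u hu
    have h1 : B' (projKer fr.sub_mem u) (projKer fr.sub_mem u) = 0 := by
      by_contra h
      exact hne u h hu
    refine ⟨?_, h1⟩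
    rw [glue_apply, h1, hτ0 _ h1, add_zero, zero_sub, neg_mul, neg_smul, map_neg] at hu
    exact form_norm hσ fr (neg_eq_zero.1 ((mul_eq_zero.1 hu).resolve_left hκ))
  refine ⟨⟨?_, ?_, ?_⟩, ?_⟩
  · intro a u w
    rw [glue_apply, glue_apply]
    simp only [map_smul, smul_eq_mul]
    rw [hτ, hσ.mul, ← sub_mul, mul_assoc, hB'.sesq]
  · intro u hu
    obtain ⟨h1, h2⟩ := key u hu
    ext w
    rw [glue_apply, h1, hτ0 _ h2, hB'.left _ h2]
    simp
  · intro u hu w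
    obtain ⟨h1, h2⟩ := key u hu
    rw [glue_apply, h1, hB'.right _ h2]
    simp
  · intro h
    have := LinearMap.congr_fun (LinearMap.congr_fun h x) x
    rw [glue_apply, fr.coord_self, projKer_self fr.sub_mem fr.coord_self, hσ.map_one] at this
    simp [fr.form_self, hκ] at this

/-- Let s = c u. Only -κ f (σ(s) c(Mu) x) survives, and c(Mu) = s c(Mx) because M sends the
remaining part of u into the complement. Since σ(s) s is a scalar ν, this is -κ ν f (M x) = 0. -/
theorem glue_apply_eq_zero {σ : D →ₗ[F] D} (hσ : IsInvol σ) (fr : Frame V x f c) {κ : F}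
    {τ : formKer D f →ₗ[F] D} {B' : formKer D f →ₗ[F] Module.Dual F (formKer D f)}
    {M : E →ₗ[D] E} (hM : M ∈ V) {u : E} (hτ : τ (projKer fr.sub_mem u) = 0)
    (hB' : B' (projKer fr.sub_mem u) = 0) (hMu : M (projKer fr.sub_mem u) ∈ formKer D f) :
    glue σ fr κ τ B' u (M u) = 0 := by
  have h1 : c (M u) = c u * c (M x) := by
    conv_lhs => rw [← add_projKer fr.sub_mem u]
    rw [map_add, map_add, fr.coord_ker _ hMu, add_zero, map_smul, map_smul, smul_eq_mul]
  obtain ⟨ν, hν⟩ := hσ.norm (c u)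
  rw [glue_apply, hτ, hB', h1, zero_sub, neg_mul, ← mul_assoc, hν, neg_smul, map_neg,
    ← fr.form_smul, algebraMap_smul, map_smul, fr.form_apply hM]
  simp

/-- If `formKer D f` is stable, then the form `(s x + z, t x + w) ↦ f (σ s t x)` is a solution. -/
theorem Frame.exists_form_of_stable {σ : D →ₗ[F] D} (hσ : IsInvol σ) (fr : Frame V x f c)
    (hst : ∀ M ∈ V, ∀ g ∈ formKer D f, M g ∈ formKer D f) :
    ∃ B : E →ₗ[F] Module.Dual F E, NIForm σ B ∧ B ≠ 0 ∧ ∀ M ∈ V, ∀ u, B u (M u) = 0 := by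
  obtain ⟨h1, h2⟩ := glue_niForm hσ fr (κ := -1) (by simp) (τ := 0) (B' := 0)
    ⟨by simp, by simp, by simp⟩ (by simp) (by simp) (by simp)
  exact ⟨_, h1, h2, fun M hM u => glue_apply_eq_zero hσ fr hM rfl rfl (hst M hM _ (Subtype.mem _))⟩

end Frame

end InvertibleAffine

namespace InvertibleAffine

/-! ### Transferring information from the complement to the whole space. -/

section Top

variable {F D : Type*} [Field F] [DivisionRing D] [Algebra F D] [FiniteDimensional F D]
variable {E : Type*} [AddCommGroup E] [Module F E] [Module D E] [IsScalarTower F D E]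
  [FiniteDimensional D E]
variable {V : Submodule F (E →ₗ[D] E)} {x : E} {f : Module.Dual F E} {c : E →ₗ[D] D}

theorem Frame.isOpt_compress (fr : Frame V x f c) (s : Finset F)
    (hs : Module.finrank D E * Module.finrank F D ≤ s.card) :
    IsOpt (compress (formKer D f) (projKer fr.sub_mem) V) :=
  fr.opt.compress s hs fr.hyper fr.form_ne_zero fr.sub_mem fr.coord_ker fr.coord_self

theorem Frame.finrank_add_one (fr : Frame V x f c) :
    Module.finrank D (formKer D f) + 1 = Module.finrank D E :=
  finrank_formKer fr.sub_mem fr.coord_ker fr.coord_self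

theorem Frame.card_le (fr : Frame V x f c) (s : Finset F)
    (hs : Module.finrank D E * Module.finrank F D ≤ s.card) :
    Module.finrank D (formKer D f) * Module.finrank F D ≤ s.card :=
  le_trans (Nat.mul_le_mul_right _ (by have := fr.finrank_add_one; omega)) hs

variable {σ : D →ₗ[F] D} {B' : formKer D f →ₗ[F] Module.Dual F (formKer D f)}
  {S : formKer D f →ₗ[F] (E →ₗ[D] E)}

/-- An operator of `V` vanishing at `x` and with prescribed value at a vector `z` outside the
radical. -/
theorem Frame.exists_mem_apply_eq (fr : Frame V x f c) (s : Finset F)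
    (hs : Module.finrank D E * Module.finrank F D ≤ s.card)
    (hB'V : ∀ N ∈ compress (formKer D f) (projKer fr.sub_mem) V, ∀ u, B' u (N u) = 0)
    {z w : formKer D f} (hz : B' z z ≠ 0) (hw : B' z w = 0) :
    ∃ M ∈ V, M x = 0 ∧ M z = w := by
  obtain ⟨N, hN, hNz⟩ := (fr.isOpt_compress s hs).exists_apply_eq s (fr.card_le s hs) hB'V hz hw
  refine ⟨_, hN, ?_, ?_⟩
  · simp [projKer_self fr.sub_mem fr.coord_self]
  · simp [projKer_coe fr.sub_mem fr.coord_ker, hNz]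

/-- A linear form vanishing on `V (a x + z)` is proportional to `B' z` on `formKer D f`. -/
theorem Frame.exists_eq_mul_form (fr : Frame V x f c) (s : Finset F)
    (hs : Module.finrank D E * Module.finrank F D ≤ s.card)
    (hB'V : ∀ N ∈ compress (formKer D f) (projKer fr.sub_mem) V, ∀ u, B' u (N u) = 0)
    {z : formKer D f} (hz : B' z z ≠ 0) {h : Module.Dual F E} {a : D}
    (hV : ∀ M ∈ V, h (M (a • x + z)) = 0) :
    ∃ l : F, ∀ g : formKer D f, h g = l * B' z g := by
  refine ⟨h z / B' z z, fun g => ?_⟩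
  obtain ⟨M, hM, hMx, hMz⟩ := fr.exists_mem_apply_eq s hs hB'V (w := g - (B' z g / B' z z) • z) hz
    (by simp [hz])
  have h1 := hV M hM
  rw [map_add, map_smul, hMx, smul_zero, zero_add, hMz] at h1
  have h2 : h g - (B' z g / B' z z) • h z = 0 := by
    rw [← map_smul, ← map_sub]
    exact h1
  rw [sub_eq_zero.1 h2, smul_eq_mul]
  ring

/-- If B' z g = 0, some M in V satisfies M x = 0 and M z = -g. Then M z + S g x = 0, and persistence
gives f (S g z) = 0. Thus g ↦ f (S g z) vanishes on the kernel of B' z. -/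
theorem Frame.exists_mul_of_section (fr : Frame V x f c) (s : Finset F)
    (hs : Module.finrank D E * Module.finrank F D ≤ s.card)
    (hB'V : ∀ N ∈ compress (formKer D f) (projKer fr.sub_mem) V, ∀ u, B' u (N u) = 0)
    (hSV : ∀ g, S g ∈ V) (hSx : ∀ g, S g x = g) {z : formKer D f} (hz : B' z z ≠ 0) :
    ∃ ν : F, ∀ g, f (S g z) = ν * B' z g := by
  have key : ∀ g, B' z g = 0 → f (S g z) = 0 := by
    intro g hg
    obtain ⟨M, hM, hMx, hMz⟩ := fr.exists_mem_apply_eq s hs hB'V (w := -g) hz (by simp [hg])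
    exact fr.opt.triv.apply_eq_zero_of_add_eq_zero fr.hyper s hs hM (hSV g) hMx
      (by rw [hMz, hSx]; simp)
  refine ⟨f (S z z) / B' z z, fun g => ?_⟩
  have h1 := key (g - (B' z g / B' z z) • z) (by simp [hz])
  rw [map_sub, map_smul, LinearMap.sub_apply, LinearMap.smul_apply, map_sub, map_smul,
    sub_eq_zero] at h1
  rw [h1, smul_eq_mul]
  ring

/-- If `f (S g z)` vanishes for all `g` and `z`, then `formKer D f` is stable under `V`. -/
theorem Frame.stable_of_section (fr : Frame V x f c) (s : Finset F)
    (hs : Module.finrank D E * Module.finrank F D ≤ s.card)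
    (hSV : ∀ g, S g ∈ V) (hSx : ∀ g, S g x = g)
    (h0 : ∀ g z : formKer D f, f (S g z) = 0) :
    ∀ M ∈ V, ∀ g ∈ formKer D f, M g ∈ formKer D f := by
  have hSG : ∀ g z : formKer D f, S g z ∈ formKer D f := by
    intro g z a
    rw [← map_smul]
    exact h0 g (a • z)
  -- V'' contains the compression of V and also has no nonzero fixed vectors. Since the compression
  -- is already optimal, the two coincide.
  let V'' : Submodule F (formKer D f →ₗ[D] formKer D f) :=
    { carrier := {N | ∃ M ∈ V, M x ∈ formKer D f ∧ ∀ z : formKer D f, M z = N z}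
      add_mem' := by
        rintro N N' ⟨M, hM, hx, h⟩ ⟨M', hM', hx', h'⟩
        exact ⟨M + M', V.add_mem hM hM', Submodule.add_mem _ hx hx', fun z => by simp [h, h']⟩
      zero_mem' := ⟨0, V.zero_mem, Submodule.zero_mem _, fun z => rfl⟩
      smul_mem' := by
        rintro a N ⟨M, hM, hx, h⟩
        refine ⟨a • M, V.smul_mem a hM, ?_, fun z => by simp [h]⟩
        have := Submodule.smul_mem (formKer D f) (algebraMap F D a) hx
        rwa [algebraMap_smul] at this }
  have htriv : TrivSpec V'' := by
    rintro N ⟨M, hM, -, h⟩ z hz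
    exact Subtype.ext (fr.opt.triv M hM z (by rw [h, hz]))
  have hopt := fr.isOpt_compress s hs
  have hle : compress (formKer D f) (projKer fr.sub_mem) V ≤ V'' := by
    intro N hN
    refine ⟨_, hN, ?_, fun z => ?_⟩
    · simp [projKer_self fr.sub_mem fr.coord_self]
    · simp [projKer_coe fr.sub_mem fr.coord_ker]
  have := finiteDimensional_hom F D (formKer D f) (formKer D f)
  have heq := Submodule.eq_of_le_of_finrank_le hle (by
    have h1 := htriv.finrank_le s (fr.card_le s hs)
    have h2 := hopt.dim
    omega)
  -- Subtracting from S g an element of V with the same restriction to the complement but killing x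
  -- leaves an operator of V that sends x to g and kills the complement.
  have hcol : ∀ g : formKer D f, ∃ M ∈ V, M x = g ∧ ∀ z : formKer D f, M z = 0 := by
    intro g
    have hN : LinearMap.codRestrict (formKer D f) (S g ∘ₗ (formKer D f).subtype) (hSG g) ∈ V'' :=
      ⟨S g, hSV g, by rw [hSx]; exact g.2, fun z => rfl⟩
    rw [← heq] at hN
    refine ⟨_, V.sub_mem (hSV g) hN, ?_, fun z => ?_⟩
    · simp [projKer_self fr.sub_mem fr.coord_self, hSx]
    · simp only [LinearMap.sub_apply, LinearMap.comp_apply, projKer_coe fr.sub_mem fr.coord_ker]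
      exact sub_self _
  intro M hM g hg
  by_contra hMg
  have hr : c (M g) ≠ 0 := fun h => hMg (fr.mem_formKer_of_coord h)
  have hμ : 1 - c (M x) ≠ 0 := by
    intro h
    have h1 := fr.form_apply hM
    rw [← one_smul D (M x), fr.form_smul, one_mul, ← sub_eq_zero.1 h, one_smul] at h1
    exact fr.form_ne_zero h1
  -- If c (M g) ≠ 0, adding such an operator M' to M makes q x + g a fixed vector. This q is the
  -- value for which q x + g - M (q x + g) has no coordinate along x, so that a suitable M' exists;
  -- f (M x) = 0 ensures c (M x) ≠ 1.
  set q := c (M g) * (1 - c (M x))⁻¹ with hq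
  have hq0 : q ≠ 0 := mul_ne_zero hr (inv_ne_zero hμ)
  have hqμ : q - q * c (M x) = c (M g) := by
    rw [← mul_one_sub, hq, mul_assoc, inv_mul_cancel₀ hμ, mul_one]
  have hmem : q⁻¹ • (q • x + g - q • M x - M g) ∈ formKer D f := by
    refine Submodule.smul_mem _ _ (fr.mem_formKer_of_coord ?_)
    simp only [map_sub, map_add, map_smul, fr.coord_self, fr.coord_ker g hg, smul_eq_mul, mul_one,
      add_zero]
    rw [hqμ, sub_self]
  obtain ⟨M', hM', hM'x, hM'z⟩ := hcol ⟨_, hmem⟩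
  have hfix := fr.opt.triv _ (V.add_mem hM hM') (q • x + g) (by
    rw [LinearMap.add_apply, map_add, map_add, map_smul, map_smul, hM'x, hM'z ⟨g, hg⟩, smul_smul,
      mul_inv_cancel₀ hq0, one_smul]
    abel)
  have := congrArg c hfix
  rw [map_add, map_smul, fr.coord_self, fr.coord_ker g hg, smul_eq_mul, mul_one, add_zero,
    map_zero] at this
  exact hq0 this

end Top

end InvertibleAffine

namespace InvertibleAffine

/-! ### The constant ν and the slopes of the annihilating forms. -/

section Top

variable {F D : Type*} [Field F] [DivisionRing D] [Algebra F D] [FiniteDimensional F D]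
variable {E : Type*} [AddCommGroup E] [Module F E] [Module D E] [IsScalarTower F D E]
  [FiniteDimensional D E]
variable {V : Submodule F (E →ₗ[D] E)} {x : E} {f : Module.Dual F E} {c : E →ₗ[D] D}
variable {σ : D →ₗ[F] D} {B' : formKer D f →ₗ[F] Module.Dual F (formKer D f)}
  {S : formKer D f →ₗ[F] (E →ₗ[D] E)}

omit [FiniteDimensional F D] in
theorem NIForm.two_le_finrank {B : E →ₗ[F] Module.Dual F E} (hσ : IsInvol σ) (hB : NIForm σ B)
    {z u : E} (hz : B z z ≠ 0) (hu : B u u = 0) (hu0 : u ≠ 0) : 2 ≤ Module.finrank D E := by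
  have hli : LinearIndependent D ![z, u] := by
    rw [LinearIndependent.pair_iff]
    intro a b hab
    have h1 : a = 0 := by
      refine hB.smul_eq_zero hσ hz ?_
      have h2 : B (b • u) = 0 := hB.left _ (hB.smul_self_eq_zero hu b)
      have h3 := congrArg B hab
      rwa [map_add, h2, add_zero, map_zero] at h3
    rw [h1, zero_smul, zero_add] at hab
    exact ⟨h1, (_root_.smul_eq_zero.1 hab).resolve_right hu0⟩
  simpa using hli.fintype_card_le_finrank

theorem exists_ne_ne_of_two_lt_card {α : Type*} {s : Finset α} (hs : 2 < s.card) (p q : α) :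
    ∃ a, a ≠ p ∧ a ≠ q := by
  classical
  obtain ⟨a, -, ha⟩ := Finset.exists_mem_notMem_of_card_lt_card
    (lt_of_le_of_lt (Finset.card_le_two (a := p) (b := q)) hs)
  exact ⟨a, by rintro rfl; simp at ha, by rintro rfl; simp at ha⟩

/-- Here E has dimension at least three, so nd ≥ 3. This provides scalars other than two prescribed
ones. -/
theorem Frame.two_lt_card (fr : Frame V x f c) {s : Finset F}
    (hs : Module.finrank D E * Module.finrank F D ≤ s.card)
    (h : 2 ≤ Module.finrank D (formKer D f)) : 2 < s.card := by
  have h1 := fr.finrank_add_one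
  have h2 : 0 < Module.finrank F D := Module.finrank_pos
  nlinarith

/-- The bilinear form `f (S g z)` is proportional to `B'`. -/
theorem Frame.exists_forall_mul_of_section (fr : Frame V x f c) (hσ : IsInvol σ) (s : Finset F)
    (hs : Module.finrank D E * Module.finrank F D ≤ s.card) (hB' : NIForm σ B') (hB'0 : B' ≠ 0)
    (hB'V : ∀ N ∈ compress (formKer D f) (projKer fr.sub_mem) V, ∀ u, B' u (N u) = 0)
    (hSV : ∀ g, S g ∈ V) (hSx : ∀ g, S g x = g) :
    ∃ ν : F, ∀ z g : formKer D f, f (S g z) = ν * B' z g := by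
  let T : formKer D f →ₗ[F] Module.Dual F (formKer D f) :=
    LinearMap.mk₂ F (fun z g => f (S g z)) (by intros; simp) (by intros; simp) (by intros; simp)
      (by intros; simp)
  have hT : ∀ z, B' z ≠ 0 → ∃ ν : F, T z = ν • B' z := by
    intro z hz
    obtain ⟨ν, hν⟩ := fr.exists_mul_of_section s hs hB'V hSV hSx (z := z)
      (fun h => hz (hB'.left z h))
    exact ⟨ν, LinearMap.ext hν⟩
  obtain ⟨z₁, hz₁⟩ : ∃ z, B' z ≠ 0 := by
    by_contra! h
    exact hB'0 (LinearMap.ext h)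
  by_cases hrk : ∃ z₂, ∀ a : F, B' z₂ ≠ a • B' z₁
  · obtain ⟨z₂, hz₂⟩ := hrk
    obtain ⟨ν, hν⟩ := exists_eq_smul_of_forall T B' hT hz₁ hz₂
    exact ⟨ν, fun z g => LinearMap.congr_fun (hν z) g⟩
  push Not at hrk
  obtain ⟨ν₁, hν₁⟩ := hT z₁ hz₁
  by_cases hker : ∀ u, B' u = 0 → T u = 0
  · refine ⟨ν₁, fun z g => ?_⟩
    obtain ⟨a, ha⟩ := hrk z
    have h1 := hker (z - a • z₁) (by rw [map_sub, map_smul, ha, sub_self])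
    rw [map_sub, map_smul, sub_eq_zero] at h1
    change T z g = _
    rw [h1, hν₁, ha]
    simp only [LinearMap.smul_apply, smul_eq_mul]
    ring
  exfalso
  push Not at hker
  -- B' has rank one over F while q ↦ B' (q z₁) is injective, so D = F. The aim is to contradict the
  -- assumption that T does not vanish on the left kernel of B'.
  have hscal : ∀ q : D, ∃ a : F, q = algebraMap F D a := by
    intro q
    obtain ⟨a, ha⟩ := hrk (q • z₁)
    refine ⟨a, sub_eq_zero.1 (hB'.smul_eq_zero hσ (fun h => hz₁ (hB'.left z₁ h)) ?_)⟩
    rw [sub_smul, map_sub, ha, algebraMap_smul, map_smul, sub_self]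
  -- Adding a vector of the left kernel to z₁ does not change B', so T of this vector is a multiple
  -- of B' z₁; when nonzero, it can be rescaled to B' z₁.
  obtain ⟨u, hBu, hTu⟩ : ∃ u, B' u = 0 ∧ T u = B' z₁ := by
    obtain ⟨u, hBu, hTu⟩ := hker
    obtain ⟨ν₂, hν₂⟩ := hT (z₁ + u) (by rwa [map_add, hBu, add_zero])
    rw [map_add, map_add, hBu, add_zero, hν₁, ← eq_sub_iff_add_eq'] at hν₂
    replace hν₂ : T u = (ν₂ - ν₁) • B' z₁ := hν₂.trans (sub_smul ν₂ ν₁ (B' z₁)).symm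
    have hδ : ν₂ - ν₁ ≠ 0 := by
      intro h
      rw [h, zero_smul] at hν₂
      exact hTu hν₂
    exact ⟨(ν₂ - ν₁)⁻¹ • u, by rw [map_smul, hBu, smul_zero],
      by rw [map_smul, hν₂, smul_smul, inv_mul_cancel₀ hδ, one_smul]⟩
  set ω := B' z₁ with hω
  obtain ⟨z₀, hBz, hTz⟩ : ∃ z₀, B' z₀ = ω ∧ T z₀ = 0 :=
    ⟨z₁ - ν₁ • u, by rw [map_sub, map_smul, hBu, smul_zero, sub_zero],
      by rw [map_sub, map_smul, hν₁, hTu, sub_self]⟩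
  have hu0 : u ≠ 0 := by
    rintro rfl
    rw [map_zero] at hTu
    exact hz₁ hTu.symm
  have hωu : ω u = 0 := by rw [← hBz]; exact hB'.right u (by rw [hBu]; rfl) z₀
  have hω0 : ω z₀ ≠ 0 := by
    intro h
    rw [← hBz] at h
    exact hz₁ (hBz.symm.trans (hB'.left _ h))
  have hcard := fr.two_lt_card hs (hB'.two_le_finrank hσ (z := z₀) (by rwa [hBz])
    (by rw [hBu]; rfl) hu0)
  set γ : formKer D f → F := fun z => ω (projKer fr.sub_mem (S z₀ z)) with hγ
  -- Let z = β z₀ + α u and let h be a form killing V (a x + z) with h (a x + z) = 1. Then h equals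
  -- l B' z on the complement, and η is h x. The equations are h (S z₀ (a x + z)) = 0 and the
  -- normalization.
  have key : ∀ α β a : F, β ≠ 0 → ∃ l η : F,
      l * β * a * ω z₀ + α * ω z₀ * η + l * β * (β * γ z₀ + α * γ u) = 0 ∧
        a * η + l * β * (β * ω z₀) = 1 := by
    intro α β a hβ
    set z := β • z₀ + α • u with hz
    have hBz' : B' z = β • ω := by rw [hz, map_add, map_smul, map_smul, hBz, hBu, smul_zero,
      add_zero]
    have hTz' : T z = α • ω := by rw [hz, map_add, map_smul, map_smul, hTz, hTu, smul_zero,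
      zero_add]
    have hωz : ω z = β * ω z₀ := by simp [hz, hωu]
    have hzz : B' z z ≠ 0 := by
      rw [hBz', LinearMap.smul_apply, hωz, smul_eq_mul]
      exact mul_ne_zero hβ (mul_ne_zero hβ hω0)
    have hne : algebraMap F D a • x + (z : E) ≠ 0 := by
      intro h
      have h1 := congrArg (projKer fr.sub_mem) h
      rw [map_add, map_smul, projKer_self fr.sub_mem fr.coord_self, smul_zero, zero_add,
        projKer_coe fr.sub_mem fr.coord_ker, map_zero] at h1
      rw [h1, map_zero] at hzz
      exact hzz rfl
    obtain ⟨h, hV, h1⟩ := fr.opt.triv.exists_form hne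
    obtain ⟨l, hl⟩ := fr.exists_eq_mul_form s hs hB'V hzz hV
    refine ⟨l, h x, ?_, ?_⟩
    · have h2 := hV _ (hSV z₀)
      rw [map_add (S z₀), map_smul (S z₀), hSx, algebraMap_smul, map_add h, map_smul h, hl] at h2
      obtain ⟨b, hb⟩ := hscal (c (S z₀ z))
      have h3 := add_projKer fr.sub_mem (S z₀ z)
      have h4 : f (S z₀ z) = b := by
        rw [← h3, map_add, hb, algebraMap_smul, map_smul, fr.form_self,
          apply_eq_zero_of_mem_formKer (Subtype.mem _)]
        simp
      have h5 : b = α * ω z₀ := by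
        rw [← h4]
        exact LinearMap.congr_fun hTz' z₀
      have h6 : γ z = β * γ z₀ + α * γ u := by
        simp [hγ, hz]
      rw [← h3, map_add h, hb, algebraMap_smul, map_smul h, hl, hBz', LinearMap.smul_apply,
        LinearMap.smul_apply] at h2
      change a • (l * (β • ω z₀)) + (b • h x + l * (β • γ z)) = 0 at h2
      rw [h6, h5] at h2
      simp only [smul_eq_mul] at h2
      linear_combination h2
    · rw [map_add, algebraMap_smul, map_smul, hl, hBz', LinearMap.smul_apply, hωz] at h1
      simp only [smul_eq_mul] at h1
      linear_combination h1
  have hγ0 : γ z₀ = 0 := by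
    obtain ⟨l, η, h1, h2⟩ := key 0 1 0 one_ne_zero
    have hl : l ≠ 0 := by rintro rfl; simp at h2
    have : l * γ z₀ = 0 := by linear_combination h1
    exact (mul_eq_zero.1 this).resolve_left hl
  obtain ⟨a, ha0, ha⟩ := exists_ne_ne_of_two_lt_card hcard 0 (-γ u / ω z₀)
  -- For α = 1 and this β, a times the first equation has the same left side as ω z₀ times the
  -- second, whose right side is ω z₀ ≠ 0. The two excluded values of a are those for which β
  -- vanishes.
  have hβ : a * (a * ω z₀ + γ u) / (ω z₀ * ω z₀) ≠ 0 := by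
    refine div_ne_zero (mul_ne_zero ha0 fun h => ha ?_) (mul_ne_zero hω0 hω0)
    rw [eq_div_iff hω0]
    linear_combination h
  obtain ⟨l, η, h1, h2⟩ := key 1 _ a hβ
  set β := a * (a * ω z₀ + γ u) / (ω z₀ * ω z₀) with hβd
  have hβe : β * (ω z₀ * ω z₀) = a * (a * ω z₀ + γ u) := by
    rw [hβd, div_mul_cancel₀ _ (mul_ne_zero hω0 hω0)]
  apply hω0
  rw [hγ0] at h1
  linear_combination a * h1 - ω z₀ * h2 + l * β * hβe

/-- The forms vanishing on `V (a x + z)`, for `z` outside the radical of `B'`. -/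
theorem Frame.exists_slope (fr : Frame V x f c) (hσ : IsInvol σ) (s : Finset F)
    (hs : Module.finrank D E * Module.finrank F D ≤ s.card) (hB' : NIForm σ B')
    (hB'V : ∀ N ∈ compress (formKer D f) (projKer fr.sub_mem) V, ∀ u, B' u (N u) = 0)
    (hSV : ∀ g, S g ∈ V) (hSx : ∀ g, S g x = g) {ν : F} (hν0 : ν ≠ 0)
    (hν : ∀ z g : formKer D f, f (S g z) = ν * B' z g) {z : formKer D f} (hz : B' z z ≠ 0) :
    ∃ t : D, (∀ g, B' (t • z) g = -B' z (projKer fr.sub_mem (S g z))) ∧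
      ∀ a : D, ∃ h : Module.Dual F E,
        (∀ v, h v = ν⁻¹ * f (((t - σ a) * c v) • x) + B' z (projKer fr.sub_mem v)) ∧
        (∀ M ∈ V, h (M (a • x + z)) = 0) ∧ h (a • x + z) ≠ 0 := by
  have hinj : ∀ t t' : D, (∀ g, B' (t • z) g = B' (t' • z) g) → t = t' := by
    intro t t' h
    refine sub_eq_zero.1 (hB'.smul_eq_zero hσ hz ?_)
    ext g
    rw [sub_smul, map_sub, LinearMap.sub_apply, h, sub_self]
    rfl
  -- A form h killing V (a x + z) is l B' z on the complement and f (η · x) on D x. Evaluating at S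
  -- g (a x + z) relates l and η. If l = 0 then η = 0 and h = 0, so l may be normalized to 1, and t
  -- = σ a + l⁻¹ ν η. The relation determines t without reference to a, so one t serves all a.
  have key : ∀ a : D, ∃ t : D, (∀ g, B' (t • z) g = -B' z (projKer fr.sub_mem (S g z))) ∧
      ∃ h : Module.Dual F E,
        (∀ v, h v = ν⁻¹ * f (((t - σ a) * c v) • x) + B' z (projKer fr.sub_mem v)) ∧
        (∀ M ∈ V, h (M (a • x + z)) = 0) ∧ h (a • x + z) ≠ 0 := by
    intro a
    have hne : a • x + (z : E) ≠ 0 := by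
      intro h
      have h1 := congrArg (projKer fr.sub_mem) h
      rw [map_add, map_smul, projKer_self fr.sub_mem fr.coord_self, smul_zero, zero_add,
        projKer_coe fr.sub_mem fr.coord_ker, map_zero] at h1
      rw [h1, map_zero] at hz
      exact hz rfl
    obtain ⟨h, hV, h1⟩ := fr.opt.triv.exists_form hne
    obtain ⟨l, hl⟩ := fr.exists_eq_mul_form s hs hB'V hz hV
    obtain ⟨η, hη⟩ := exists_left_translate _ (InvertibleAffine.form_ne_zero (D := D) fr.form_ne_zero)
      (h ∘ₗ spanMap F x)
    have hη' : ∀ q : D, h (q • x) = f ((η * q) • x) := hη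
    have hhv : ∀ v, h v = f ((η * c v) • x) + l * B' z (projKer fr.sub_mem v) := by
      intro v
      conv_lhs => rw [← add_projKer fr.sub_mem v]
      rw [map_add, hη', hl]
    have heq : ∀ g, l * B' (σ a • z) g + ν * B' (η • z) g +
        l * B' z (projKer fr.sub_mem (S g z)) = 0 := by
      intro g
      have h2 := hV _ (hSV g)
      rw [map_add, map_smul, hSx, map_add, hhv (S g z), ← fr.form_smul, ← map_smul] at h2
      have h3 : h (a • (g : E)) = l * B' z (a • g) := hl (a • g)
      have h4 : f (S g (η • (z : E))) = ν * B' (η • z) g := hν (η • z) g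
      rw [h3, h4] at h2
      rw [hB'.sesq (σ a), hσ.invol]
      linear_combination h2
    have hl0 : l ≠ 0 := by
      rintro rfl
      have h5 : η = 0 := by
        refine hB'.smul_eq_zero hσ hz (LinearMap.ext fun g => ?_)
        have h6 := heq g
        rw [zero_mul, zero_mul, zero_add, add_zero] at h6
        exact (mul_eq_zero.1 h6).resolve_left hν0
      rw [hhv, h5] at h1
      simp at h1
    refine ⟨σ a + (l⁻¹ * ν) • η, fun g => ?_, l⁻¹ • h, fun v => ?_, fun M hM => ?_, ?_⟩
    · rw [add_smul, map_add, smul_assoc, map_smul B', LinearMap.add_apply, LinearMap.smul_apply,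
        smul_eq_mul, ← sub_eq_zero, ← mul_zero l⁻¹, ← heq g]
      field_simp
      ring
    · rw [LinearMap.smul_apply, hhv, add_sub_cancel_left, smul_mul_assoc, smul_assoc, map_smul f,
        smul_eq_mul, smul_eq_mul]
      field_simp
    · rw [LinearMap.smul_apply, hV M hM, smul_zero]
    · rw [LinearMap.smul_apply, h1]
      simp [hl0]
  obtain ⟨t, ht, -⟩ := key 0
  refine ⟨t, ht, fun a => ?_⟩
  obtain ⟨t', ht', h⟩ := key a
  rwa [hinj t' t (fun g => by rw [ht, ht'])] at h

end Top

end InvertibleAffine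

namespace InvertibleAffine

/-! ### Semilinearity of the slope. -/

section Slope

variable {F D : Type*} [Field F] [DivisionRing D] [Algebra F D] [FiniteDimensional F D]
variable {X : Type*} [AddCommGroup X] [Module F X] [Module D X] [IsScalarTower F D X]
  [FiniteDimensional D X]
variable {σ : D →ₗ[F] D} {B : X →ₗ[F] Module.Dual F X} {K : X →ₗ[F] (X →ₗ[D] X)} {τ : X → D}

-- Moving a across the form in the relation at a z gives B (τ(az) a z) = σ(a) a · B (τ(z) z), the
-- norm σ(a) a being a scalar. Hence τ(az) a = τ(z) σ(a) a, and a cancels.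
omit [FiniteDimensional F D] [FiniteDimensional D X] in
theorem slope_smul (hσ : IsInvol σ) (hB : NIForm σ B)
    (h1 : ∀ z, B z z ≠ 0 → ∀ g, B (τ z • z) g = -B z (K g z))
    (h0 : ∀ z, B z z = 0 → τ z = 0) (a : D) (z : X) : τ (a • z) = τ z * σ a := by
  by_cases hz : B z z = 0
  · rw [h0 z hz, h0 _ (hB.smul_self_eq_zero hz a), zero_mul]
  by_cases ha : a = 0
  · rw [ha, zero_smul, h0 0 (by simp), map_zero, mul_zero]
  have haz : B (a • z) (a • z) ≠ 0 := fun h => hz (by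
    have := hB.smul_self_eq_zero h a⁻¹
    rwa [smul_smul, inv_mul_cancel₀ ha, one_smul] at this)
  obtain ⟨ν, hν⟩ := hσ.norm a
  have h2 : τ (a • z) * a - ν • τ z = 0 := by
    refine hB.smul_eq_zero hσ hz (LinearMap.ext fun g => ?_)
    rw [sub_smul, mul_smul, map_sub, LinearMap.sub_apply, h1 _ haz, smul_assoc, map_smul B ν,
      LinearMap.smul_apply, h1 _ hz, map_smul (K g) a z, hB.sesq, smul_smul, hν, algebraMap_smul,
      map_smul (B z) ν]
    simp
  rw [sub_eq_zero, Algebra.smul_def, Algebra.commutes, ← hν, ← mul_assoc] at h2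
  exact mul_right_cancel₀ ha h2

/-- The function t ↦ τ(z + tu) is affine while B does not see tu. If its direction β were nonzero,
the expression in `hne` at z + tu with a = β⁻¹ would be an affine function of t with leading
coefficient ν⁻¹ φ(1) ≠ 0, hence would vanish for some t. -/
theorem slope_add_radical (hσ : IsInvol σ) (hB : NIForm σ B)
    (h1 : ∀ z, B z z ≠ 0 → ∀ g, B (τ z • z) g = -B z (K g z)) {ν : F} (hν : ν ≠ 0)
    {φ : D →ₗ[F] F} (hφ : φ 1 = 1)
    (hne : ∀ z, B z z ≠ 0 → ∀ a : D, ν⁻¹ * φ ((τ z - σ a) * a) + B z z ≠ 0)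
    {z u : X} (hz : B z z ≠ 0) (hu : B u u = 0) : τ (z + u) = τ z := by
  have : FiniteDimensional F X := FiniteDimensional.trans F D X
  have htu : ∀ t : F, B (t • u) (t • u) = 0 := fun t => by
    simp [hu]
  have hgood : ∀ t : F, B (z + t • u) (z + t • u) = B z z := fun t => hB.add_self (htu t) z
  let T : D →ₗ[F] Module.Dual F X := B ∘ₗ spanMap F z
  have hT : Function.Injective T := (injective_iff_map_eq_zero T).2
    fun a ha => hB.smul_eq_zero hσ hz ha
  have key : ∀ t : F, τ (z + t • u) = τ z + t • (τ (z + u) - τ z) := by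
    intro t
    by_contra hcon
    obtain ⟨χ, hχ⟩ := exists_dual_ne_zero (F := F) (sub_ne_zero.2 hcon)
    obtain ⟨g, hg⟩ := exists_forall_apply_eq T hT χ
    have h2 : ∀ t : F, χ (τ (z + t • u)) = χ (τ z) - t * B z (K g u) := by
      intro t
      have h3 := h1 (z + t • u) (by rwa [hgood]) g
      rw [smul_add, map_add B, hB.left _ (hB.smul_self_eq_zero (htu t) _), add_zero, map_add B,
        hB.left _ (htu t), add_zero, map_add (K g), LinearMap.map_smul_of_tower (K g) t u,
        map_add (B z), map_smul (B z) t] at h3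
      have h4 : B (τ (z + t • u) • z) g = χ (τ (z + t • u)) := hg _
      have h5 : B (τ z • z) g = χ (τ z) := hg _
      rw [h1 z hz] at h5
      rw [← h4, h3, ← h5, smul_eq_mul]
      ring
    apply hχ
    have h6 := h2 1
    rw [one_smul] at h6
    rw [map_sub, map_add, map_smul, map_sub, h2, h6, smul_eq_mul]
    ring
  by_contra hcon
  have hβ : τ (z + u) - τ z ≠ 0 := sub_ne_zero.2 hcon
  set β := τ (z + u) - τ z with hβd
  set t : F := -(φ ((τ z - σ β⁻¹) * β⁻¹) + ν * B z z) with ht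
  have h7 := hne (z + t • u) (by rwa [hgood]) β⁻¹
  apply h7
  have h8 : (τ z + t • β - σ β⁻¹) * β⁻¹ = (τ z - σ β⁻¹) * β⁻¹ + t • 1 := by
    rw [add_sub_right_comm, add_mul, smul_mul_assoc, mul_inv_cancel₀ hβ]
  rw [key, hgood, h8, map_add, map_smul, hφ, ht]
  simp only [smul_eq_mul]
  field_simp
  ring

/-- Choose g with B (a z) g = χ a and B (b w) g = 0 for all a, b. The relation at z + tw expresses χ
(τ(z + tw)) as a quadratic polynomial in t whose t²-coefficient -B w (K g w) = B (τ(w) w) g is zero.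
-/
theorem slope_add_smul_of_independent (hB : NIForm σ B)
    (h1 : ∀ z, B z z ≠ 0 → ∀ g, B (τ z • z) g = -B z (K g z)) {z w : X}
    (hzw : ∀ a b : D, B (a • z + b • w) = 0 → a = 0 ∧ b = 0) (t : F) :
    τ (z + t • w) = τ z + t • (τ (z + w) - τ z) := by
  have : FiniteDimensional F X := FiniteDimensional.trans F D X
  have hgood : ∀ t : F, B (z + t • w) (z + t • w) ≠ 0 := by
    intro t h
    have := hzw 1 (algebraMap F D t) (by
      rw [one_smul, algebraMap_smul]
      exact hB.left _ h)
    exact one_ne_zero this.1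
  have hz : B z z ≠ 0 := by simpa using hgood 0
  have hw : B w w ≠ 0 := by
    intro h
    have := hzw 0 1 (by rw [zero_smul, zero_add, one_smul]; exact hB.left _ h)
    exact one_ne_zero this.2
  let T : D × D →ₗ[F] Module.Dual F X :=
    (B ∘ₗ spanMap F z).coprod (B ∘ₗ spanMap F w)
  have hTab : ∀ a b, T (a, b) = B (a • z + b • w) := fun a b => by simp [T]
  have hT : Function.Injective T := (injective_iff_map_eq_zero T).2 (by
    rintro ⟨a, b⟩ hab
    rw [hTab] at hab
    obtain ⟨rfl, rfl⟩ := hzw a b hab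
    rfl)
  by_contra hcon
  obtain ⟨χ, hχ⟩ := exists_dual_ne_zero (F := F) (sub_ne_zero.2 hcon)
  obtain ⟨g, hg⟩ := exists_forall_apply_eq T hT (χ ∘ₗ LinearMap.fst F D D)
  have hgz : ∀ a : D, B (a • z) g = χ a := by
    intro a
    have := hg (a, 0)
    rw [hTab, zero_smul, add_zero] at this
    simpa using this
  have hgw : ∀ b : D, B (b • w) g = 0 := by
    intro b
    have := hg (0, b)
    rw [hTab, zero_smul, zero_add] at this
    simpa using this
  have h2 : ∀ t : F, χ (τ (z + t • w)) = χ (τ z) - t * (B z (K g w) + B w (K g z)) := by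
    intro t
    have h3 := h1 (z + t • w) (hgood t) g
    have h4 : B (τ (z + t • w) • (z + t • w)) g = χ (τ (z + t • w)) := by
      rw [smul_add, map_add, LinearMap.add_apply, smul_comm, map_smul B t, LinearMap.smul_apply,
        hgw, smul_zero, add_zero, hgz]
    have h5 := h1 w hw g
    rw [hgw] at h5
    have h6 := h1 z hz g
    rw [hgz] at h6
    rw [← h4, h3, h6, map_add B, map_smul B, map_add (K g), LinearMap.map_smul_of_tower (K g) t w,
      LinearMap.add_apply, map_add (B z), map_add, LinearMap.smul_apply, LinearMap.smul_apply,
      map_smul (B z) t, map_smul (B w) t]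
    simp only [smul_eq_mul]
    linear_combination -(t * t) * h5
  apply hχ
  have h6 := h2 1
  rw [one_smul] at h6
  rw [map_sub, map_add, map_smul, map_sub, h2, h6, smul_eq_mul]
  ring

/-- The vector z + tw equals t (w + t⁻¹ z). Expanding both affine expressions and comparing them
gives (t - 1)(τ(z + w) - τ z - τ w) = 0. -/
theorem slope_add_of_independent (hσ : IsInvol σ) (hB : NIForm σ B)
    (h1 : ∀ z, B z z ≠ 0 → ∀ g, B (τ z • z) g = -B z (K g z))
    (h0 : ∀ z, B z z = 0 → τ z = 0) {z w : X}
    (hzw : ∀ a b : D, B (a • z + b • w) = 0 → a = 0 ∧ b = 0) {t : F} (ht0 : t ≠ 0) (ht1 : t ≠ 1) :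
    τ (z + w) = τ z + τ w := by
  have e1 := slope_add_smul_of_independent hB h1 hzw t
  have e2 := slope_add_smul_of_independent hB h1 (z := w) (w := z) (fun a b h => by
    rw [add_comm] at h
    exact (hzw b a h).symm) t⁻¹
  have e3 : τ (z + t • w) = t • τ (w + t⁻¹ • z) := by
    have := slope_smul hσ hB h1 h0 (algebraMap F D t) (w + t⁻¹ • z)
    rw [hσ.map_algebraMap, algebraMap_smul, smul_add, smul_smul, mul_inv_cancel₀ ht0, one_smul,
      add_comm, ← Algebra.commutes, ← Algebra.smul_def] at this
    exact this
  rw [e1, e2, add_comm w z, smul_add, smul_smul, mul_inv_cancel₀ ht0, one_smul] at e3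
  have e4 : (t - 1) • (τ (z + w) - (τ z + τ w)) = 0 := by
    have e5 : (t - 1) • (τ (z + w) - (τ z + τ w)) =
        (τ z + t • (τ (z + w) - τ z)) - (t • τ w + (τ (z + w) - τ w)) := by module
    rw [e5, e3, sub_self]
  exact sub_eq_zero.1 ((smul_eq_zero.1 e4).resolve_left (sub_ne_zero.2 ht1))

/-- Either one vector is in the radical, or w is a multiple of z modulo the radical and
semilinearity applies, or the two are independent modulo the radical. Only the last case needs a
scalar other than 0 and 1, and then X has dimension at least two. -/
theorem slope_add (hσ : IsInvol σ) (hB : NIForm σ B)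
    (h1 : ∀ z, B z z ≠ 0 → ∀ g, B (τ z • z) g = -B z (K g z))
    (h0 : ∀ z, B z z = 0 → τ z = 0) {ν : F} (hν : ν ≠ 0) {φ : D →ₗ[F] F} (hφ : φ 1 = 1)
    (hne : ∀ z, B z z ≠ 0 → ∀ a : D, ν⁻¹ * φ ((τ z - σ a) * a) + B z z ≠ 0)
    (hcard : 2 ≤ Module.finrank D X → ∃ t : F, t ≠ 0 ∧ t ≠ 1) (z w : X) :
    τ (z + w) = τ z + τ w := by
  by_cases hz : B z z = 0
  · rw [h0 z hz, zero_add, add_comm]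
    by_cases hw : B w w = 0
    · rw [h0 w hw]
      exact h0 _ (by rw [hB.add_self hz]; exact hw)
    · exact slope_add_radical hσ hB h1 hν hφ hne hw hz
  by_cases hdep : ∃ a : D, B (w - a • z) (w - a • z) = 0
  · obtain ⟨a, ha⟩ := hdep
    have hshift : ∀ b : D, τ (b • z + (w - a • z)) = τ z * σ b := by
      intro b
      by_cases hb : b = 0
      · rw [hb, zero_smul, zero_add, h0 _ ha, map_zero, mul_zero]
      · rw [slope_add_radical hσ hB h1 hν hφ hne (fun h => hz (by
          have := hB.smul_self_eq_zero h b⁻¹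
          rwa [smul_smul, inv_mul_cancel₀ hb, one_smul] at this)) ha, slope_smul hσ hB h1 h0]
    have e1 := hshift a
    have e2 := hshift (1 + a)
    rw [add_sub_cancel] at e1
    rw [add_smul, one_smul, add_assoc, add_sub_cancel] at e2
    rw [e1, e2, map_add, hσ.map_one, mul_add, mul_one]
  · push Not at hdep
    have hzw : ∀ a b : D, B (a • z + b • w) = 0 → a = 0 ∧ b = 0 := by
      intro a b hab
      have hb : b = 0 := by
        by_contra hb
        apply hdep (-(b⁻¹ * a))
        have h2 : B (a • z + b • w) (a • z + b • w) = 0 := by rw [hab]; rfl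
        have h3 := hB.smul_self_eq_zero h2 b⁻¹
        rwa [smul_add, smul_smul, smul_smul, inv_mul_cancel₀ hb, one_smul, add_comm,
          ← sub_neg_eq_add, ← neg_smul] at h3
      rw [hb, zero_smul, add_zero] at hab
      exact ⟨hB.smul_eq_zero hσ hz hab, hb⟩
    have hli : LinearIndependent D ![z, w] := by
      rw [LinearIndependent.pair_iff]
      intro a b hab
      exact hzw a b (by rw [hab, map_zero])
    obtain ⟨t, ht0, ht1⟩ := hcard (by simpa using hli.fintype_card_le_finrank)
    exact slope_add_of_independent hσ hB h1 h0 hzw ht0 ht1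

end Slope

end InvertibleAffine

namespace InvertibleAffine

/-! ### Existence of the invariant form. -/

section Form

variable {F D : Type*} [Field F] [DivisionRing D] [Algebra F D] [FiniteDimensional F D]
variable {E : Type*} [AddCommGroup E] [Module F E] [Module D E] [IsScalarTower F D E]
  [FiniteDimensional D E]
variable {V : Submodule F (E →ₗ[D] E)} {x : E} {f : Module.Dual F E} {c : E →ₗ[D] D}
variable {σ : D →ₗ[F] D} {B' : formKer D f →ₗ[F] Module.Dual F (formKer D f)}
  {S : formKer D f →ₗ[F] (E →ₗ[D] E)}

omit [FiniteDimensional F D] [FiniteDimensional D E] in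
/-- A quadratic map that vanishes at `w`, at `u + w` and at `u + t w`, where `t ≠ 1`,
vanishes at `u`. -/
theorem apply_self_eq_zero_of_line {B : E →ₗ[F] Module.Dual F E} {M : E →ₗ[D] E} {u w : E}
    (hw : B w (M w) = 0) {t : F} (ht1 : t ≠ 1)
    (h1 : B (u + w) (M (u + w)) = 0) (ht : B (u + t • w) (M (u + t • w)) = 0) :
    B u (M u) = 0 := by
  have e : ∀ t : F, B (u + t • w) (M (u + t • w)) =
      B u (M u) + t * (B u (M w) + B w (M u)) + t * t * B w (M w) := by
    intro t
    rw [map_add B, map_smul B, map_add M, LinearMap.map_smul_of_tower M t w, LinearMap.add_apply,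
      map_add (B u), map_smul (B u) t, LinearMap.smul_apply, map_add (B w), map_smul (B w) t]
    simp only [smul_eq_mul]
    ring
  have e1 := e 1
  rw [one_smul, h1, hw] at e1
  have e2 := e t
  rw [ht, hw] at e2
  have e3 : (t - 1) * B u (M u) = 0 := by linear_combination e2 - t * e1
  exact (mul_eq_zero.1 e3).resolve_left (sub_ne_zero.2 ht1)

/-- The slopes, set to zero on the radical of B', form the semilinear map τ to be glued with κ =
ν⁻¹. The annihilating forms of `Frame.exists_slope` are then the partial maps of the glued form at
vectors with nonisotropic projection. -/
theorem Frame.exists_form_of_section (fr : Frame V x f c) (hσ : IsInvol σ) (s : Finset F)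
    (hs : Module.finrank D E * Module.finrank F D ≤ s.card) (hB' : NIForm σ B') (hB'0 : B' ≠ 0)
    (hB'V : ∀ N ∈ compress (formKer D f) (projKer fr.sub_mem) V, ∀ u, B' u (N u) = 0)
    (hSV : ∀ g, S g ∈ V) (hSx : ∀ g, S g x = g) {ν : F} (hν0 : ν ≠ 0)
    (hν : ∀ z g : formKer D f, f (S g z) = ν * B' z g) :
    ∃ B : E →ₗ[F] Module.Dual F E, NIForm σ B ∧ B ≠ 0 ∧ ∀ M ∈ V, ∀ u, B u (M u) = 0 := by
  classical
  have hex : ∀ z : formKer D f, ∃ t : D, (B' z z = 0 → t = 0) ∧ (B' z z ≠ 0 →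
      (∀ g, B' (t • z) g = -B' z (projKer fr.sub_mem (S g z))) ∧
      ∀ a : D, ∃ h : Module.Dual F E,
        (∀ v, h v = ν⁻¹ * f (((t - σ a) * c v) • x) + B' z (projKer fr.sub_mem v)) ∧
        (∀ M ∈ V, h (M (a • x + z)) = 0) ∧ h (a • x + z) ≠ 0) := by
    intro z
    by_cases hz : B' z z = 0
    · exact ⟨0, fun _ => rfl, fun h => absurd hz h⟩
    · obtain ⟨t, ht⟩ := fr.exists_slope hσ s hs hB' hB'V hSV hSx hν0 hν hz
      exact ⟨t, fun h => absurd h hz, fun _ => ht⟩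
  choose τ h0 hτ using hex
  let K : formKer D f →ₗ[F] (formKer D f →ₗ[D] formKer D f) :=
    { toFun := fun g => projKer fr.sub_mem ∘ₗ S g ∘ₗ (formKer D f).subtype
      map_add' := fun g g' => by ext; simp
      map_smul' := fun a g => by
        ext v
        simp only [map_smul, LinearMap.comp_apply, LinearMap.smul_apply, RingHom.id_apply,
          LinearMap.map_smul_of_tower] }
  have h1 : ∀ z, B' z z ≠ 0 → ∀ g, B' (τ z • z) g = -B' z (K g z) := fun z hz => (hτ z hz).1
  let φ : D →ₗ[F] F := f ∘ₗ spanMap F x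
  have hφ : φ 1 = 1 := by simp [φ, fr.form_self]
  have hcad : ∀ (a : D) (z : formKer D f), c (a • x + z) = a := fun a z => by
    rw [map_add, map_smul, fr.coord_self, fr.coord_ker z z.2, smul_eq_mul, mul_one, add_zero]
  have hpad : ∀ (a : D) (z : formKer D f), projKer fr.sub_mem (a • x + z) = z := fun a z => by
    rw [map_add, map_smul, projKer_self fr.sub_mem fr.coord_self, smul_zero, zero_add,
      projKer_coe fr.sub_mem fr.coord_ker]
  have hne : ∀ z, B' z z ≠ 0 → ∀ a : D, ν⁻¹ * φ ((τ z - σ a) * a) + B' z z ≠ 0 := by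
    intro z hz a
    obtain ⟨h, hh, -, hh0⟩ := (hτ z hz).2 a
    rwa [hh, hcad, hpad] at hh0
  have hcd : 2 ≤ Module.finrank D (formKer D f) → ∃ t : F, t ≠ 0 ∧ t ≠ 1 := fun h =>
    exists_ne_ne_of_two_lt_card (fr.two_lt_card hs h) 0 1
  have hsmul := slope_smul hσ hB' h1 h0
  let τl : formKer D f →ₗ[F] D :=
    { toFun := τ
      map_add' := slope_add hσ hB' h1 h0 hν0 hφ hne hcd
      map_smul' := fun a z => by
        have := hsmul (algebraMap F D a) z
        rwa [hσ.map_algebraMap, algebraMap_smul, ← Algebra.commutes, ← Algebra.smul_def] at this }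
  have hκ := inv_ne_zero hν0
  have hself : ∀ u, u = c u • x + (projKer fr.sub_mem u : E) := fun u =>
    (add_projKer fr.sub_mem u).symm
  obtain ⟨hB1, hB2⟩ := glue_niForm hσ fr hκ (τ := τl) hB' hsmul h0 (fun u hu => by
    rw [glue_apply]
    exact hne _ hu _)
  have hgood : ∀ M ∈ V, ∀ u, B' (projKer fr.sub_mem u) (projKer fr.sub_mem u) ≠ 0 →
      glue σ fr ν⁻¹ τl B' u (M u) = 0 := by
    intro M hM u hu
    obtain ⟨h, hh, hhV, -⟩ := (hτ _ hu).2 (c u)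
    have h2 := hhV M hM
    rw [← hself u, hh] at h2
    exact h2
  refine ⟨_, hB1, hB2, fun M hM u => ?_⟩
  -- When the projection of u is isotropic but nonzero, all points u + tw with t ≠ 0 are covered by
  -- `hgood` for a nonisotropic w. A quadratic function of t that vanishes at two such points and
  -- has no t²-term vanishes at t = 0.
  by_cases hu : B' (projKer fr.sub_mem u) (projKer fr.sub_mem u) = 0
  · by_cases hu0 : projKer fr.sub_mem u = 0
    · refine glue_apply_eq_zero hσ fr hM (h0 _ hu) (hB'.left _ hu) ?_
      rw [hu0]
      simp
    obtain ⟨w, hw⟩ : ∃ z, B' z z ≠ 0 := by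
      by_contra! h
      exact hB'0 (LinearMap.ext fun z => hB'.left z (h z))
    obtain ⟨t, ht0, ht1⟩ := hcd (hB'.two_le_finrank hσ hw hu hu0)
    have hline : ∀ t : F, t ≠ 0 → glue σ fr ν⁻¹ τl B' (u + t • (w : E)) (M (u + t • (w : E))) = 0 := by
      intro t ht
      refine hgood M hM _ ?_
      have h2 : projKer fr.sub_mem (u + t • (w : E)) = t • w + projKer fr.sub_mem u := by
        rw [map_add, LinearMap.map_smul_of_tower, projKer_coe fr.sub_mem fr.coord_ker, add_comm]
      rw [h2, hB'.add_self hu, map_smul, map_smul, LinearMap.smul_apply]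
      simp [ht, hw]
    refine apply_self_eq_zero_of_line (w := (w : E)) (hgood M hM _ ?_) ht1 ?_ (hline t ht0)
    · rwa [projKer_coe fr.sub_mem fr.coord_ker]
    · simpa using hline 1 one_ne_zero
  · exact hgood M hM u hu

-- Induction through the compression to the complement of D x. A stable complement, in particular
-- the zero one, is handled directly; otherwise ν ≠ 0 and the form on the complement is glued.
omit [FiniteDimensional F D] [FiniteDimensional D E] in
theorem IsOpt.exists_form_aux [FiniteDimensional F D] (hσ : IsInvol σ) (s : Finset F) (n : ℕ) :
    ∀ {E : Type*} [AddCommGroup E] [Module F E] [Module D E] [IsScalarTower F D E]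
      [FiniteDimensional D E] {V : Submodule F (E →ₗ[D] E)}, IsOpt V → Module.finrank D E = n →
      0 < n → n * Module.finrank F D ≤ s.card →
      ∃ B : E →ₗ[F] Module.Dual F E, NIForm σ B ∧ B ≠ 0 ∧ ∀ M ∈ V, ∀ u, B u (M u) = 0 := by
  induction n with
  | zero => intros; omega
  | succ n ih =>
    intro E _ _ _ _ _ V hV hn _ hs
    rw [← hn] at hs
    obtain ⟨x, f, hfx, hVx⟩ := hV.exists_hyperplane (by omega) s hs
    obtain ⟨c, hcx, hcG, hc⟩ := exists_coord (D := D) (f := f) (x := x)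
      (by rw [hfx]; exact one_ne_zero)
    have fr : Frame V x f c := ⟨hV, hfx, hVx, hcx, hcG, hc⟩
    by_cases hst : ∀ M ∈ V, ∀ g ∈ formKer D f, M g ∈ formKer D f
    · exact fr.exists_form_of_stable hσ hst
    have hG := fr.finrank_add_one
    have hG0 : 0 < n := by
      by_contra h0
      have h1 : Module.finrank D (formKer D f) = 0 := by omega
      have h2 := Submodule.finrank_eq_zero.1 h1
      refine hst fun M _ g hg => ?_
      rw [h2] at hg
      rw [(Submodule.mem_bot D).1 hg, map_zero]
      exact Submodule.zero_mem _
    obtain ⟨B', h1, h2, h3⟩ := ih (fr.isOpt_compress s hs) (by omega) hG0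
      (by have := fr.card_le s hs; rwa [show Module.finrank D (formKer D f) = n by omega] at this)
    obtain ⟨S, hSV, hSx⟩ := fr.exists_section
    obtain ⟨ν, hν⟩ := fr.exists_forall_mul_of_section hσ s hs h1 h2 h3 hSV hSx
    by_cases hν0 : ν = 0
    · refine absurd (fr.stable_of_section s hs hSV hSx fun g z => ?_) hst
      rw [hν, hν0, zero_mul]
    · exact fr.exists_form_of_section hσ s hs h1 h2 h3 hSV hSx hν0 hν

/-- An optimal space on a nonzero `D`-space admits a nonzero form `B` with `B u (M u) = 0`. -/
theorem IsOpt.exists_form (hσ : IsInvol σ) (hV : IsOpt V) (hE : 0 < Module.finrank D E)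
    (s : Finset F) (hs : Module.finrank D E * Module.finrank F D ≤ s.card) :
    ∃ B : E →ₗ[F] Module.Dual F E, NIForm σ B ∧ B ≠ 0 ∧ ∀ M ∈ V, ∀ u, B u (M u) = 0 :=
  IsOpt.exists_form_aux hσ s _ hV rfl hE hs

end Form

end InvertibleAffine

namespace InvertibleAffine

/-! ### Restriction to a stable subspace. -/

section Restrict

theorem finrank_le_finrank_add_finrank_ker {F X Y : Type*} [Field F] [AddCommGroup X] [Module F X]
    [AddCommGroup Y] [Module F Y] [FiniteDimensional F X] [FiniteDimensional F Y] (φ : X →ₗ[F] Y)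
    {W : Submodule F Y} (h : ∀ x, φ x ∈ W) :
    Module.finrank F X ≤ Module.finrank F W + Module.finrank F (LinearMap.ker φ) := by
  have h1 := φ.finrank_range_add_finrank_ker
  have h2 : LinearMap.range φ ≤ W := by
    rintro - ⟨x, rfl⟩
    exact h x
  have h3 := Submodule.finrank_mono h2
  omega

variable {F D : Type*} [Field F] [DivisionRing D] [Algebra F D]
variable {E : Type*} [AddCommGroup E] [Module F E] [Module D E] [IsScalarTower F D E]
variable {Q : Type*} [AddCommGroup Q] [Module F Q] [Module D Q] [IsScalarTower F D Q]

/-- The restrictions of the elements of `V` to a stable subspace. -/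
def restrictTo (G : Submodule D E) (V : Submodule F (E →ₗ[D] E)) : Submodule F (G →ₗ[D] G) where
  carrier := {N | ∃ M ∈ V, ∀ u : G, (N u : E) = M u}
  add_mem' := by
    rintro N N' ⟨M, hM, h⟩ ⟨M', hM', h'⟩
    exact ⟨M + M', V.add_mem hM hM', fun u => by simp [h, h']⟩
  zero_mem' := ⟨0, V.zero_mem, fun u => by simp⟩
  smul_mem' := by
    rintro a N ⟨M, hM, h⟩
    exact ⟨a • M, V.smul_mem a hM, fun u => by simp [h]⟩

/-- The operators induced by the elements of `V` on the quotient `p : E → Q` by a stable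
subspace. -/
def inducedOn (p : E →ₗ[D] Q) (V : Submodule F (E →ₗ[D] E)) : Submodule F (Q →ₗ[D] Q) where
  carrier := {N | ∃ M ∈ V, ∀ u : E, N (p u) = p (M u)}
  add_mem' := by
    rintro N N' ⟨M, hM, h⟩ ⟨M', hM', h'⟩
    refine ⟨M + M', V.add_mem hM hM', fun u => ?_⟩
    rw [LinearMap.add_apply, LinearMap.add_apply, h, h', map_add]
  zero_mem' := ⟨0, V.zero_mem, fun u => by simp⟩
  smul_mem' := by
    rintro a N ⟨M, hM, h⟩
    refine ⟨a • M, V.smul_mem a hM, fun u => ?_⟩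
    rw [LinearMap.smul_apply, LinearMap.smul_apply, h, LinearMap.map_smul_of_tower]

variable [FiniteDimensional F D] [FiniteDimensional D E] [FiniteDimensional D Q]

/-- V is filtered by restriction to G and then by the action on Q; what remains embeds in Hom(Q, G).
-/
theorem finrank_le_restrictTo_add_inducedOn {V : Submodule F (E →ₗ[D] E)} {G : Submodule D E}
    (hst : ∀ M ∈ V, ∀ u ∈ G, M u ∈ G) {p : E →ₗ[D] Q} {j : Q →ₗ[D] E} (hpj : ∀ q, p (j q) = q)
    (hp : ∀ u, p u = 0 ↔ u ∈ G) :
    Module.finrank F V ≤ Module.finrank F (restrictTo G V) + Module.finrank F (inducedOn p V) +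
      Module.finrank D Q * (Module.finrank F D * Module.finrank D G) := by
  have : FiniteDimensional F (E →ₗ[D] E) := finiteDimensional_hom F D E E
  have : FiniteDimensional F (G →ₗ[D] G) := finiteDimensional_hom F D G G
  have : FiniteDimensional F (Q →ₗ[D] Q) := finiteDimensional_hom F D _ _
  have : FiniteDimensional F (Q →ₗ[D] G) := finiteDimensional_hom F D _ _
  have hjp : ∀ u, u - j (p u) ∈ G := fun u => (hp _).1 (by rw [map_sub, hpj, sub_self])
  obtain ⟨Φ, hΦ⟩ : ∃ Φ : V →ₗ[F] (G →ₗ[D] G), ∀ M u, (Φ M u : E) = M.1 u :=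
    ⟨{ toFun := fun M => M.1.restrict (hst M.1 M.2)
       map_add' := fun M M' => LinearMap.ext fun u => rfl
       map_smul' := fun a M => LinearMap.ext fun u => rfl }, fun _ _ => rfl⟩
  obtain ⟨Θ, hΘ⟩ : ∃ Θ : LinearMap.ker Φ →ₗ[F] (Q →ₗ[D] Q), ∀ M q, Θ M q = p (M.1.1 (j q)) :=
    ⟨{ toFun := fun M => p ∘ₗ M.1.1 ∘ₗ j
       map_add' := fun M M' => by ext; simp
       map_smul' := fun a M => by
        ext
        simp only [LinearMap.comp_apply, LinearMap.smul_apply, SetLike.val_smul,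
          LinearMap.map_smul_of_tower, RingHom.id_apply] }, fun _ _ => rfl⟩
  have hk0 : ∀ M : LinearMap.ker Θ, ∀ u ∈ G, M.1.1.1 u = 0 := fun M u hu => by
    have h := hΦ M.1.1 ⟨u, hu⟩
    rw [LinearMap.mem_ker.1 M.1.2] at h
    exact h.symm
  have hk1 : ∀ M : LinearMap.ker Θ, ∀ q, M.1.1.1 (j q) ∈ G := fun M q => by
    rw [← hp, ← hΘ, LinearMap.mem_ker.1 M.2]
    rfl
  obtain ⟨Ψ, hΨ⟩ : ∃ Ψ : LinearMap.ker Θ →ₗ[F] (Q →ₗ[D] G), ∀ M q, (Ψ M q : E) = M.1.1.1 (j q) :=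
    ⟨{ toFun := fun M => LinearMap.codRestrict G (M.1.1.1 ∘ₗ j) (hk1 M)
       map_add' := fun M M' => LinearMap.ext fun u => rfl
       map_smul' := fun a M => LinearMap.ext fun u => rfl }, fun _ _ => rfl⟩
  have hΨ : Function.Injective Ψ := by
    intro M M' hM
    have h : M.1.1.1 = M'.1.1.1 := by
      ext u
      have h1 := hΨ M (p u)
      rw [hM, hΨ M' (p u)] at h1
      have h2 := hk0 M _ (hjp u)
      have h3 := hk0 M' _ (hjp u)
      rw [map_sub, sub_eq_zero] at h2 h3
      rw [h2, h3, h1]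
    exact Subtype.ext (Subtype.ext (Subtype.ext h))
  have h1 := LinearMap.finrank_le_finrank_of_injective hΨ
  rw [finrank_hom] at h1
  have h2 := finrank_le_finrank_add_finrank_ker Φ (W := restrictTo G V)
    (fun M => ⟨M.1, M.2, hΦ M⟩)
  have h3 := finrank_le_finrank_add_finrank_ker (F := F) (X := LinearMap.ker Φ)
    (Y := Q →ₗ[D] Q) Θ (W := inducedOn p V) (fun M => by
    refine ⟨M.1.1, M.1.2, fun u => ?_⟩
    have h6 := (hp _).2 (hst _ M.1.2 _ (hjp u))
    rw [map_sub, map_sub, sub_eq_zero] at h6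
    rw [h6, hΘ])
  omega

/-- The restriction of an optimal space to a stable subspace is optimal, provided that the induced
operators on the quotient have no nonzero fixed vectors. -/
theorem IsOpt.restrictTo {V : Submodule F (E →ₗ[D] E)} (hV : IsOpt V) (s : Finset F)
    (hs : Module.finrank D E * Module.finrank F D ≤ s.card) {G : Submodule D E}
    (hst : ∀ M ∈ V, ∀ u ∈ G, M u ∈ G) {p : E →ₗ[D] Q} {j : Q →ₗ[D] E} (hpj : ∀ q, p (j q) = q)
    (hp : ∀ u, p u = 0 ↔ u ∈ G) (hq : ∀ M ∈ V, ∀ u, M u - u ∈ G → u ∈ G) :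
    IsOpt (InvertibleAffine.restrictTo G V) := by
  have ht0 : TrivSpec (InvertibleAffine.restrictTo G V) := by
    rintro N ⟨M, hM, h⟩ u hu
    refine Subtype.ext (hV.triv M hM u ?_)
    rw [← h, hu]
  have ht1 : TrivSpec (inducedOn p V) := by
    rintro N ⟨M, hM, h⟩ v hv
    rw [← hpj v] at hv ⊢
    rw [h, ← sub_eq_zero, ← map_sub, hp] at hv
    exact (hp _).2 (hq M hM _ hv)
  have hadd : Module.finrank D Q + Module.finrank D G = Module.finrank D E := by
    have h1 := LinearMap.finrank_range_add_finrank_ker p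
    rwa [LinearMap.range_eq_top.2 fun q => ⟨j q, hpj q⟩, finrank_top,
      show LinearMap.ker p = G from Submodule.ext hp] at h1
  have hle0 := ht0.finrank_le s (le_trans (Nat.mul_le_mul_right _ (by omega)) hs)
  have hle1 := ht1.finrank_le s (le_trans (Nat.mul_le_mul_right _ (by omega)) hs)
  refine ⟨ht0, le_antisymm hle0 ?_⟩
  -- With k = dim G and m = dim Q, the identity k(k+1) + m(m+1) + 2km = (k+m)(k+m+1) leaves no slack
  -- between the bounds.
  have h5 := finrank_le_restrictTo_add_inducedOn hst hpj hp
  have h4 := hV.dim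
  rw [← hadd] at h4
  generalize Module.finrank D Q = m at hle1 h5 h4
  generalize Module.finrank D G = k at hle0 h5 h4 ⊢
  generalize Module.finrank F (InvertibleAffine.restrictTo G V) = r at hle0 h5 ⊢
  generalize Module.finrank F (inducedOn p V) = q at hle1 h5
  generalize Module.finrank F D = d at *
  linarith

end Restrict

end InvertibleAffine

namespace InvertibleAffine

/-! ### Block-triangular form of an optimal operator space. -/

section Triangular

open Matrix

variable {F D : Type*} [Field F] [DivisionRing D] [Algebra F D]

/-- The properties of an associated pair that are used in the sequel. -/
structure IsPair (σ : D →ₗ[F] D) (e : D →ₗ[F] F) : Prop extends IsInvol σ where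
  ne_zero : e ≠ 0
  mul_comm : ∀ a b, e (a * b) = e (b * a)
  map_invol : ∀ a, e (σ a) = e a
  skew : ∀ a, e a = 0 → σ a = -a

/-- The form `w P u⋆` on rows, with values in `F`. -/
def rowForm {ι : Type*} [Fintype ι] (σ : D →ₗ[F] D) (e : D →ₗ[F] F) (P : Matrix ι ι D)
    (u w : ι → D) : F :=
  e ((w ᵥ* P) ⬝ᵥ fun j => σ (u j))

/-- The matrix `P` is block-diagonal with nonisotropic blocks, the blocks being the fibers of
`g`. -/
structure IsLevelNonisotropic {ι κ : Type*} [Fintype ι] (σ : D →ₗ[F] D) (e : D →ₗ[F] F) (g : ι → κ)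
    (P : Matrix ι ι D) : Prop where
  diag : ∀ i j, g i ≠ g j → P i j = 0
  nonisotropic : ∀ (l : κ) (u : ι → D), (∀ i, g i ≠ l → u i = 0) → rowForm σ e P u u = 0 → u = 0

/-- The matrices that are block-triangular with respect to the level function `g`, with diagonal
blocks in `P + SH`. -/
def flat {ι κ : Type*} [LT κ] (σ : D →ₗ[F] D) (e : D →ₗ[F] F) (g : ι → κ)
    (P : Matrix ι ι D) : Set (Matrix ι ι D) :=
  {M | (∀ i j, g j < g i → M i j = 0) ∧
    (∀ i j, g i = g j → σ (M j i - P j i) = -(M i j - P i j)) ∧ ∀ i, e (M i i - P i i) = 0}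

variable {E : Type*} [AddCommGroup E] [Module F E] [Module D E] [IsScalarTower F D E]
variable {σ : D →ₗ[F] D} {e : D →ₗ[F] F} {ι : Type*} [Fintype ι]

theorem IsPair.eq_zero (hp : IsPair σ e) {a : D} (h : ∀ q, e (q * a) = 0) : a = 0 := by
  by_contra ha
  apply hp.ne_zero
  ext q
  have := h (q * a⁻¹)
  rwa [mul_assoc, inv_mul_cancel₀ ha, mul_one] at this

/-- The entry P i j represents q ↦ B (v j) (q v i) as q ↦ e (q P i j). Sesquilinearity and e (ab) =
e (ba) give the general formula. -/
theorem exists_gram (hp : IsPair σ e) {B : E →ₗ[F] Module.Dual F E} (hB : NIForm σ B)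
    [FiniteDimensional F D] (v : ι → E) :
    ∃ P : Matrix ι ι D, ∀ u w : ι → D,
      B (∑ j, u j • v j) (∑ i, w i • v i) = rowForm σ e P u w := by
  have hex : ∀ i j, ∃ a : D, ∀ q, B (v j) (q • v i) = e (q * a) := fun i j =>
    exists_right_translate e hp.ne_zero (B (v j) ∘ₗ spanMap F (v i))
  choose P hP using hex
  refine ⟨Matrix.of P, fun u w => ?_⟩
  rw [rowForm, map_sum B, LinearMap.sum_apply, dotProduct, map_sum]
  refine Finset.sum_congr rfl fun j _ => ?_
  rw [vecMul, dotProduct, Finset.sum_mul, map_sum, map_sum]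
  refine Finset.sum_congr rfl fun i _ => ?_
  rw [hB.sesq, smul_smul, hP, hp.mul_comm _ (σ (u j)), mul_assoc]
  rfl

theorem rowForm_vecMul (m P : Matrix ι ι D) (u w : ι → D) :
    rowForm σ e P u (w ᵥ* m) = rowForm σ e (m * P) u w := by
  rw [rowForm, vecMul_vecMul, rowForm]

theorem rowForm_add_left (P : Matrix ι ι D) (u u' w : ι → D) :
    rowForm σ e P (u + u') w = rowForm σ e P u w + rowForm σ e P u' w := by
  simp_rw [rowForm, ← map_add, ← dotProduct_add]
  congr 2
  ext j
  simp

theorem rowForm_add_right (P : Matrix ι ι D) (u w w' : ι → D) :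
    rowForm σ e P u (w + w') = rowForm σ e P u w + rowForm σ e P u w' := by
  simp_rw [rowForm, add_vecMul, add_dotProduct, map_add]

theorem rowForm_single [DecidableEq ι] (P : Matrix ι ι D) (i j : ι) (a b : D) :
    rowForm σ e P (Pi.single j b) (Pi.single i a) = e (a * P i j * σ b) := by
  have h : (fun k => σ ((Pi.single j b : ι → D) k)) = Pi.single j (σ b) := by
    ext k
    by_cases hk : k = j
    · subst hk; simp
    · simp [hk]
  rw [rowForm, h, dotProduct_single, single_vecMul]
  rfl

/-- A matrix whose form is alternating is skew-Hermitian with diagonal entries in `ker e`. -/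
theorem skew_of_rowForm (hp : IsPair σ e) {N : Matrix ι ι D}
    (hN : ∀ u, rowForm σ e N u u = 0) :
    (∀ i j, σ (N j i) = -N i j) ∧ ∀ i, e (N i i) = 0 := by
  classical
  have hN2 : ∀ u w, rowForm σ e N u w + rowForm σ e N w u = 0 := by
    intro u w
    have := hN (u + w)
    rw [rowForm_add_left, rowForm_add_right, rowForm_add_right, hN, hN] at this
    linear_combination this
  refine ⟨fun i j => ?_, fun i => ?_⟩
  · rw [← add_eq_zero_iff_eq_neg]
    refine hp.eq_zero fun a => ?_
    have h := hN2 (Pi.single j 1) (Pi.single i a)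
    rw [rowForm_single, rowForm_single, hp.map_one, mul_one, one_mul,
      ← hp.map_invol (N j i * σ a), hp.mul, hp.invol] at h
    rw [mul_add, map_add]
    linear_combination h
  · have h := hN (Pi.single i 1)
    rwa [rowForm_single, hp.map_one, mul_one, one_mul] at h

/-- The matrix of an endomorphism acting on rows. -/
noncomputable def rowMatrix (b : Module.Basis ι D E) (M : E →ₗ[D] E) : Matrix ι ι D :=
  Matrix.of fun i j => b.repr (M (b i)) j

theorem apply_sum_rowMatrix (b : Module.Basis ι D E) (M : E →ₗ[D] E) (u : ι → D) :
    M (∑ i, u i • b i) = ∑ j, (u ᵥ* rowMatrix b M) j • b j := by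
  simp_rw [vecMul, dotProduct, Finset.sum_smul, map_sum, map_smul]
  rw [Finset.sum_comm]
  refine Finset.sum_congr rfl fun i _ => ?_
  simp_rw [mul_smul, ← Finset.smul_sum]
  congr 1
  exact (b.sum_repr (M (b i))).symm

variable {κ : Type*} [Fintype κ]

theorem rowForm_fromBlocks (P : Matrix ι ι D) (P' : Matrix κ κ D) (u w : ι ⊕ κ → D) :
    rowForm σ e (fromBlocks P 0 0 P') u w =
      rowForm σ e P (u ∘ Sum.inl) (w ∘ Sum.inl) + rowForm σ e P' (u ∘ Sum.inr) (w ∘ Sum.inr) := by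
  rw [rowForm, rowForm, rowForm, vecMul_fromBlocks, ← map_add]
  simp [dotProduct]

/-- The first block is level 0 and the levels of the second are shifted by one, so a vector
supported on one level lives in a single block. -/
theorem IsLevelNonisotropic.fromBlocks {P : Matrix ι ι D} {P' : Matrix κ κ D} {g : κ → ℕ}
    (hP : ∀ u, rowForm σ e P u u = 0 → u = 0) (hP' : IsLevelNonisotropic σ e g P') :
    IsLevelNonisotropic σ e (Sum.elim (fun _ => 0) (fun i => g i + 1) : ι ⊕ κ → ℕ)
      (Matrix.fromBlocks P 0 0 P') := by
  refine ⟨?_, fun l u hu h => ?_⟩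
  · rintro (i | i) (j | j) h
    · exact absurd rfl h
    · rfl
    · rfl
    · exact hP'.diag i j fun h' => h (by simp [h'])
  · rw [rowForm_fromBlocks] at h
    rcases l with _ | l
    · have h2 : u ∘ Sum.inr = 0 := by
        ext i
        exact hu (Sum.inr i) (by simp)
      rw [h2] at h
      have h3 := hP _ (by rwa [show rowForm σ e P' 0 0 = 0 by simp [rowForm], add_zero] at h)
      ext (i | i)
      · exact congrFun h3 i
      · exact congrFun h2 i
    · have h2 : u ∘ Sum.inl = 0 := by
        ext i
        exact hu (Sum.inl i) (by simp)
      rw [h2] at h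
      have h3 := hP'.nonisotropic l _ (fun i hi => hu (Sum.inr i) (by simpa using hi))
        (by rwa [show rowForm σ e P 0 0 = 0 by simp [rowForm], zero_add] at h)
      ext (i | i)
      · exact congrFun h2 i
      · exact congrFun h3 i

/-- The radical G of the invariant form B is stable and smaller than E. If Mu - u ∈ G, then 0 = B u
(Mu - u) = -B u u, so u ∈ G; hence the restriction to G is optimal and induction applies. A
complement of G carries a nonisotropic Gram matrix and becomes the first level. -/
theorem IsOpt.exists_triangular_aux [FiniteDimensional F D] (hp : IsPair σ e) (s : Finset F)
    (n : ℕ) :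
    ∀ {E : Type*} [AddCommGroup E] [Module F E] [Module D E] [IsScalarTower F D E]
      [FiniteDimensional D E] {V : Submodule F (E →ₗ[D] E)}, IsOpt V → Module.finrank D E = n →
      n * Module.finrank F D ≤ s.card →
      ∃ (ι : Type) (_ : Fintype ι) (b : Module.Basis ι D E) (g : ι → ℕ) (P : Matrix ι ι D),
        IsLevelNonisotropic σ e g P ∧ ∀ M ∈ V, rowMatrix b M * P ∈ flat σ e g 0 := by
  induction n using Nat.strong_induction_on with
  | _ n ih =>
    intro E _ _ _ _ _ V hV hn hs
    rcases Nat.eq_zero_or_pos n with h0 | h0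
    · have : Subsingleton E := Module.finrank_zero_iff.1 (hn.trans h0)
      exact ⟨Fin 0, inferInstance, Module.Basis.empty E, fun i => i.elim0, 0,
        ⟨fun i => i.elim0, fun l u _ _ => Subsingleton.elim _ _⟩,
        fun M _ => ⟨fun i => i.elim0, fun i => i.elim0, fun i => i.elim0⟩⟩
    obtain ⟨B, hB, hB0, hBV⟩ := hV.exists_form hp.toIsInvol (by omega) s (by rwa [hn])
    obtain ⟨G, hG⟩ : ∃ G : Submodule D E, ∀ u, u ∈ G ↔ B u u = 0 := ⟨hB.radical, fun u => Iff.rfl⟩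
    have hpol : ∀ M ∈ V, ∀ u ∈ G, ∀ w, B w (M u) = 0 := by
      intro M hM u hu w
      have h1 := hBV M hM (w + u)
      rwa [map_add B, hB.left u ((hG u).1 hu), add_zero, map_add M, map_add, hBV M hM,
        zero_add] at h1
    have hst : ∀ M ∈ V, ∀ u ∈ G, M u ∈ G := fun M hM u hu => (hG _).2 (hpol M hM u hu _)
    have hGlt : Module.finrank D G < n := by
      rw [← hn]
      refine Submodule.finrank_lt fun h => hB0 (LinearMap.ext fun u => hB.left u ((hG u).1 ?_))
      rw [h]
      trivial
    obtain ⟨H, hH⟩ := G.exists_isCompl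
    have hdisj : ∀ u ∈ H, B u u = 0 → u = 0 := fun u hu h =>
      Submodule.disjoint_def.1 hH.disjoint u ((hG u).2 h) hu
    have hq : ∀ M ∈ V, ∀ u, M u - u ∈ G → u ∈ G := by
      intro M hM u hu
      have h1 := hB.right _ ((hG _).1 hu) u
      rw [map_sub, hBV M hM, zero_sub, neg_eq_zero] at h1
      exact (hG u).2 h1
    have hV0 : IsOpt (InvertibleAffine.restrictTo G V) := hV.restrictTo s (by rwa [hn]) hst
      (p := H.projectionOnto G hH.symm) (j := H.subtype)
      (fun q => Submodule.projectionOnto_apply_left hH.symm q)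
      (fun u => Submodule.projectionOnto_apply_eq_zero_iff hH.symm) hq
    obtain ⟨κ, _, b₀, g, P₀, hP₀, hVP₀⟩ := ih _ hGlt hV0 rfl
      (le_trans (Nat.mul_le_mul_right _ hGlt.le) hs)
    let b₁ := Module.finBasis D H
    let v : Fin (Module.finrank D H) → E := fun i => b₁ i
    obtain ⟨P₁, hP₁⟩ := exists_gram hp hB v
    let b := (b₁.prod b₀).map (Submodule.prodEquivOfIsCompl H G hH.symm)
    have hbl : ∀ i, b (Sum.inl i) = v i := fun i => by simp [b, v]
    have hbr : ∀ i, b (Sum.inr i) = b₀ i := fun i => by simp [b]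
    have hnon : ∀ u, rowForm σ e P₁ u u = 0 → u = 0 := by
      intro u hu
      rw [← hP₁] at hu
      have h1 : ∑ j, u j • v j = ((∑ j, u j • b₁ j : H) : E) := by simp [v]
      rw [h1] at hu
      have h2 : ∑ j, u j • b₁ j = 0 := Subtype.ext (hdisj _ (Subtype.mem _) hu)
      ext j
      exact Fintype.linearIndependent_iff.1 b₁.linearIndependent u h2 j
    refine ⟨_, inferInstance, b, _, Matrix.fromBlocks P₁ 0 0 P₀, hP₀.fromBlocks hnon,
      fun M hM => ?_⟩
    have hMG : M.restrict (hst M hM) ∈ InvertibleAffine.restrictTo G V := ⟨M, hM, fun u => rfl⟩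
    have hrG : ∀ u : G, b.repr u = (b₁.prod b₀).repr (0, u) := by
      intro u
      simp [b]
    obtain ⟨m₁, m₂, hm⟩ : ∃ m₁ m₂, rowMatrix b M =
        Matrix.fromBlocks m₁ m₂ 0 (rowMatrix b₀ (M.restrict (hst M hM))) := by
      refine ⟨(rowMatrix b M).toBlocks₁₁, (rowMatrix b M).toBlocks₁₂, ?_⟩
      conv_lhs => rw [← Matrix.fromBlocks_toBlocks (rowMatrix b M)]
      congr 1
      · ext i j
        have h1 := hrG ⟨M (b₀ i), hst M hM _ (b₀ i).2⟩
        simp [rowMatrix, Matrix.toBlocks₂₁, hbr, h1]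
      · ext i j
        have h1 := hrG ⟨M (b₀ i), hst M hM _ (b₀ i).2⟩
        simp [rowMatrix, Matrix.toBlocks₂₂, hbr, h1]
        rfl
    -- For u in the complement, the part of M u in G is invisible to B, so B u (M u) = 0 says that
    -- the form of m₁ P₁ is alternating.
    have hskew := skew_of_rowForm hp (N := m₁ * P₁) (by
      intro u
      rw [← rowForm_vecMul, ← hP₁]
      have h1 := apply_sum_rowMatrix b M (Sum.elim u 0)
      rw [hm, Matrix.vecMul_fromBlocks] at h1
      simp only [Fintype.sum_sum_type, Sum.elim_inl, Sum.elim_inr, hbl, hbr] at h1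
      have h2 : Sum.elim u (0 : κ → D) ∘ Sum.inl = u := rfl
      have h3 : Sum.elim u (0 : κ → D) ∘ Sum.inr = 0 := rfl
      rw [h2, h3] at h1
      simp only [Pi.zero_apply, zero_smul, Finset.sum_const_zero, add_zero, Matrix.zero_vecMul]
        at h1
      have h4 := hBV M hM (∑ i, u i • v i)
      rw [h1, map_add] at h4
      rwa [hB.right (∑ j, (u ᵥ* m₂) j • (b₀ j : E)), add_zero] at h4
      exact (hG _).1 (Submodule.sum_mem _ fun j _ => Submodule.smul_mem _ _ (b₀ j).2))
    obtain ⟨k1, k2, k3⟩ := hVP₀ _ hMG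
    rw [hm, Matrix.fromBlocks_multiply]
    simp only [Matrix.mul_zero, Matrix.zero_mul, add_zero, zero_add]
    refine ⟨?_, ?_, ?_⟩
    · rintro (i | i) (j | j) h
      · simp at h
      · simp at h
      · rfl
      · exact k1 i j (by simpa using h)
    · rintro (i | i) (j | j) h
      · simpa using hskew.1 i j
      · simp at h
      · simp at h
      · exact k2 i j (by simpa using h)
    · rintro (i | i)
      · simpa using hskew.2 i
      · exact k3 i

/-- An optimal space is contained, in suitable coordinates and up to a right factor, in a space of
block-triangular matrices with skew-Hermitian diagonal blocks. -/
theorem IsOpt.exists_triangular [FiniteDimensional F D] [FiniteDimensional D E] (hp : IsPair σ e)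
    (s : Finset F) (hs : Module.finrank D E * Module.finrank F D ≤ s.card)
    {V : Submodule F (E →ₗ[D] E)} (hV : IsOpt V) :
    ∃ (ι : Type) (_ : Fintype ι) (b : Module.Basis ι D E) (g : ι → ℕ) (P : Matrix ι ι D),
      IsLevelNonisotropic σ e g P ∧ ∀ M ∈ V, rowMatrix b M * P ∈ flat σ e g 0 :=
  IsOpt.exists_triangular_aux hp s _ hV rfl hs

end Triangular

end InvertibleAffine

namespace InvertibleAffine

/-! ### The common properties of associated pairs, case by case. -/

section Pair

variable {F D : Type*} [Field F] [DivisionRing D] [Algebra F D]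

/-- If `x + σ x` is the scalar `e x` for every `x`, then `(σ, e)` has all the properties of an
associated pair. -/
theorem IsInvol.isPair {σ : D →ₗ[F] D} {e : D →ₗ[F] F} (hσ : IsInvol σ)
    (h : ∀ x, algebraMap F D (e x) = x + σ x) (he : e ≠ 0) : IsPair σ e where
  toIsInvol := hσ
  ne_zero := he
  mul_comm a b := by
    apply (algebraMap F D).injective
    have ha : σ a = algebraMap F D (e a) - a := eq_sub_of_add_eq' (h a).symm
    have hb : σ b = algebraMap F D (e b) - b := eq_sub_of_add_eq' (h b).symm
    rw [h, h, hσ.mul, hσ.mul, ha, hb]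
    have h1 := Algebra.commutes (e a) b
    have h2 := Algebra.commutes (e b) a
    have h3 := Algebra.commutes (e a) (algebraMap F D (e b))
    simp only [sub_mul, mul_sub, h1, h2, h3]
    abel
  map_invol a := by
    apply (algebraMap F D).injective
    rw [h, h, hσ.invol, add_comm]
  skew a ha := by
    have h1 := h a
    rw [ha, map_zero] at h1
    exact eq_neg_of_add_eq_zero_right h1.symm

theorem isPair_id_of_finrank_eq_one [FiniteDimensional F D] {e : D →ₗ[F] F} (hd : Module.finrank F D = 1)
    (he : ∀ x, e x = LinearMap.trace F D (LinearMap.mulLeft F x)) : IsPair LinearMap.id e := by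
  have hs : ∀ x : D, ∃ a : F, a • (1 : D) = x := fun x =>
    (finrank_eq_one_iff_of_nonzero' (1 : D) one_ne_zero).1 hd x
  have h1 : e 1 = 1 := by
    rw [he, LinearMap.mulLeft_one, LinearMap.trace_id, hd, Nat.cast_one]
  have hc : ∀ a b : D, a * b = b * a := by
    intro a b
    obtain ⟨a, rfl⟩ := hs a
    simp
  refine ⟨⟨fun a b => hc a b, fun a => rfl, fun a => ?_⟩, ?_, fun a b => by rw [hc],
    fun a => rfl, fun a ha => ?_⟩
  · obtain ⟨a, rfl⟩ := hs a
    exact ⟨a * a, by simp [Algebra.algebraMap_eq_smul_one, smul_smul]⟩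
  · rintro rfl
    simp at h1
  · obtain ⟨a, rfl⟩ := hs a
    rw [map_smul, h1, smul_eq_mul, mul_one] at ha
    simp [ha]

theorem isPair_id_of_isHyperRadicial {e : D →ₗ[F] F} (hD : IsHyperRadicial F D) (he : e ≠ 0) :
    IsPair LinearMap.id e := by
  obtain ⟨hchar, -, hc, hsq⟩ := hD
  have : CharP D 2 := charP_of_injective_algebraMap (algebraMap F D).injective 2
  refine ⟨⟨fun a b => hc a b, fun a => rfl, fun a => ?_⟩, he, fun a b => by rw [hc],
    fun a => rfl, fun a _ => (CharTwo.neg_eq a).symm⟩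
  obtain ⟨b, hb⟩ := hsq a
  exact ⟨b, by rw [← hb, sq]; rfl⟩

theorem isPair_of_isSeparableQuadratic {e : D →ₗ[F] F} (hd : Module.finrank F D = 2)
    (hc : ∀ x y : D, x * y = y * x) {τ : D ≃ₐ[F] D} (hτ : τ ≠ AlgEquiv.refl)
    (he : ∀ x, e x = LinearMap.trace F D (LinearMap.mulLeft F x)) :
    IsPair τ.toLinearMap e := by
  obtain ⟨y, hy⟩ : ∃ y, τ y ≠ y := by
    by_contra! h
    exact hτ (AlgEquiv.ext h)
  have hli : LinearIndependent F ![(1 : D), y] := by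
    rw [LinearIndependent.pair_iff' one_ne_zero]
    rintro a rfl
    exact hy (by rw [map_smul, map_one])
  let b := basisOfLinearIndependentOfCardEqFinrank hli (by simp [hd])
  have hb0 : b 0 = 1 := by simp [b]
  have hb1 : b 1 = y := by simp [b]
  have hrep : ∀ x : D, ∃ s t : F, x = algebraMap F D s + algebraMap F D t * y := fun x =>
    ⟨b.repr x 0, b.repr x 1, by
      conv_lhs => rw [← b.sum_repr x]
      rw [Fin.sum_univ_two, hb0, hb1, Algebra.smul_def, Algebra.smul_def, mul_one]⟩
  -- From y² = q + p y and τ y ≠ y one gets τ y = p - y. So x + τ x and the norm are scalars, and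
  -- the trace computed in the basis 1, y is x + τ x.
  obtain ⟨q, p, hpq⟩ := hrep (y * y)
  have hτy : τ y = algebraMap F D p - y := by
    have h1 := congrArg τ hpq
    simp only [map_mul, map_add, AlgEquiv.commutes] at h1
    have h2 : (τ y - y) * (τ y + y - algebraMap F D p) = 0 := by
      have h3 := hc (τ y) y
      have h4 := hc (τ y) (algebraMap F D p)
      have h5 := hc y (algebraMap F D p)
      simp only [sub_mul, mul_sub, mul_add, h1, h3, h4, h5, hpq]
      abel
    have h3 := (mul_eq_zero.1 h2).resolve_left (sub_ne_zero.2 hy)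
    rw [sub_eq_zero] at h3
    exact eq_sub_of_add_eq h3
  have hτr : ∀ s t : F, τ (algebraMap F D s + algebraMap F D t * y) =
      algebraMap F D s + algebraMap F D t * (algebraMap F D p - y) := fun s t => by
    rw [map_add, map_mul, AlgEquiv.commutes, AlgEquiv.commutes, hτy]
  have hinv : IsInvol τ.toLinearMap := by
    refine ⟨fun a c => ?_, fun a => ?_, fun a => ?_⟩
    · rw [AlgEquiv.toLinearMap_apply, map_mul, hc]
      rfl
    · obtain ⟨s, t, rfl⟩ := hrep a
      simp only [AlgEquiv.toLinearMap_apply]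
      rw [hτr, map_add, map_mul, map_sub, AlgEquiv.commutes, AlgEquiv.commutes, AlgEquiv.commutes,
        hτy, sub_sub_cancel]
    · obtain ⟨s, t, rfl⟩ := hrep a
      refine ⟨s * s + s * t * p - t * t * q, ?_⟩
      simp only [AlgEquiv.toLinearMap_apply]
      rw [hτr]
      let : Field D := { (inferInstance : DivisionRing D) with mul_comm := hc }
      simp only [map_sub, map_add, map_mul]
      linear_combination (-algebraMap F D t * algebraMap F D t) * hpq
  have htr : ∀ x, algebraMap F D (e x) = x + τ x := by
    intro x
    obtain ⟨s, t, rfl⟩ := hrep x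
    have hey : e y = p := by
      have h0 : y * b 0 = b 1 := by rw [hb0, hb1, mul_one]
      have h1 : y * b 1 = q • b 0 + p • b 1 := by
        rw [hb0, hb1, hpq, Algebra.smul_def, Algebra.smul_def, mul_one]
      rw [he, LinearMap.trace_eq_matrix_trace F b, Matrix.trace_fin_two, LinearMap.toMatrix_apply,
        LinearMap.toMatrix_apply, LinearMap.mulLeft_apply, LinearMap.mulLeft_apply, h0, h1]
      simp
    have he1 : e 1 = 1 + 1 := by
      rw [he, LinearMap.mulLeft_one, LinearMap.trace_eq_matrix_trace F b, Matrix.trace_fin_two,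
        LinearMap.toMatrix_apply, LinearMap.toMatrix_apply]
      simp
    have h2 : algebraMap F D s + algebraMap F D t * y = s • (1 : D) + t • y := by
      rw [Algebra.smul_def, Algebra.smul_def, mul_one]
    have h3 : e (algebraMap F D s + algebraMap F D t * y) = s * (1 + 1) + t * p := by
      rw [h2, map_add, map_smul, map_smul, he1, hey, smul_eq_mul, smul_eq_mul]
    rw [hτr, h3]
    simp only [map_add, map_mul, mul_sub, mul_add, mul_one]
    abel
  refine hinv.isPair htr ?_
  rintro rfl
  have h1 := htr 1
  have h2 := htr y
  rw [LinearMap.zero_apply, map_zero, map_one] at h1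
  rw [LinearMap.zero_apply, map_zero] at h2
  have h3 : (1 + 1) * y = y + y := by rw [add_mul, one_mul]
  rw [← h1, zero_mul, h2] at h3
  exact hy (add_left_cancel h3)

theorem exists_isPair_of_isQuaternion {σ : D → D} {e : D →ₗ[F] F} {a b c : F}
    (hd : Module.finrank F D = 4) (hD : Algebra.IsCentral F D)
    (φ : D ≃ₐ[F] QuaternionAlgebra F a b c) (hσ : ∀ x, φ (σ x) = star (φ x))
    (he : ∀ x, algebraMap F D (e x) = x + σ x) :
    ∃ σ' : D →ₗ[F] D, (∀ x, σ' x = σ x) ∧ IsPair σ' e := by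
  let σ' : D →ₗ[F] D :=
    { toFun := σ
      map_add' := fun x y => φ.injective (by simp [hσ])
      map_smul' := fun t x => φ.injective (by simp [hσ]) }
  have hσ' : ∀ x, φ (σ' x) = star (φ x) := hσ
  have hinv : IsInvol σ' := by
    refine ⟨fun x y => φ.injective (by simp [hσ']), fun x => φ.injective (by simp [hσ']),
      fun x => ?_⟩
    obtain ⟨ν, hν⟩ : ∃ ν : F, star (φ x) * φ x = algebraMap F _ ν :=
      ⟨_, QuaternionAlgebra.star_mul_eq_coe _⟩
    exact ⟨ν, φ.injective (by rw [map_mul, hσ', hν, AlgEquiv.commutes])⟩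
  refine ⟨σ', fun x => rfl, hinv.isPair he ?_⟩
  -- If e were zero, x + σ x = 0 for all x; at x = 1 this gives 1 + 1 = 0, so σ is the identity. An
  -- antiautomorphism equal to the identity makes D commutative, against centrality in degree 4.
  rintro rfl
  have h0 : ∀ x, x + σ' x = 0 := fun x => by
    have := he x
    rw [LinearMap.zero_apply, map_zero] at this
    exact this.symm
  have h1 := h0 1
  rw [hinv.map_one] at h1
  have h2 : ∀ x, σ' x = x := fun x => by
    have h3 : x + x = 0 := by rw [← one_mul x, ← add_mul, h1, zero_mul]
    exact add_left_cancel ((h0 x).trans h3.symm)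
  have h3 : ∀ x y : D, x * y = y * x := fun x y => by
    rw [← h2 (x * y), hinv.mul, h2, h2]
  have h4 : (⊥ : Subalgebra F D) = ⊤ := by
    rw [← Algebra.IsCentral.center_eq_bot F D, eq_top_iff]
    exact fun x _ => Subalgebra.mem_center_iff.2 fun y => h3 y x
  have h5 := Subalgebra.bot_eq_top_iff_finrank_eq_one.1 h4
  omega

theorem IsAssociatedPair.exists_isPair [FiniteDimensional F D] {σ : D → D} {e : D →ₗ[F] F} (h : IsAssociatedPair σ e) :
    ∃ σ' : D →ₗ[F] D, (∀ x, σ' x = σ x) ∧ IsPair σ' e := by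
  rcases h.involution.quadraticType with hd | hd | hd | hd
  · exact ⟨LinearMap.id, fun x => by rw [h.involution.degree_one hd]; rfl,
      isPair_id_of_finrank_eq_one hd (h.degree_one hd)⟩
  · obtain ⟨τ, hτ, hστ⟩ := h.involution.separable hd
    exact ⟨τ.toLinearMap, fun x => (hστ x).symm,
      isPair_of_isSeparableQuadratic hd.1 hd.2.1 hτ (h.separable hd)⟩
  · obtain ⟨a, b, c, φ, hφ⟩ := h.involution.quaternion hd
    exact exists_isPair_of_isQuaternion hd.1 hd.2.1 φ hφ (h.quaternion hd)
  · exact ⟨LinearMap.id, fun x => by rw [h.involution.hyperRadicial hd]; rfl,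
      isPair_id_of_isHyperRadicial hd (h.hyperRadicial hd)⟩

end Pair

end InvertibleAffine

namespace InvertibleAffine

/-! ### The triangular model spaces: invertibility and dimension. -/

section Flat

open Matrix

variable {F D : Type*} [Field F] [DivisionRing D] [Algebra F D]
variable {σ : D →ₗ[F] D} {e : D →ₗ[F] F} {ι κ : Type*} [Fintype ι]

theorem isUnit_of_forall_vecMul [DecidableEq ι] {M : Matrix ι ι D}
    (h : ∀ x, x ᵥ* M = 0 → x = 0) : IsUnit M := by
  have hinj : Function.Injective M.vecMulLinear :=
    (injective_iff_map_eq_zero M.vecMulLinear).2 h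
  have hsurj := LinearMap.injective_iff_surjective.1 hinj
  choose r hr using fun i : ι => hsurj (Pi.single i 1)
  have h1 : Matrix.of r * M = 1 := by
    ext i j
    have := congrFun (hr i) j
    rw [vecMulLinear_apply] at this
    rw [mul_apply_eq_vecMul]
    change (r i ᵥ* M) j = _
    rw [this, one_apply, Pi.single_apply]
    simp [eq_comm]
  exact IsUnit.of_mul_eq_one_right _ h1

theorem eq_zero_of_isUnit [DecidableEq ι] {M : Matrix ι ι D} (h : IsUnit M) {x : ι → D}
    (hx : x ᵥ* M = 0) : x = 0 :=
  vecMul_injective_of_isUnit h (by simpa using hx)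

theorem rowForm_eq_sum (P : Matrix ι ι D) (u w : ι → D) :
    rowForm σ e P u w = ∑ p : ι × ι, e (w p.1 * P p.1 p.2 * σ (u p.2)) := by
  rw [rowForm, dotProduct, map_sum, Fintype.sum_prod_type_right]
  refine Finset.sum_congr rfl fun j _ => ?_
  rw [vecMul, dotProduct, Finset.sum_mul, map_sum]

/-- The form of a matrix with skew-Hermitian diagonal blocks vanishes on each level. -/
theorem rowForm_self_eq_zero (hp : IsPair σ e) {g : ι → κ} {N : Matrix ι ι D}
    (h1 : ∀ i j, g i = g j → σ (N j i) = -N i j) (h2 : ∀ i, e (N i i) = 0) {l : κ} {u : ι → D}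
    (hu : ∀ i, g i ≠ l → u i = 0) : rowForm σ e N u u = 0 := by
  rw [rowForm_eq_sum]
  -- The terms at (i, j) and (j, i) cancel. A diagonal term is a norm times e (N j j) = 0.
  refine Finset.sum_involution (fun p _ => p.swap) ?_ ?_ (fun _ _ => Finset.mem_univ _)
    (fun _ _ => rfl)
  · rintro ⟨i, j⟩ -
    by_cases hi : g i = l
    · by_cases hj : g j = l
      · have h3 := hp.map_invol (u j * N j i * σ (u i))
        rw [hp.mul, hp.mul, hp.invol, h1 i j (hi.trans hj.symm), neg_mul, mul_neg, map_neg,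
          ← mul_assoc] at h3
        change _ + e (u j * N j i * σ (u i)) = 0
        rw [← h3, add_neg_cancel]
      · simp [hu j hj]
    · simp [hu i hi]
  · rintro ⟨i, j⟩ - h hij
    obtain rfl : j = i := congrArg Prod.fst hij
    apply h
    change e (u j * N j j * σ (u j)) = 0
    obtain ⟨ν, hν⟩ := hp.norm (u j)
    rw [mul_assoc, hp.mul_comm, mul_assoc, hν, hp.mul_comm, ← Algebra.smul_def, map_smul, h2,
      smul_zero]

/-- The direction of the affine space `flat σ e g P`. -/
def flatDir [LT κ] (σ : D →ₗ[F] D) (e : D →ₗ[F] F) (g : ι → κ) : Submodule F (Matrix ι ι D) where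
  carrier := flat σ e g 0
  add_mem' := by
    rintro M M' ⟨h1, h2, h3⟩ ⟨h1', h2', h3'⟩
    refine ⟨fun i j h => ?_, fun i j h => ?_, fun i => ?_⟩
    · rw [Matrix.add_apply, h1 i j h, h1' i j h, add_zero]
    · have k := h2 i j h
      have k' := h2' i j h
      simp only [Matrix.zero_apply, sub_zero] at k k'
      simp only [Matrix.zero_apply, sub_zero, Matrix.add_apply, map_add, k, k']
      abel
    · have k := h3 i
      have k' := h3' i
      simp only [Matrix.zero_apply, sub_zero] at k k'
      simp only [Matrix.zero_apply, sub_zero, Matrix.add_apply, map_add, k, k', add_zero]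
  zero_mem' := ⟨fun _ _ _ => rfl, fun _ _ _ => by simp, fun _ => by simp⟩
  smul_mem' := by
    rintro a M ⟨h1, h2, h3⟩
    refine ⟨fun i j h => ?_, fun i j h => ?_, fun i => ?_⟩
    · rw [Matrix.smul_apply, h1 i j h, smul_zero]
    · have k := h2 i j h
      simp only [Matrix.zero_apply, sub_zero] at k
      simp only [Matrix.zero_apply, sub_zero, Matrix.smul_apply, map_smul, k, smul_neg]
    · have k := h3 i
      simp only [Matrix.zero_apply, sub_zero] at k
      simp only [Matrix.zero_apply, sub_zero, Matrix.smul_apply, map_smul, k, smul_zero]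

omit [Fintype ι] in
theorem mem_flatDir [LT κ] {g : ι → κ} {M : Matrix ι ι D} : M ∈ flatDir σ e g ↔
    (∀ i j, g j < g i → M i j = 0) ∧ (∀ i j, g i = g j → σ (M j i) = -M i j) ∧
      ∀ i, e (M i i) = 0 := by
  change M ∈ flat σ e g 0 ↔ _
  simp [flat]

omit [Fintype ι] in
theorem mem_flat_iff [Preorder κ] {g : ι → κ} {M P : Matrix ι ι D}
    (hP : ∀ i j, g i ≠ g j → P i j = 0) : M ∈ flat σ e g P ↔ M - P ∈ flatDir σ e g := by
  rw [mem_flatDir]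
  refine and_congr (forall_congr' fun i => forall_congr' fun j => forall_congr' fun h => ?_) Iff.rfl
  rw [Matrix.sub_apply, hP i j h.ne', sub_zero]

/-- Every matrix of `flat σ e g P` is invertible. -/
theorem IsLevelNonisotropic.isUnit [LinearOrder κ] [DecidableEq ι] (hp : IsPair σ e) {g : ι → κ}
    {P : Matrix ι ι D} (hP : IsLevelNonisotropic σ e g P) {M : Matrix ι ι D}
    (hM : M ∈ flat σ e g P) : IsUnit M := by
  classical
  refine isUnit_of_forall_vecMul fun x hx => ?_
  by_contra hx0
  obtain ⟨k, hk⟩ : ∃ k, x k ≠ 0 := by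
    by_contra! h
    exact hx0 (funext h)
  obtain ⟨i₀, hi₀, hmin⟩ := Finset.exists_min_image (Finset.univ.filter fun i => x i ≠ 0) g
    ⟨k, by simpa using hk⟩
  simp only [Finset.mem_filter, Finset.mem_univ, true_and] at hi₀ hmin
  set u : ι → D := fun i => if g i = g i₀ then x i else 0 with hu
  have hul : ∀ i, g i ≠ g i₀ → u i = 0 := fun i hi => if_neg hi
  -- Since u is the part of x on its lowest nonzero level, block-triangularity makes xM and uM agree
  -- there. Thus the form of M vanishes at u, and so does that of P.
  have h1 : ∀ j, g j = g i₀ → (u ᵥ* M) j = 0 := by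
    intro j hj
    suffices h0 : (u ᵥ* M) j = (x ᵥ* M) j by
      rw [h0, hx]
      rfl
    refine Finset.sum_congr rfl fun i _ => ?_
    change u i * M i j = x i * M i j
    by_cases hi : g i = g i₀
    · simp [hu, hi]
    · rw [hul i hi, zero_mul]
      by_cases hxi : x i = 0
      · rw [hxi, zero_mul]
      · rw [hM.1 i j (by rw [hj]; exact lt_of_le_of_ne (hmin i hxi) (Ne.symm hi)), mul_zero]
  have h2 : rowForm σ e M u u = 0 := by
    rw [rowForm, dotProduct, Finset.sum_eq_zero, map_zero]
    intro j _
    by_cases hj : g j = g i₀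
    · rw [h1 j hj, zero_mul]
    · rw [hul j hj, map_zero, mul_zero]
  have h3 := rowForm_self_eq_zero hp (N := M - P) hM.2.1 hM.2.2 hul
  have h4 : rowForm σ e (M - P) u u = rowForm σ e M u u - rowForm σ e P u u := by
    rw [rowForm, vecMul_sub, sub_dotProduct, map_sub]
    rfl
  rw [h4, h2, zero_sub, neg_eq_zero] at h3
  have h5 := congrFun (hP.nonisotropic _ u hul h3) i₀
  exact hi₀ (by simpa [hu] using h5)

theorem card_sigma_fin (n : ℕ) : 2 * Fintype.card (Σ i : Fin n, Fin i) + n = n * n := by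
  rw [Fintype.card_sigma]
  simp only [Fintype.card_fin]
  rw [Fin.sum_univ_eq_sum_range (fun i => i), mul_comm, Finset.sum_range_id_mul_two]
  rcases n with _ | n
  · rfl
  · simp only [Nat.add_sub_cancel]
    ring

/-- The space contains the solutions of one D-valued equation for each pair j < i, and of n scalar
equations on the diagonal. So its dimension is at least d n² - d n(n-1)/2 - n, with no need for the
equations to be independent. -/
theorem le_finrank_flatDir [FiniteDimensional F D] [LinearOrder κ] (hp : IsPair σ e) {n : ℕ}
    (g : Fin n → κ) :
    Module.finrank F D * (n * (n + 1)) ≤ 2 * Module.finrank F (flatDir σ e g) + 2 * n := by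
  let idx : (Σ i : Fin n, Fin i) → Fin n := fun p => ⟨p.2, p.2.2.trans p.1.2⟩
  let Φ : Matrix (Fin n) (Fin n) D →ₗ[F] ((Σ i : Fin n, Fin i) → D) × (Fin n → F) :=
    { toFun := fun M => (fun p =>
        if g p.1 < g (idx p) then M (idx p) p.1 else
        if g (idx p) < g p.1 then M p.1 (idx p) else
        σ (M p.1 (idx p)) + M (idx p) p.1, fun i => e (M i i))
      map_add' := fun M M' => by
        refine Prod.ext (funext fun p => ?_) (funext fun i => ?_)
        · simp only [Matrix.add_apply, map_add, Prod.fst_add, Pi.add_apply]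
          split_ifs
          · rfl
          · rfl
          · abel
        · simp
      map_smul' := fun a M => by
        refine Prod.ext (funext fun p => ?_) (funext fun i => ?_)
        · simp only [Matrix.smul_apply, map_smul, Prod.smul_fst, Pi.smul_apply, RingHom.id_apply]
          split_ifs
          · rfl
          · rfl
          · rw [smul_add]
        · simp }
  have hker : LinearMap.ker Φ ≤ flatDir σ e g := by
    intro M hM
    have h1 := fun p => congrFun (congrArg Prod.fst (LinearMap.mem_ker.1 hM)) p
    have h2 : ∀ i, e (M i i) = 0 := fun i => congrFun (congrArg Prod.snd (LinearMap.mem_ker.1 hM)) i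
    have h3 : ∀ i j : Fin n, j < i →
        (if g i < g j then M j i else if g j < g i then M i j else σ (M i j) + M j i) = 0 :=
      fun i j h => h1 ⟨i, ⟨j, h⟩⟩
    refine mem_flatDir.2 ⟨fun i j h => ?_, fun i j h => ?_, h2⟩
    · rcases lt_trichotomy i j with hij | rfl | hij
      · simpa [h] using h3 j i hij
      · exact absurd h (lt_irrefl _)
      · simpa [h, h.not_gt] using h3 i j hij
    · rcases lt_trichotomy i j with hij | rfl | hij
      · have h4 := h3 j i hij
        simp only [h, lt_irrefl, if_false] at h4
        exact eq_neg_of_add_eq_zero_left h4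
      · exact hp.skew _ (h2 i)
      · have h4 := h3 i j hij
        simp only [h, lt_irrefl, if_false] at h4
        have h5 := congrArg σ (eq_neg_of_add_eq_zero_left h4)
        rw [hp.invol, map_neg] at h5
        rw [h5, neg_neg]
  have h1 := LinearMap.finrank_range_add_finrank_ker Φ
  have h2 := Submodule.finrank_mono hker
  have h3 := Submodule.finrank_le (LinearMap.range Φ)
  rw [Module.finrank_prod, Module.finrank_pi_fintype, Module.finrank_pi_fintype] at h3
  rw [Module.finrank_matrix] at h1
  simp only [Finset.sum_const, Finset.card_univ, Fintype.card_fin, Module.finrank_self,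
    smul_eq_mul] at h1 h3
  have h4 := card_sigma_fin n
  generalize Fintype.card (Σ i : Fin n, Fin i) = c at h3 h4
  generalize Module.finrank F D = d at *
  have h5 : d * (n * (n + 1)) = 2 * (n * n * d) - 2 * (c * d) := by
    have h6 : n * n * d = 2 * (c * d) + n * d := by rw [← h4]; ring
    have h7 : d * (n * (n + 1)) = n * n * d + n * d := by ring
    omega
  omega

end Flat

end InvertibleAffine

namespace InvertibleAffine

/-! ### From optimal affine spaces to the triangular models. -/

section Optimal

open Matrix

variable {F D : Type*} [Field F] [DivisionRing D] [Algebra F D]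
variable {σ : D →ₗ[F] D} {e : D →ₗ[F] F} {n : ℕ}

/-- The action on rows of the matrices `N W`. -/
def rowEnd (F : Type*) [Field F] [Algebra F D] (W : Matrix (Fin n) (Fin n) D) :
    Matrix (Fin n) (Fin n) D →ₗ[F] ((Fin n → D) →ₗ[D] (Fin n → D)) where
  toFun N := (N * W).vecMulLinear
  map_add' N N' := by
    ext
    simp [add_mul]
  map_smul' a N := by
    refine LinearMap.ext fun x => ?_
    rw [vecMulLinear_apply, smul_mul, vecMul_smul]
    rfl

theorem rowEnd_apply (W N : Matrix (Fin n) (Fin n) D) (x : Fin n → D) :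
    rowEnd F W N x = x ᵥ* (N * W) := rfl

theorem rowEnd_injective {W : Matrix (Fin n) (Fin n) D} (hW : IsUnit W) :
    Function.Injective (rowEnd F W) := by
  refine (injective_iff_map_eq_zero (rowEnd F W)).2 fun N hN => ?_
  have h1 : N * W = 0 := by
    ext i j
    have := congrFun (LinearMap.congr_fun hN (Pi.single i 1)) j
    rw [rowEnd_apply, single_one_vecMul] at this
    exact this
  exact hW.mul_left_eq_zero.1 h1

variable {A : AffineSubspace F (Matrix (Fin n) (Fin n) D)}

/-- A row x fixed by N M₀⁻¹ satisfies x (M₀ - N) = 0, and M₀ - N belongs to the affine space. -/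
theorem IsAffineInvertible.trivSpec (hA : IsAffineInvertible A) {M₀ W : Matrix (Fin n) (Fin n) D}
    (hM₀ : M₀ ∈ A) (hW : M₀ * W = 1) : TrivSpec (A.direction.map (rowEnd F W)) := by
  rintro - ⟨N, hN, rfl⟩ x hx
  have hW' : W * M₀ = 1 := mul_eq_one_comm.1 hW
  have h1 : M₀ - N ∈ A := by
    have := AffineSubspace.vadd_mem_of_mem_direction (neg_mem hN) hM₀
    rwa [vadd_eq_add, neg_add_eq_sub] at this
  refine eq_zero_of_isUnit (hA.2 _ h1) ?_
  rw [rowEnd_apply] at hx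
  have h2 := congrArg (fun y => y ᵥ* M₀) hx
  simp only [vecMul_vecMul, Matrix.mul_assoc, hW', Matrix.mul_one] at h2
  rw [vecMul_sub, h2, sub_self]

theorem IsAffineInvertible.exists_inverse (hA : IsAffineInvertible A)
    {M₀ : Matrix (Fin n) (Fin n) D} (hM₀ : M₀ ∈ A) :
    ∃ W : Matrix (Fin n) (Fin n) D, IsUnit W ∧ M₀ * W = 1 := by
  obtain ⟨u, hu⟩ := hA.2 _ hM₀
  exact ⟨(u⁻¹ : (Matrix (Fin n) (Fin n) D)ˣ), Units.isUnit _, by rw [← hu, Units.mul_inv]⟩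

variable [FiniteDimensional F D]

theorem IsAffineInvertible.finrank_le (hA : IsAffineInvertible A) (s : Finset F)
    (hs : n * Module.finrank F D ≤ s.card) :
    2 * Module.finrank F A.direction + 2 * n ≤ Module.finrank F D * (n * (n + 1)) := by
  obtain ⟨M₀, hM₀⟩ := hA.1
  obtain ⟨W, hWu, hW⟩ := hA.exists_inverse hM₀
  have h := (hA.trivSpec hM₀ hW).finrank_le s (by simpa using hs)
  rwa [Module.finrank_fin_fun, ← (Submodule.equivMapOfInjective _ (rowEnd_injective hWu) _).finrank_eq] at h

variable {κ : Type*} [LinearOrder κ] {g : Fin n → κ} {P : Matrix (Fin n) (Fin n) D}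

/-- The affine space with underlying set `flat σ e g P`. -/
def flatSpace (σ : D →ₗ[F] D) (e : D →ₗ[F] F) (g : Fin n → κ) (P : Matrix (Fin n) (Fin n) D) :
    AffineSubspace F (Matrix (Fin n) (Fin n) D) := AffineSubspace.mk' P (flatDir σ e g)

omit [FiniteDimensional F D] in
theorem coe_flatSpace (hP : IsLevelNonisotropic σ e g P) :
    (flatSpace σ e g P : Set (Matrix (Fin n) (Fin n) D)) = flat σ e g P := by
  ext M
  rw [mem_flat_iff hP.diag]
  exact AffineSubspace.mem_mk'

theorem isOptimal_flatSpace (hp : IsPair σ e) (hP : IsLevelNonisotropic σ e g P) (s : Finset F)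
    (hs : n * Module.finrank F D ≤ s.card) : IsOptimalAffineInvertible (flatSpace σ e g P) := by
  refine ⟨⟨⟨P, AffineSubspace.self_mem_mk' _ _⟩, fun M hM => hP.isUnit hp ?_⟩, fun B hB => ?_⟩
  · rw [← coe_flatSpace hP]
    exact hM
  · have h1 := hB.finrank_le s hs
    have h2 := le_finrank_flatDir hp g
    rw [flatSpace, AffineSubspace.direction_mk']
    omega

omit [FiniteDimensional F D] in
-- A scalar diagonal matrix with e a ≠ 0 and one level per index works, e (u a σ(u)) being a norm
-- times e a. This shows that the bound is always attained.
theorem IsPair.exists_isLevelNonisotropic (hp : IsPair σ e) (n : ℕ) :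
    ∃ P : Matrix (Fin n) (Fin n) D, IsLevelNonisotropic σ e id P := by
  obtain ⟨a, ha⟩ : ∃ a, e a ≠ 0 := by
    by_contra! h
    exact hp.ne_zero (LinearMap.ext h)
  refine ⟨diagonal fun _ => a, fun i j h => diagonal_apply_ne _ h, fun l u hu h => ?_⟩
  rw [rowForm, dotProduct, Finset.sum_eq_single l (fun j _ hj => by rw [hu j hj]; simp)
    (by simp), vecMul_diagonal, hp.mul_comm, ← mul_assoc] at h
  obtain ⟨ν, hν⟩ := hp.norm (u l)
  rw [hν, ← Algebra.smul_def, map_smul, smul_eq_mul] at h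
  rw [(mul_eq_zero.1 h).resolve_right ha, map_zero] at hν
  ext i
  by_cases hi : i = l
  · subst hi
    by_contra hui
    exact mul_ne_zero (hp.map_ne_zero hui) hui hν
  · exact hu i hi

theorem IsOptimalAffineInvertible.finrank_eq (hA : IsOptimalAffineInvertible A) (hp : IsPair σ e)
    (s : Finset F) (hs : n * Module.finrank F D ≤ s.card) :
    2 * Module.finrank F A.direction + 2 * n = Module.finrank F D * (n * (n + 1)) := by
  obtain ⟨P, hP⟩ := hp.exists_isLevelNonisotropic n
  have h1 := hA.2 _ (isOptimal_flatSpace hp hP s hs).1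
  rw [flatSpace, AffineSubspace.direction_mk'] at h1
  have h2 := le_finrank_flatDir hp (id : Fin n → Fin n)
  have h3 := hA.1.finrank_le s hs
  omega

theorem IsOptimalAffineInvertible.isOpt (hA : IsOptimalAffineInvertible A) (hp : IsPair σ e)
    (s : Finset F) (hs : n * Module.finrank F D ≤ s.card) {M₀ W : Matrix (Fin n) (Fin n) D}
    (hM₀ : M₀ ∈ A) (hW : M₀ * W = 1) (hWu : IsUnit W) :
    IsOpt (A.direction.map (rowEnd F W)) := by
  refine ⟨hA.1.trivSpec hM₀ hW, ?_⟩
  rw [Module.finrank_fin_fun, ← (Submodule.equivMapOfInjective _ (rowEnd_injective hWu) _).finrank_eq]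
  exact hA.finrank_eq hp s hs

omit [FiniteDimensional F D] [LinearOrder κ] in
theorem IsLevelNonisotropic.comp {ι ι' : Type*} [Fintype ι] [Fintype ι'] {g : ι → κ}
    {P : Matrix ι ι D} (hP : IsLevelNonisotropic σ e g P) (ε : ι' ≃ ι) :
    IsLevelNonisotropic σ e (g ∘ ε) (P.submatrix ε ε) := by
  refine ⟨fun i j h => hP.diag _ _ h, fun l u hu h => ?_⟩
  have h1 : rowForm σ e P (u ∘ ε.symm) (u ∘ ε.symm) = rowForm σ e (P.submatrix ε ε) u u := by
    rw [rowForm, rowForm, submatrix_vecMul_equiv, dotProduct, dotProduct, ← Equiv.sum_comp ε]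
    simp
  have h2 := hP.nonisotropic l (u ∘ ε.symm) (fun i hi => hu _ (by simpa using hi)) (h1.trans h)
  ext i
  simpa using congrFun h2 (ε i)

/-- An optimal affine space of invertible matrices is equivalent to a space `flat σ e h P`. -/
theorem IsOptimalAffineInvertible.exists_flat (hA : IsOptimalAffineInvertible A)
    (hp : IsPair σ e) (s : Finset F) (hs : n * Module.finrank F D ≤ s.card) :
    ∃ (h : Fin n → ℕ) (P : Matrix (Fin n) (Fin n) D), Monotone h ∧ IsLevelNonisotropic σ e h P ∧
      MatEquivalent (A : Set (Matrix (Fin n) (Fin n) D)) (flat σ e h P) := by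
  obtain ⟨M₀, hM₀⟩ := hA.1.1
  obtain ⟨W, hWu, hW⟩ := hA.1.exists_inverse hM₀
  obtain ⟨ι, _, b, g, P, hP, hVP⟩ := (hA.isOpt hp s hs hM₀ hW hWu).exists_triangular hp s
    (by simpa using hs)
  have hc : Fintype.card ι = n := by
    rw [← Module.finrank_eq_card_basis b, Module.finrank_fin_fun]
  let ε₀ : Fin n ≃ ι := (Fintype.equivFinOfCardEq hc).symm
  -- The basis is sorted by level, so that the blocks become intervals.
  let ε : Fin n ≃ ι := (Tuple.sort (g ∘ ε₀)).trans ε₀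
  have hmono : Monotone (g ∘ ε) := Tuple.monotone_sort (g ∘ ε₀)
  set P' := P.submatrix ε ε with hP'
  have hP'n : IsLevelNonisotropic σ e (g ∘ ε) P' := hP.comp ε
  let Q : Matrix (Fin n) (Fin n) D := Matrix.of fun i => b (ε i)
  have hQu : IsUnit Q := by
    refine isUnit_of_forall_vecMul fun x hx => ?_
    have h1 : ∑ i, x i • b (ε i) = 0 := by
      rw [← hx]
      ext j
      simp [vecMul, dotProduct, Q]
    exact funext (Fintype.linearIndependent_iff.1
      (b.linearIndependent.comp ε ε.injective) x h1)
  have hP'u : IsUnit P' := hP'n.isUnit hp ((mem_flat_iff hP'n.diag).2 (by simp))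
  obtain ⟨q, hq⟩ := hQu
  obtain ⟨p, hpp⟩ := hP'u
  obtain ⟨w, hw⟩ := hWu
  have hrow : ∀ N, (rowMatrix b (rowEnd F W N)).submatrix ε ε * Q = Q * (N * W) := by
    intro N
    ext i j
    have h1 := congrFun (b.sum_repr (rowEnd F W N (b (ε i)))) j
    rw [← Equiv.sum_comp ε] at h1
    simp only [Finset.sum_apply, Pi.smul_apply, smul_eq_mul] at h1
    exact h1
  have hmem : ∀ N ∈ A.direction, Q * N * (W * (q⁻¹ : (Matrix (Fin n) (Fin n) D)ˣ) * P') ∈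
      flatDir σ e (g ∘ ε) := by
    intro N hN
    have h1 := mem_flatDir.1 (hVP _ ⟨N, hN, rfl⟩)
    have h2 : Q * N * (W * (q⁻¹ : (Matrix (Fin n) (Fin n) D)ˣ) * P') =
        (rowMatrix b (rowEnd F W N) * P).submatrix ε ε := by
      have h3 : (rowMatrix b (rowEnd F W N)).submatrix ε ε =
          Q * (N * W) * (q⁻¹ : (Matrix (Fin n) (Fin n) D)ˣ) := by
        rw [← hrow, ← hq, Units.mul_inv_cancel_right]
      rw [← submatrix_mul_equiv _ _ ε ε ε, h3]
      simp only [Matrix.mul_assoc]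
      rfl
    rw [h2]
    exact mem_flatDir.2 ⟨fun i j h => h1.1 _ _ h, fun i j h => h1.2.1 _ _ h, fun i => h1.2.2 _⟩
  -- The right factor W Q⁻¹ P' is chosen so that the base point M₀ is sent to P'.
  let r : (Matrix (Fin n) (Fin n) D)ˣ := w * q⁻¹ * p
  have hr : (r : Matrix (Fin n) (Fin n) D) =
      W * (q⁻¹ : (Matrix (Fin n) (Fin n) D)ˣ) * P' := by
    rw [← hw, ← hpp]
    rfl
  have hQM : Q * M₀ * (r : Matrix (Fin n) (Fin n) D) = P' := by
    rw [hr, Matrix.mul_assoc, ← Matrix.mul_assoc M₀, ← Matrix.mul_assoc M₀, hW, Matrix.one_mul,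
      ← hq, Units.mul_inv_cancel_left]
  let φ : Matrix (Fin n) (Fin n) D →ₗ[F] Matrix (Fin n) (Fin n) D :=
    LinearMap.mulRight F (r : Matrix (Fin n) (Fin n) D) ∘ₗ LinearMap.mulLeft F Q
  have hφ : ∀ N, φ N = Q * N * r := fun N => rfl
  have hφi : Function.Injective φ := by
    refine (injective_iff_map_eq_zero φ).2 fun N hN => ?_
    rw [hφ, Units.mul_left_eq_zero, ← hq, Units.mul_right_eq_zero] at hN
    exact hN
  have hle : A.direction.map φ ≤ flatDir σ e (g ∘ ε) := by
    rintro - ⟨N, hN, rfl⟩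
    rw [hφ, hr]
    exact hmem N hN
  have heq : A.direction.map φ = flatDir σ e (g ∘ ε) := by
    refine Submodule.eq_of_le_of_finrank_le hle ?_
    rw [← (Submodule.equivMapOfInjective φ hφi _).finrank_eq]
    have h1 := (isOptimal_flatSpace hp hP'n s hs).1.finrank_le s hs
    have h2 := hA.finrank_eq hp s hs
    rw [flatSpace, AffineSubspace.direction_mk'] at h1
    omega
  refine ⟨g ∘ ε, P', hmono, hP'n, q, r, ?_⟩
  ext M
  rw [mem_flat_iff hP'n.diag, ← heq]
  constructor
  · rintro ⟨N, hN, hNM⟩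
    refine ⟨N + M₀, AffineSubspace.vadd_mem_of_mem_direction hN hM₀, ?_⟩
    change (q : Matrix (Fin n) (Fin n) D) * (N + M₀) * r = M
    rw [hq, Matrix.mul_add, Matrix.add_mul, hQM, ← hφ, hNM, sub_add_cancel]
  · rintro ⟨N, hN, rfl⟩
    refine ⟨N - M₀, AffineSubspace.vsub_mem_direction hN hM₀, ?_⟩
    change φ (N - M₀) = (q : Matrix (Fin n) (Fin n) D) * N * r - P'
    rw [hφ, Matrix.mul_sub, Matrix.sub_mul, hQM, hq]

end Optimal

end InvertibleAffine

namespace InvertibleAffine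

/-! ### Ordered partitions as level functions, joints as triangular models. -/

section Compositions

open Matrix

variable {n : ℕ}

theorem index_lt_index_iff (c : Composition n) (i j : Fin n) :
    c.index i < c.index j ↔ ∃ t ∈ c.boundaries, (i : ℕ) < t ∧ (t : ℕ) ≤ j := by
  constructor
  · intro h
    refine ⟨c.boundary (c.index j).castSucc, Finset.mem_map_of_mem _ (Finset.mem_univ _), ?_,
      c.sizeUpTo_index_le j⟩
    exact (c.lt_sizeUpTo_index_succ i).trans_le (c.monotone_sizeUpTo (Nat.succ_le_of_lt h))
  · rintro ⟨t, ht, hit, htj⟩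
    obtain ⟨k, -, rfl⟩ := Finset.mem_map.1 ht
    change (i : ℕ) < c.sizeUpTo k at hit
    change c.sizeUpTo k ≤ j at htj
    have h1 : (c.index i : ℕ) < k := by
      by_contra! h
      have := c.monotone_sizeUpTo h
      have := c.sizeUpTo_index_le i
      omega
    have h2 : (k : ℕ) ≤ c.index j := by
      by_contra! h
      have := c.monotone_sizeUpTo (Nat.succ_le_of_lt h)
      have := c.lt_sizeUpTo_index_succ j
      simp only [Nat.succ_eq_add_one, Fin.val_succ] at *
      omega
    exact Fin.lt_def.2 (h1.trans_le h2)

/-- Every monotone function on `Fin n` has the same levels as the index function of a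
composition. -/
theorem exists_composition_of_monotone {h : Fin n → ℕ} (hm : Monotone h) :
    ∃ c : Composition n, ∀ i j, c.index i < c.index j ↔ h i < h j := by
  classical
  -- The boundaries are the two ends and the positions where h jumps. If h i < h j, the least
  -- position where h exceeds h i is such a jump.
  let s : CompositionAsSet n :=
    { boundaries := Finset.univ.filter fun t => t = 0 ∨ t = Fin.last n ∨
        ∃ i j : Fin n, (i : ℕ) + 1 = t ∧ (j : ℕ) = t ∧ h i < h j
      zero_mem := by simp
      getLast_mem := by simp }
  refine ⟨s.toComposition, fun i j => ?_⟩
  rw [index_lt_index_iff, s.toComposition_boundaries]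
  constructor
  · rintro ⟨t, ht, hit, htj⟩
    rcases (Finset.mem_filter.1 ht).2 with rfl | rfl | ⟨i', j', hi', hj', hij⟩
    · simp at hit
    · have := j.2
      rw [Fin.val_last] at htj
      omega
    · exact ((hm (Fin.le_def.2 (by omega))).trans_lt hij).trans_le (hm (Fin.le_def.2 (by omega)))
  · intro hij
    have hex : ∃ k, ∃ hk : k < n, h i < h ⟨k, hk⟩ := ⟨j, j.2, hij⟩
    obtain ⟨hk, hlt⟩ := Nat.find_spec hex
    have hkj : Nat.find hex ≤ j := Nat.find_min' hex ⟨j.2, hij⟩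
    have hik : (i : ℕ) < Nat.find hex := by
      by_contra! hle
      exact absurd (hm (a := ⟨Nat.find hex, hk⟩) (b := i) hle) (not_le.2 hlt)
    refine ⟨⟨Nat.find hex, by omega⟩, Finset.mem_filter.2 ⟨Finset.mem_univ _, Or.inr (Or.inr
      ⟨⟨Nat.find hex - 1, by omega⟩, ⟨Nat.find hex, hk⟩, ?_, rfl, ?_⟩)⟩, hik, hkj⟩
    · change Nat.find hex - 1 + 1 = Nat.find hex
      omega
    · refine lt_of_le_of_lt ?_ hlt
      by_contra! hlt'
      exact Nat.find_min hex (m := Nat.find hex - 1) (by omega) ⟨by omega, hlt'⟩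

theorem exists_embedding {c : Composition n} {i : Fin n} {k : Fin c.length} (h : c.index i = k) :
    ∃ a, i = c.embedding k a := by
  subst h
  exact ⟨_, (c.embedding_comp_inv i).symm⟩

variable {D : Type*} [DivisionRing D]

/-- The block-diagonal matrix with prescribed diagonal blocks. -/
def diagJoin (c : Composition n)
    (N : ∀ i, Matrix (Fin (c.blocksFun i)) (Fin (c.blocksFun i)) D) :
    Matrix (Fin n) (Fin n) D :=
  (blockDiagonal' N).submatrix c.blocksFinEquiv.symm c.blocksFinEquiv.symm

theorem blocksFinEquiv_symm_embedding (c : Composition n) (i : Fin c.length)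
    (a : Fin (c.blocksFun i)) : c.blocksFinEquiv.symm (c.embedding i a) = ⟨i, a⟩ :=
  (Equiv.symm_apply_eq _).2 rfl

theorem diagJoin_embedding (c : Composition n)
    (N : ∀ i, Matrix (Fin (c.blocksFun i)) (Fin (c.blocksFun i)) D) (i : Fin c.length)
    (a b : Fin (c.blocksFun i)) : diagJoin c N (c.embedding i a) (c.embedding i b) = N i a b := by
  rw [diagJoin, submatrix_apply, blocksFinEquiv_symm_embedding, blocksFinEquiv_symm_embedding,
    blockDiagonal'_apply_eq]

theorem diagJoin_of_ne (c : Composition n)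
    (N : ∀ i, Matrix (Fin (c.blocksFun i)) (Fin (c.blocksFun i)) D) {i j : Fin n}
    (h : c.index i ≠ c.index j) : diagJoin c N i j = 0 := by
  obtain ⟨a, ha⟩ := exists_embedding (c := c) (i := i) rfl
  obtain ⟨b, hb⟩ := exists_embedding (c := c) (i := j) rfl
  rw [ha, hb, diagJoin, submatrix_apply, blocksFinEquiv_symm_embedding,
    blocksFinEquiv_symm_embedding, blockDiagonal'_apply_ne _ _ _ h]

variable {F : Type*} [Field F] [Algebra F D] {σ : D →ₗ[F] D} {e : D →ₗ[F] F}

/-- The joint of the sets `P_i + SH` is a space `flat σ e g P`. -/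
theorem jointTranslate_eq_flat (c : Composition n) (P : InvertibleFamily D c) :
    jointTranslate σ e c P = flat σ e c.index (diagJoin c fun i => (P i).val) := by
  ext M
  refine and_congr ⟨fun h i j hij => ?_, fun h i j hij => ?_⟩ ⟨fun h => ⟨?_, ?_⟩, fun h i => ?_⟩
  · obtain ⟨a, ha⟩ := exists_embedding (c := c) (i := i) rfl
    obtain ⟨b, hb⟩ := exists_embedding (c := c) (i := j) rfl
    rw [ha, hb]
    exact congrFun (congrFun (h _ _ hij) a) b
  · ext a b
    exact h _ _ (by simpa using hij)
  · intro i j hij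
    obtain ⟨a, ha⟩ := exists_embedding (c := c) (i := i) rfl
    obtain ⟨b, hb⟩ := exists_embedding hij.symm
    obtain ⟨S, ⟨hS, -⟩, hM⟩ := h (c.index i)
    have h1 : ∀ a b, M (c.embedding (c.index i) a) (c.embedding (c.index i) b) -
        diagJoin c (fun i => (P i).val) (c.embedding (c.index i) a) (c.embedding (c.index i) b) =
          S a b := fun a b => by
      rw [diagJoin_embedding, sub_eq_iff_eq_add']
      exact congrFun (congrFun hM a) b
    generalize c.index i = k at *
    rw [ha, hb, h1, h1]
    exact congrFun (congrFun hS a) b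
  · intro i
    obtain ⟨a, ha⟩ := exists_embedding (c := c) (i := i) rfl
    obtain ⟨S, ⟨-, hS⟩, hM⟩ := h (c.index i)
    generalize c.index i = k at *
    rw [ha, diagJoin_embedding, ← hS a]
    congr 1
    rw [sub_eq_iff_eq_add']
    exact congrFun (congrFun hM a) a
  · refine ⟨M.submatrix (c.embedding i) (c.embedding i) - (P i).val, ⟨?_, fun a => ?_⟩, by abel⟩
    · ext a b
      have := h.1 (c.embedding i a) (c.embedding i b) (by simp)
      rwa [diagJoin_embedding, diagJoin_embedding] at this
    · have := h.2 (c.embedding i a)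
      rwa [diagJoin_embedding] at this

theorem starForm_eq_rowForm (hp : IsPair σ e) {k : ℕ} (P : Matrix (Fin k) (Fin k) D)
    (X : Fin k → D) :
    starForm σ e P X = rowForm σ e P (fun i => σ (X i)) (fun i => σ (X i)) := by
  rw [starForm, rowForm, dotProduct_mulVec]
  simp_rw [hp.invol]

theorem isNonisotropic_iff (hp : IsPair σ e) {k : ℕ} {P : Matrix (Fin k) (Fin k) D} :
    IsNonisotropic σ e P ↔ ∀ u, rowForm σ e P u u = 0 → u = 0 := by
  constructor
  · intro h u hu
    by_contra hu0
    refine h (fun i => σ (u i)) (fun h0 => hu0 (funext fun i => ?_)) ?_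
    · have := congrArg σ (congrFun h0 i)
      rwa [hp.invol, Pi.zero_apply, map_zero] at this
    · rw [starForm_eq_rowForm hp]
      simpa only [hp.invol] using hu
  · intro h X hX h0
    rw [starForm_eq_rowForm hp] at h0
    refine hX (funext fun i => ?_)
    have := congrArg σ (congrFun (h _ h0) i)
    rwa [hp.invol, Pi.zero_apply, map_zero] at this

theorem rowForm_level (c : Composition n) (P : Matrix (Fin n) (Fin n) D) (k : Fin c.length)
    {u : Fin n → D} (hu : ∀ i, c.index i ≠ k → u i = 0) :
    rowForm σ e P u u =
      rowForm σ e (P.submatrix (c.embedding k) (c.embedding k)) (u ∘ c.embedding k)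
        (u ∘ c.embedding k) := by
  have hout : ∀ i ∉ Set.range (c.embedding k), u i = 0 := fun i hi => hu i fun h => hi (by
    rw [← h]
    exact c.mem_range_embedding i)
  rw [rowForm, rowForm]
  congr 1
  symm
  refine Fintype.sum_of_injective _ (c.embedding k).injective _ _ (fun j hj => ?_) fun j => ?_
  · change _ * σ (u j) = 0
    rw [hout j hj, map_zero, mul_zero]
  · congr 1
    refine Fintype.sum_of_injective _ (c.embedding k).injective _ _ (fun i hi => ?_) fun i => rfl
    change u i * _ = 0
    rw [hout i hi, zero_mul]

theorem isLevelNonisotropic_iff (hp : IsPair σ e) {c : Composition n}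
    {P : Matrix (Fin n) (Fin n) D} (hP : ∀ i j, c.index i ≠ c.index j → P i j = 0) :
    IsLevelNonisotropic σ e c.index P ↔
      ∀ k, IsNonisotropic σ e (P.submatrix (c.embedding k) (c.embedding k)) := by
  simp_rw [isNonisotropic_iff hp]
  constructor
  · intro h k u hu
    have hv : Function.extend (c.embedding k) u 0 ∘ c.embedding k = u :=
      funext fun a => (c.embedding k).injective.extend_apply u 0 a
    have h1 := h.nonisotropic k (Function.extend (c.embedding k) u 0) (fun i hi => by
      rw [Function.extend_apply' _ _ _ (fun ⟨a, ha⟩ => hi (by rw [← ha, c.index_embedding])),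
        Pi.zero_apply]) (by
      rw [rowForm_level c P k, hv, hu]
      intro i hi
      rw [Function.extend_apply' _ _ _ (fun ⟨a, ha⟩ => hi (by rw [← ha, c.index_embedding])),
        Pi.zero_apply])
    rw [← hv, h1]
    rfl
  · intro h
    refine ⟨hP, fun l u hu h0 => ?_⟩
    rw [rowForm_level c P l hu] at h0
    have h1 := h l _ h0
    ext i
    by_cases hi : c.index i = l
    · obtain ⟨a, ha⟩ := exists_embedding (c := c) (i := i) rfl
      subst hi
      rw [ha]
      exact congrFun h1 a
    · exact hu i hi

end Compositions

end InvertibleAffine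

namespace InvertibleAffine

/-! ### Columns annihilated by a row through a model space. -/

section Annihilator

open Matrix

variable {F D : Type*} [Field F] [DivisionRing D] [Algebra F D]
variable {σ : D →ₗ[F] D} {e : D →ₗ[F] F} {ι κ : Type*} [Fintype ι] [DecidableEq ι]
  [LinearOrder κ] {g : ι → κ} {P : Matrix ι ι D}

omit [LinearOrder κ] in
theorem dotProduct_single_mulVec (x y : ι → D) (i j : ι) (a : D) :
    x ⬝ᵥ (Matrix.single i j a *ᵥ y) = x i * a * y j := by
  rw [single_mulVec, dotProduct, Finset.sum_eq_single i]
  · simp [mul_assoc]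
  · intro k _ hk
    simp [hk]
  · simp

omit [Fintype ι] in
theorem single_mem_flatDir_of_lt {i j : ι} (h : g i < g j) (a : D) :
    Matrix.single i j a ∈ flatDir σ e g := by
  have hne : ∀ k l, ¬ g k < g l → Matrix.single i j a k l = 0 := by
    intro k l hkl
    rw [single_apply, if_neg]
    rintro ⟨rfl, rfl⟩
    exact hkl h
  refine mem_flatDir.2 ⟨fun k l hkl => hne k l hkl.not_gt, fun k l hkl => ?_, fun k => ?_⟩
  · rw [hne k l hkl.not_lt, hne l k hkl.not_gt, map_zero, neg_zero]
  · rw [hne k k (lt_irrefl _), map_zero]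

omit [Fintype ι] in
theorem single_self_mem_flatDir (hp : IsPair σ e) (i : ι) {a : D} (ha : e a = 0) :
    Matrix.single i i a ∈ flatDir σ e g := by
  refine mem_flatDir.2 ⟨fun k l hkl => ?_, fun k l hkl => ?_, fun k => ?_⟩
  · rw [single_apply, if_neg]
    rintro ⟨rfl, rfl⟩
    exact lt_irrefl _ hkl
  · by_cases h : i = k ∧ i = l
    · obtain ⟨rfl, rfl⟩ := h
      simpa using hp.skew a ha
    · rw [single_apply, single_apply, if_neg h, if_neg fun h' => h h'.symm, map_zero, neg_zero]
  · rw [single_apply]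
    split_ifs
    · exact ha
    · exact map_zero e

omit [Fintype ι] in
theorem single_sub_single_mem_flatDir (hp : IsPair σ e) {i j : ι} (hij : i ≠ j) (h : g i = g j)
    (a : D) : Matrix.single i j a - Matrix.single j i (σ a) ∈ flatDir σ e g := by
  have hne : ∀ k l, g k ≠ g l → (Matrix.single i j a - Matrix.single j i (σ a)) k l = 0 := by
    intro k l hkl
    rw [Matrix.sub_apply, single_apply, single_apply, if_neg, if_neg, sub_zero]
    · rintro ⟨rfl, rfl⟩
      exact hkl h.symm
    · rintro ⟨rfl, rfl⟩
      exact hkl h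
  refine mem_flatDir.2 ⟨fun k l hkl => hne k l hkl.ne', fun k l hkl => ?_, fun k => ?_⟩
  · simp only [Matrix.sub_apply, single_apply]
    by_cases h1 : i = k ∧ j = l
    · obtain ⟨rfl, rfl⟩ := h1
      simp [hij, hij.symm, hp.invol]
    · by_cases h2 : i = l ∧ j = k
      · obtain ⟨rfl, rfl⟩ := h2
        simp [hij, hij.symm]
      · rw [if_neg h2, if_neg fun h' => h1 h'.symm, if_neg h1, if_neg fun h' => h2 h'.symm]
        simp
  · rw [Matrix.sub_apply, single_apply, single_apply, if_neg, if_neg, sub_zero, map_zero]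
    · rintro ⟨rfl, rfl⟩
      exact hij rfl
    · rintro ⟨rfl, rfl⟩
      exact hij rfl

/-- A pair `(x, y)` with `e (x S y) = 0` for all `S ∈ flatDir σ e g` is such that `y` is
proportional to `σ x` on every level where `x` is nonzero. -/
theorem exists_eq_smul_of_annihilator (hp : IsPair σ e) {x y : ι → D} {i : ι} (hx : x i ≠ 0)
    (h : ∀ S ∈ flatDir σ e g, e (x ⬝ᵥ (S *ᵥ y)) = 0) :
    ∃ β : F, ∀ j, g i = g j → y j = β • σ (x j) := by
  obtain ⟨q, hq⟩ : ∃ q, e q ≠ 0 := by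
    by_contra! h
    exact hp.ne_zero (LinearMap.ext h)
  -- Testing on the matrices a E_ii with e a = 0 shows that y i * x i pairs to zero with ker e,
  -- hence is a scalar. Testing on a E_ij - σ(a) E_ji then transports the proportionality to the
  -- rest of the level.
  obtain ⟨γ, hγ⟩ : ∃ γ : F, y i * x i = algebraMap F D γ := by
    refine ⟨e (q * (y i * x i)) / e q, ?_⟩
    rw [← sub_eq_zero]
    refine hp.eq_zero fun a => ?_
    have h1 := h _ (single_self_mem_flatDir hp i (a := a - (e a / e q) • q) (by
      rw [map_sub, map_smul, smul_eq_mul, div_mul_cancel₀ _ hq, sub_self]))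
    rw [dotProduct_single_mulVec, mul_assoc, hp.mul_comm, mul_assoc, sub_mul, smul_mul_assoc,
      map_sub, map_smul, smul_eq_mul] at h1
    rw [mul_sub, map_sub, ← Algebra.commutes, ← Algebra.smul_def, map_smul, smul_eq_mul]
    linear_combination h1
  obtain ⟨ν, hν⟩ := hp.norm (x i)
  have hν0 : ν ≠ 0 := by
    rintro rfl
    rw [map_zero] at hν
    exact mul_ne_zero (hp.map_ne_zero hx) hx hν
  have hyi : y i = (γ / ν) • σ (x i) := by
    refine mul_right_cancel₀ hx ?_
    rw [hγ, smul_mul_assoc, hν, Algebra.smul_def, ← map_mul, div_mul_cancel₀ _ hν0]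
  refine ⟨γ / ν, fun j hj => ?_⟩
  by_cases hij : i = j
  · rw [← hij, hyi]
  have h1 : y j * x i = σ (x j) * σ (y i) := by
    rw [← sub_eq_zero]
    refine hp.eq_zero fun a => ?_
    have h2 := h _ (single_sub_single_mem_flatDir hp hij hj a)
    rw [sub_mulVec, dotProduct_sub, dotProduct_single_mulVec, dotProduct_single_mulVec, map_sub,
      ← hp.map_invol (x j * σ a * y i), hp.mul, hp.mul, hp.invol, mul_assoc, hp.mul_comm,
      ← mul_assoc (σ (y i)), mul_assoc (σ (y i)), hp.mul_comm (σ (y i))] at h2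
    rw [mul_sub, map_sub]
    simpa only [mul_assoc] using h2
  refine mul_right_cancel₀ hx ?_
  rw [h1, hyi, map_smul, hp.invol, mul_smul_comm, smul_mul_assoc]

omit [DecidableEq ι] in
theorem vecMul_dotProduct_eq_zero_of_levels {M : Matrix ι ι D} (hM : ∀ i j, g j < g i → M i j = 0)
    {k : κ} {x y : ι → D} (hx : ∀ i, g i < k → x i = 0) (hy : ∀ j, k ≤ g j → y j = 0) :
    x ⬝ᵥ (M *ᵥ y) = 0 := by
  refine Finset.sum_eq_zero fun i _ => ?_
  by_cases hi : g i < k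
  · rw [hx i hi, zero_mul]
  · rw [mulVec, dotProduct, Finset.sum_eq_zero, mul_zero]
    intro j _
    by_cases hj : k ≤ g j
    · rw [hy j hj, mul_zero]
    · rw [hM i j ((not_le.1 hj).trans_le (not_lt.1 hi)), zero_mul]

/-- The restriction of a vector to a level. -/
def levelPart (g : ι → κ) (k : κ) (x : ι → D) : ι → D := fun i => if g i = k then x i else 0

omit [DecidableEq ι] in
/-- If `P` is block-diagonal, `x` has level at least `k` and `y` has level at most `k`, then only
the level `k` contributes to `x P y`. -/
theorem dotProduct_mulVec_levelPart (hP : ∀ i j, g i ≠ g j → P i j = 0) {k : κ} {x y : ι → D}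
    (hx : ∀ i, g i < k → x i = 0) (hy : ∀ j, k < g j → y j = 0) :
    x ⬝ᵥ (P *ᵥ y) = levelPart g k x ⬝ᵥ (P *ᵥ levelPart g k y) := by
  refine Finset.sum_congr rfl fun i _ => ?_
  by_cases hi : g i = k
  · rw [levelPart, if_pos hi]
    congr 1
    refine Finset.sum_congr rfl fun j _ => ?_
    by_cases hj : g j = k
    · rw [levelPart, if_pos hj]
    · change P i j * _ = P i j * _
      rw [hP i j (by rw [hi]; exact Ne.symm hj), zero_mul, zero_mul]
  · rw [levelPart, if_neg hi, zero_mul]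
    rcases lt_or_gt_of_ne hi with hi | hi
    · rw [hx i hi, zero_mul]
    · rw [mulVec, dotProduct, Finset.sum_eq_zero, mul_zero]
      intro j _
      by_cases hj : g i = g j
      · rw [hy j (hj ▸ hi), mul_zero]
      · rw [hP i j hj, zero_mul]

/-- The annihilator of a row vector of level `k`. -/
theorem forall_dotProduct_mulVec_eq_zero_iff (hp : IsPair σ e) (hP : IsLevelNonisotropic σ e g P)
    {x y : ι → D} {i : ι} (hxi : x i ≠ 0) (hx : ∀ j, g j < g i → x j = 0) :
    (∀ M ∈ flat σ e g P, x ⬝ᵥ (M *ᵥ y) = 0) ↔ ∀ j, g i ≤ g j → y j = 0 := by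
  refine ⟨fun h => ?_, fun h M hM => vecMul_dotProduct_eq_zero_of_levels hM.1 hx h⟩
  have hP0 := h P ((mem_flat_iff hP.diag).2 (by simp))
  have hS : ∀ S ∈ flatDir σ e g, x ⬝ᵥ (S *ᵥ y) = 0 := by
    intro S hS
    have h1 := h (P + S) ((mem_flat_iff hP.diag).2 (by simpa using hS))
    rwa [add_mulVec, dotProduct_add, hP0, zero_add] at h1
  have hgt : ∀ j, g i < g j → y j = 0 := by
    intro j hj
    have h1 := hS _ (single_mem_flatDir_of_lt hj 1)
    rw [dotProduct_single_mulVec, mul_one] at h1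
    exact (mul_eq_zero.1 h1).resolve_left hxi
  obtain ⟨β, hβ⟩ := exists_eq_smul_of_annihilator hp hxi fun S h => by rw [hS S h, map_zero]
  -- By proportionality x P y is β times the value of the form of P at the level part of x, which is
  -- nonisotropic.
  have hβ0 : β = 0 := by
    rw [dotProduct_mulVec_levelPart hP.diag hx hgt] at hP0
    have h1 : levelPart g (g i) y = β • fun j => σ (levelPart g (g i) x j) := by
      ext j
      by_cases hj : g i = g j
      · simp [levelPart, hj.symm, hβ j hj]
      · simp [levelPart, Ne.symm hj]
    rw [h1, mulVec_smul, dotProduct_smul, dotProduct_mulVec] at hP0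
    have h2 := congrArg e hP0
    rw [map_smul, map_zero, smul_eq_mul] at h2
    refine (mul_eq_zero.1 h2).resolve_right fun h3 => hxi ?_
    have h4 := congrFun (hP.nonisotropic (g i) _ (fun j hj => if_neg hj) h3) i
    simpa [levelPart] using h4
  intro j hj
  rcases hj.eq_or_lt with hj | hj
  · rw [hβ j hj, hβ0, zero_smul]
  · exact hgt j hj

omit [DecidableEq ι] in
theorem exists_level {x : ι → D} (hx : x ≠ 0) :
    ∃ i, x i ≠ 0 ∧ ∀ j, g j < g i → x j = 0 := by
  classical
  obtain ⟨k, hk⟩ := Function.ne_iff.1 hx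
  obtain ⟨i, hi, hmin⟩ := Finset.exists_min_image (Finset.univ.filter fun i => x i ≠ 0) g
    ⟨k, by simpa using hk⟩
  refine ⟨i, (Finset.mem_filter.1 hi).2, fun j hj => ?_⟩
  by_contra h
  exact absurd (hmin j (by simpa using h)) (not_le.2 hj)

end Annihilator

end InvertibleAffine

namespace InvertibleAffine

/-! ### An equivalence determines the partition. -/

section Equivalence

open Matrix

variable {F D : Type*} [Field F] [DivisionRing D] [Algebra F D]
variable {σ : D →ₗ[F] D} {e : D →ₗ[F] F} {n : ℕ}

theorem le_index_iff (c : Composition n) (k : Fin c.length) (j : Fin n) :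
    k ≤ c.index j ↔ c.sizeUpTo k ≤ j := by
  constructor
  · intro h
    exact (c.monotone_sizeUpTo h).trans (c.sizeUpTo_index_le j)
  · intro h
    by_contra! hlt
    have h1 := c.lt_sizeUpTo_index_succ j
    have h2 := c.monotone_sizeUpTo (Nat.succ_le_of_lt (Fin.lt_def.1 hlt))
    simp only [Fin.val_succ] at h1
    simp only [Nat.succ_eq_add_one] at h2
    omega

theorem sizeUpTo_injective (c : Composition n) {k l : Fin c.length}
    (h : c.sizeUpTo k = c.sizeUpTo l) : k = l := by
  have key : ∀ {k l : Fin c.length}, k < l → c.sizeUpTo k < c.sizeUpTo l := fun {k l} h =>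
    (c.sizeUpTo_strict_mono k.2).trans_le (c.monotone_sizeUpTo (Nat.succ_le_of_lt h))
  rcases lt_trichotomy k l with hlt | heq | hlt
  · exact absurd h (key hlt).ne
  · exact heq
  · exact absurd h (key hlt).ne'

theorem exists_index_eq (c : Composition n) (k : Fin c.length) : ∃ i, c.index i = k :=
  ⟨c.embedding k ⟨0, c.one_le_blocksFun k⟩, c.index_embedding _ _⟩

/-- The columns whose entries vanish from a given position on. -/
def lowSpace (F D : Type*) [Field F] [DivisionRing D] [Algebra F D] (n t : ℕ) :
    Submodule F (Fin n → D) where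
  carrier := {y | ∀ j : Fin n, t ≤ j → y j = 0}
  add_mem' hx hy j hj := by rw [Pi.add_apply, hx j hj, hy j hj, add_zero]
  zero_mem' _ _ := rfl
  smul_mem' a x hx j hj := by rw [Pi.smul_apply, hx j hj, smul_zero]

theorem lowSpace_lt {t t' : ℕ} (h : t < t') (ht : t < n) : lowSpace F D n t < lowSpace F D n t' := by
  refine lt_of_le_of_ne (fun y hy j hj => hy j (h.le.trans hj)) fun heq => ?_
  have h1 : Pi.single ⟨t, ht⟩ (1 : D) ∈ lowSpace F D n t' := fun j hj =>
    Pi.single_eq_of_ne (fun h' => by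
      rw [h'] at hj
      exact absurd hj (not_le.2 h)) _
  rw [← heq] at h1
  have h2 := h1 ⟨t, ht⟩ le_rfl
  rw [Pi.single_eq_same] at h2
  exact one_ne_zero h2

/-- The multiplication of columns by a matrix, as a linear map over `F`. -/
def colMap (F : Type*) [Field F] [Algebra F D] {m : ℕ} (V : Matrix (Fin m) (Fin m) D) :
    (Fin m → D) →ₗ[F] (Fin m → D) where
  toFun y := V *ᵥ y
  map_add' := mulVec_add V
  map_smul' a y := mulVec_smul V a y

theorem lowSpace_eq_of_mulVec [FiniteDimensional F D] {t t' : ℕ} (ht : t < n) (ht' : t' < n)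
    (V : (Matrix (Fin n) (Fin n) D)ˣ)
    (h : ∀ y, y ∈ lowSpace F D n t' ↔ V.val *ᵥ y ∈ lowSpace F D n t) : t' = t := by
  let φ : (Fin n → D) ≃ₗ[F] (Fin n → D) :=
    LinearEquiv.ofLinearMap (colMap F V.val) (colMap F V⁻¹.val)
      (LinearMap.ext fun y => by simp [colMap]) (LinearMap.ext fun y => by simp [colMap])
  have h1 : lowSpace F D n t' = (lowSpace F D n t).map φ.symm.toLinearMap :=
    Submodule.ext fun y => by
      rw [Submodule.map_equiv_eq_comap_symm]
      exact h y
  have h2 : Module.finrank F (lowSpace F D n t') = Module.finrank F (lowSpace F D n t) := by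
    rw [h1]
    exact (φ.symm.submoduleMap _).finrank_eq.symm
  rcases lt_trichotomy t' t with hlt | heq | hlt
  · exact absurd h2 (Submodule.finrank_lt_finrank_of_lt (lowSpace_lt hlt ht')).ne
  · exact heq
  · exact absurd h2 (Submodule.finrank_lt_finrank_of_lt (lowSpace_lt hlt ht)).ne'

variable {c c' : Composition n} {P P' : Matrix (Fin n) (Fin n) D}
  {U V : (Matrix (Fin n) (Fin n) D)ˣ}

theorem vecMul_dotProduct_mulVec {m : Type*} [Fintype m] (U M V : Matrix m m D) (x y : m → D) :
    x ⬝ᵥ ((U * M * V) *ᵥ y) = (x ᵥ* U) ⬝ᵥ (M *ᵥ (V *ᵥ y)) := by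
  rw [← mulVec_mulVec, ← mulVec_mulVec, dotProduct_mulVec]

theorem mem_lowSpace_iff (c : Composition n) (i : Fin n) {y : Fin n → D} :
    y ∈ lowSpace F D n (c.sizeUpTo (c.index i)) ↔ ∀ j, c.index i ≤ c.index j → y j = 0 :=
  forall_congr' fun j => by rw [le_index_iff]

theorem vecMul_unit_ne_zero {x : Fin n → D} (hx : x ≠ 0) (U : (Matrix (Fin n) (Fin n) D)ˣ) :
    x ᵥ* U.val ≠ 0 := fun h => hx (eq_zero_of_isUnit U.isUnit h)

/-- The level of a row vector determines the annihilator, whose dimension is preserved. -/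
theorem sizeUpTo_eq_of_equivalent [FiniteDimensional F D] (hp : IsPair σ e)
    (hP : IsLevelNonisotropic σ e c.index P) (hP' : IsLevelNonisotropic σ e c'.index P')
    (h : flat σ e c'.index P' = (fun M => U.val * M * V.val) '' flat σ e c.index P)
    {x : Fin n → D} {i i' : Fin n} (hxi : (x ᵥ* U.val) i ≠ 0)
    (hx : ∀ j, c.index j < c.index i → (x ᵥ* U.val) j = 0) (hxi' : x i' ≠ 0)
    (hx' : ∀ j, c'.index j < c'.index i' → x j = 0) :
    (∀ y, (∀ j, c'.index i' ≤ c'.index j → y j = 0) ↔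
      ∀ j, c.index i ≤ c.index j → (V.val *ᵥ y) j = 0) ∧
    c'.sizeUpTo (c'.index i') = c.sizeUpTo (c.index i) := by
  have key : ∀ y, (∀ j, c'.index i' ≤ c'.index j → y j = 0) ↔
      ∀ j, c.index i ≤ c.index j → (V.val *ᵥ y) j = 0 := by
    intro y
    rw [← forall_dotProduct_mulVec_eq_zero_iff hp hP' hxi' hx',
      ← forall_dotProduct_mulVec_eq_zero_iff hp hP hxi hx, h, Set.forall_mem_image]
    simp_rw [vecMul_dotProduct_mulVec]
  refine ⟨key, lowSpace_eq_of_mulVec (F := F) ((c.sizeUpTo_index_le i).trans_lt i.2)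
    ((c'.sizeUpTo_index_le i').trans_lt i'.2) V fun y => ?_⟩
  rw [mem_lowSpace_iff, mem_lowSpace_iff, key]

/-- A boundary of c' other than n is the start of the level of some unit row. The image of this row
under U starts at a level of c whose annihilator has the same dimension, hence the same start. -/
theorem boundaries_subset_of_equivalent [FiniteDimensional F D] (hp : IsPair σ e)
    (hP : IsLevelNonisotropic σ e c.index P) (hP' : IsLevelNonisotropic σ e c'.index P')
    (h : flat σ e c'.index P' = (fun M => U.val * M * V.val) '' flat σ e c.index P) :
    c'.boundaries ⊆ c.boundaries := by
  intro t ht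
  obtain ⟨k, -, rfl⟩ := Finset.mem_map.1 ht
  refine Fin.lastCases ?_ (fun k => ?_) k
  · have h1 := c.toCompositionAsSet.getLast_mem
    change c'.boundary (Fin.last _) ∈ _
    rw [c'.boundary_last]
    exact h1
  · obtain ⟨i', hi'⟩ := exists_index_eq c' k
    have hne : (Pi.single i' 1 : Fin n → D) ≠ 0 := by simp
    obtain ⟨i, hi, hlev⟩ := exists_level (g := c.index) (vecMul_unit_ne_zero hne U)
    have h1 := (sizeUpTo_eq_of_equivalent hp hP hP' h hi hlev (i' := i') (by simp)
      (fun j hj => Pi.single_eq_of_ne (by rintro rfl; exact lt_irrefl _ hj) _)).2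
    refine Finset.mem_map.2 ⟨(c.index i).castSucc, Finset.mem_univ _, Fin.ext ?_⟩
    rw [hi'] at h1
    exact h1.symm

theorem composition_eq_of_equivalent [FiniteDimensional F D] (hp : IsPair σ e)
    (hP : IsLevelNonisotropic σ e c.index P) (hP' : IsLevelNonisotropic σ e c'.index P')
    (h : flat σ e c'.index P' = (fun M => U.val * M * V.val) '' flat σ e c.index P) :
    c' = c := by
  have h' : flat σ e c.index P = (fun M => U⁻¹.val * M * V⁻¹.val) '' flat σ e c'.index P' := by
    rw [h, Set.image_image]
    simp [Matrix.mul_assoc]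
  have h1 := subset_antisymm (boundaries_subset_of_equivalent hp hP hP' h)
    (boundaries_subset_of_equivalent hp hP' hP h')
  exact (compositionEquiv n).injective (CompositionAsSet.ext h1)

end Equivalence

end InvertibleAffine

namespace InvertibleAffine

/-! ### An equivalence on a single diagonal block. -/

section Blocks

open Matrix

variable {F D : Type*} [Field F] [DivisionRing D] [Algebra F D]
variable {σ : D →ₗ[F] D} {e : D →ₗ[F] F} {n : ℕ}

/-- The conjugate transpose with respect to `σ`. -/
def conjT (σ : D →ₗ[F] D) {m : ℕ} (M : Matrix (Fin m) (Fin m) D) : Matrix (Fin m) (Fin m) D :=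
  Mᵀ.map σ

theorem conjT_mul (hσ : IsInvol σ) {m : ℕ} (M N : Matrix (Fin m) (Fin m) D) :
    conjT σ (M * N) = conjT σ N * conjT σ M := by
  ext i j
  simp only [conjT, map_apply, transpose_apply, mul_apply, map_sum, hσ.mul]

theorem conjT_one (hσ : IsInvol σ) {m : ℕ} : conjT σ (1 : Matrix (Fin m) (Fin m) D) = 1 := by
  ext i j
  simp only [conjT, map_apply, transpose_apply, one_apply, eq_comm]
  split_ifs
  · exact hσ.map_one.symm
  · exact (map_zero σ).symm

theorem conjT_conjT (hσ : IsInvol σ) {m : ℕ} (M : Matrix (Fin m) (Fin m) D) :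
    conjT σ (conjT σ M) = M := by
  ext i j
  simp [conjT, hσ.invol]

/-- The conjugate transpose of an invertible matrix. -/
def unitConjT (hσ : IsInvol σ) {m : ℕ} (M : (Matrix (Fin m) (Fin m) D)ˣ) :
    (Matrix (Fin m) (Fin m) D)ˣ where
  val := conjT σ M.val
  inv := conjT σ M⁻¹.val
  val_inv := by rw [← conjT_mul hσ, Units.inv_mul, conjT_one hσ]
  inv_val := by rw [← conjT_mul hσ, Units.mul_inv, conjT_one hσ]

theorem conjT_mulVec (hσ : IsInvol σ) {m : ℕ} (M : Matrix (Fin m) (Fin m) D) (u : Fin m → D) :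
    (conjT σ M *ᵥ fun i => σ (u i)) = fun j => σ ((u ᵥ* M) j) := by
  ext j
  simp only [conjT, mulVec, vecMul, dotProduct, map_apply, transpose_apply, map_sum, hσ.mul]

theorem starForm_conjT_mulVec (hp : IsPair σ e) {m : ℕ} (P M : Matrix (Fin m) (Fin m) D)
    (u : Fin m → D) : starForm σ e P (conjT σ M *ᵥ fun i => σ (u i)) =
      rowForm σ e P (u ᵥ* M) (u ᵥ* M) := by
  rw [conjT_mulVec hp.toIsInvol, starForm_eq_rowForm hp]
  simp_rw [hp.invol]

theorem rowForm_mul_mul {m : Type*} [Fintype m] (U M V : Matrix m m D) (u : m → D) :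
    rowForm σ e (U * M * V) u u =
      e ((u ᵥ* U) ⬝ᵥ (M *ᵥ (V *ᵥ fun i => σ (u i)))) := by
  rw [← vecMul_dotProduct_mulVec, rowForm, dotProduct_mulVec]

variable {c : Composition n} {P P' : Matrix (Fin n) (Fin n) D}
  {U V : (Matrix (Fin n) (Fin n) D)ˣ}

theorem vecMul_embedding {k : Fin c.length} {u : Fin n → D} (hu : ∀ i, c.index i ≠ k → u i = 0)
    (M : Matrix (Fin n) (Fin n) D) :
    (u ᵥ* M) ∘ c.embedding k =
      (u ∘ c.embedding k) ᵥ* M.submatrix (c.embedding k) (c.embedding k) := by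
  ext a
  refine (Fintype.sum_of_injective _ (c.embedding k).injective _ _ (fun i hi => ?_)
    fun i => rfl).symm
  change u i * _ = 0
  rw [hu i fun h => hi (by rw [← h]; exact c.mem_range_embedding i), zero_mul]

theorem mulVec_embedding {k : Fin c.length} {u : Fin n → D} (hu : ∀ i, c.index i ≠ k → u i = 0)
    (M : Matrix (Fin n) (Fin n) D) :
    (M *ᵥ u) ∘ c.embedding k =
      M.submatrix (c.embedding k) (c.embedding k) *ᵥ (u ∘ c.embedding k) := by
  ext a
  refine (Fintype.sum_of_injective _ (c.embedding k).injective _ _ (fun i hi => ?_)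
    fun i => rfl).symm
  change _ * u i = 0
  rw [hu i fun h => hi (by rw [← h]; exact c.mem_range_embedding i), mul_zero]

theorem index_eq_of_equivalent [FiniteDimensional F D] (hp : IsPair σ e)
    (hP : IsLevelNonisotropic σ e c.index P) (hP' : IsLevelNonisotropic σ e c.index P')
    (h : flat σ e c.index P' = (fun M => U.val * M * V.val) '' flat σ e c.index P)
    {x : Fin n → D} {i i' : Fin n} (hxi : (x ᵥ* U.val) i ≠ 0)
    (hx : ∀ j, c.index j < c.index i → (x ᵥ* U.val) j = 0) (hxi' : x i' ≠ 0)
    (hx' : ∀ j, c.index j < c.index i' → x j = 0) : c.index i' = c.index i :=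
  sizeUpTo_injective c (sizeUpTo_eq_of_equivalent hp hP hP' h hxi hx hxi' hx').2

/-- The right factor of an equivalence is block-triangular. -/
theorem mulVec_eq_zero_of_equivalent [FiniteDimensional F D] (hp : IsPair σ e)
    (hP : IsLevelNonisotropic σ e c.index P) (hP' : IsLevelNonisotropic σ e c.index P')
    (h : flat σ e c.index P' = (fun M => U.val * M * V.val) '' flat σ e c.index P)
    {l : Fin c.length} {y : Fin n → D} (hy : ∀ j, l < c.index j → y j = 0) {j : Fin n}
    (hj : l < c.index j) : (V.val *ᵥ y) j = 0 := by
  -- Columns that vanish above level l form the annihilator of a row of level l + 1, and V carries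
  -- annihilators to annihilators.
  have hl : (l : ℕ) + 1 < c.length := lt_of_le_of_lt (Nat.succ_le_of_lt hj) (c.index j).2
  obtain ⟨i', hi'⟩ := exists_index_eq c ⟨l + 1, hl⟩
  have hne : (Pi.single i' 1 : Fin n → D) ≠ 0 := by simp
  have h0 : (Pi.single i' 1 : Fin n → D) i' ≠ 0 := by simp
  have hs : ∀ j, c.index j < c.index i' → (Pi.single i' 1 : Fin n → D) j = 0 := fun j hj =>
    Pi.single_eq_of_ne (by rintro rfl; exact lt_irrefl _ hj) _
  obtain ⟨i, hi, hlev⟩ := exists_level (g := c.index) (vecMul_unit_ne_zero hne U)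
  have h1 := index_eq_of_equivalent hp hP hP' h hi hlev h0 hs
  refine ((sizeUpTo_eq_of_equivalent hp hP hP' h hi hlev h0 hs).1 y).1 (fun j hj => hy j ?_) j ?_
  · refine lt_of_lt_of_le ?_ hj
    rw [hi', Fin.lt_def]
    exact Nat.lt_succ_self _
  · rw [← h1, hi', Fin.le_def]
    exact Nat.succ_le_of_lt hj

theorem mul_mul_sub_mem_flatDir (hP : IsLevelNonisotropic σ e c.index P)
    (hP' : IsLevelNonisotropic σ e c.index P')
    (h : flat σ e c.index P' = (fun M => U.val * M * V.val) '' flat σ e c.index P) :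
    U.val * P * V.val - P' ∈ flatDir σ e c.index := by
  rw [← mem_flat_iff hP'.diag, h]
  exact ⟨P, (mem_flat_iff hP.diag).2 (by simp), rfl⟩

theorem mul_mul_mem_flatDir (hP : IsLevelNonisotropic σ e c.index P)
    (hP' : IsLevelNonisotropic σ e c.index P')
    (h : flat σ e c.index P' = (fun M => U.val * M * V.val) '' flat σ e c.index P)
    {S : Matrix (Fin n) (Fin n) D} (hS : S ∈ flatDir σ e c.index) :
    U.val * S * V.val ∈ flatDir σ e c.index := by
  have h1 : U.val * (P + S) * V.val - P' ∈ flatDir σ e c.index := by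
    rw [← mem_flat_iff hP'.diag, h]
    exact ⟨P + S, (mem_flat_iff hP.diag).2 (by simpa using hS), rfl⟩
  have h2 := sub_mem h1 (mul_mul_sub_mem_flatDir hP hP' h)
  rwa [sub_sub_sub_cancel_right, Matrix.mul_add, Matrix.add_mul, add_sub_cancel_left] at h2

theorem rowForm_self_eq_zero_of_mem (hp : IsPair σ e) {N : Matrix (Fin n) (Fin n) D}
    (hN : N ∈ flatDir σ e c.index) {k : Fin c.length} {u : Fin n → D}
    (hu : ∀ i, c.index i ≠ k → u i = 0) : rowForm σ e N u u = 0 :=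
  rowForm_self_eq_zero hp (mem_flatDir.1 hN).2.1 (mem_flatDir.1 hN).2.2 hu

/-- The action of an equivalence on a row of level `k`. -/
theorem exists_smul_of_equivalent [FiniteDimensional F D] (hp : IsPair σ e)
    (hP : IsLevelNonisotropic σ e c.index P) (hP' : IsLevelNonisotropic σ e c.index P')
    (h : flat σ e c.index P' = (fun M => U.val * M * V.val) '' flat σ e c.index P)
    {k : Fin c.length} {u : Fin n → D} (hu : ∀ i, c.index i ≠ k → u i = 0) (hu0 : u ≠ 0) :
    (∃ i, c.index i = k ∧ (u ᵥ* U.val) i ≠ 0) ∧ ∃ β : F,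
      (∀ j, c.index j = k → (V.val *ᵥ fun i => σ (u i)) j = β • σ ((u ᵥ* U.val) j)) ∧
      rowForm σ e P' u u =
        β • rowForm σ e P (levelPart c.index k (u ᵥ* U.val)) (levelPart c.index k (u ᵥ* U.val)) := by
  obtain ⟨i', hi', hlev'⟩ := exists_level (g := c.index) hu0
  have hk : c.index i' = k := by
    by_contra hne
    exact hi' (hu i' hne)
  obtain ⟨i, hi, hlev⟩ := exists_level (g := c.index) (vecMul_unit_ne_zero hu0 U)
  have hik := index_eq_of_equivalent hp hP hP' h hi hlev hi' hlev'
  rw [hk] at hik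
  -- U S V is again in the direction, so its form vanishes at u; hence the column V u⋆ pairs to zero
  -- with uU through every S, and it is proportional to (uU)⋆ on level k.
  have hS : ∀ S ∈ flatDir σ e c.index,
      e ((u ᵥ* U.val) ⬝ᵥ (S *ᵥ (V.val *ᵥ fun i => σ (u i)))) = 0 := fun S hS => by
    rw [← rowForm_mul_mul]
    exact rowForm_self_eq_zero_of_mem hp (mul_mul_mem_flatDir hP hP' h hS) hu
  obtain ⟨β, hβ⟩ := exists_eq_smul_of_annihilator hp hi hS
  have hβ' : ∀ j, c.index j = k → (V.val *ᵥ fun i => σ (u i)) j = β • σ ((u ᵥ* U.val) j) :=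
    fun j hj => hβ j (hik.symm.trans hj.symm)
  refine ⟨⟨i, hik.symm, hi⟩, β, hβ', ?_⟩
  have h1 := rowForm_self_eq_zero_of_mem hp (mul_mul_sub_mem_flatDir hP hP' h) hu
  have h2 : rowForm σ e (U.val * P * V.val - P') u u =
      rowForm σ e (U.val * P * V.val) u u - rowForm σ e P' u u := by
    rw [rowForm, vecMul_sub, sub_dotProduct, map_sub]
    rfl
  rw [h2, sub_eq_zero] at h1
  rw [← h1, rowForm_mul_mul, dotProduct_mulVec_levelPart hP.diag (k := k)
    (fun j hj => hlev j (by rwa [← hik])) (fun j hj => mulVec_eq_zero_of_equivalent hp hP hP' h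
      (fun j hj => by rw [hu j hj.ne', map_zero]) hj)]
  have h3 : (levelPart c.index k (V.val *ᵥ fun i => σ (u i))) =
      β • fun j => σ (levelPart c.index k (u ᵥ* U.val) j) := by
    ext j
    by_cases hj : c.index j = k
    · simp [levelPart, hj, hβ' j hj]
    · simp [levelPart, hj]
  rw [h3, mulVec_smul, dotProduct_smul, map_smul, dotProduct_mulVec]
  rfl

theorem extend_embedding (k : Fin c.length) (u : Fin (c.blocksFun k) → D) :
    ∃ v : Fin n → D, (∀ i, c.index i ≠ k → v i = 0) ∧ v ∘ c.embedding k = u :=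
  ⟨Function.extend (c.embedding k) u 0, fun i hi => by
      rw [Function.extend_apply' _ _ _ (fun ⟨a, ha⟩ => hi (by rw [← ha, c.index_embedding])),
        Pi.zero_apply],
    funext fun a => (c.embedding k).injective.extend_apply u 0 a⟩

/-- Equivalent joints have equivalent forms, up to a scalar, on each block. -/
theorem exists_block_of_equivalent [FiniteDimensional F D] (hp : IsPair σ e)
    (hP : IsLevelNonisotropic σ e c.index P) (hP' : IsLevelNonisotropic σ e c.index P')
    (h : flat σ e c.index P' = (fun M => U.val * M * V.val) '' flat σ e c.index P)
    (k : Fin c.length) :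
    ∃ (Q : (Matrix (Fin (c.blocksFun k)) (Fin (c.blocksFun k)) D)ˣ) (α : Fˣ),
      ∀ X, starForm σ e (P'.submatrix (c.embedding k) (c.embedding k)) X =
        α * starForm σ e (P.submatrix (c.embedding k) (c.embedding k)) (Q.val *ᵥ X) := by
  -- The image under U of a nonzero row supported on level k has a nonzero coordinate on level k, so
  -- the diagonal block of U is injective on rows.
  have hUk : IsUnit (U.val.submatrix (c.embedding k) (c.embedding k)) := by
    refine isUnit_of_forall_vecMul fun u hu => ?_
    by_contra hu0
    obtain ⟨v, hv, rfl⟩ := extend_embedding k u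
    obtain ⟨⟨i, hik, hi⟩, -⟩ := exists_smul_of_equivalent hp hP hP' h hv
      (fun h0 => hu0 (by rw [h0]; rfl))
    rw [← vecMul_embedding hv] at hu
    obtain ⟨a, rfl⟩ := exists_embedding hik
    exact hi (congrFun hu a)
  obtain ⟨W, hW⟩ := hUk
  have key : ∀ X, X ≠ 0 → ∃ β : F,
      V.val.submatrix (c.embedding k) (c.embedding k) *ᵥ X =
        β • (conjT σ W.val *ᵥ X) ∧
      starForm σ e (P'.submatrix (c.embedding k) (c.embedding k)) X =
        β * starForm σ e (P.submatrix (c.embedding k) (c.embedding k)) (conjT σ W.val *ᵥ X) := by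
    intro X hX
    obtain ⟨v, hv, hvX⟩ := extend_embedding k fun a => σ (X a)
    have hXv : X = fun a => σ ((v ∘ c.embedding k) a) := by
      rw [hvX]
      simp_rw [hp.invol]
    obtain ⟨-, β, h1, h2⟩ := exists_smul_of_equivalent hp hP hP' h hv (fun h0 => hX (by
      rw [hXv, h0]
      ext a
      simp))
    have hσv : ∀ i, c.index i ≠ k → (fun i => σ (v i)) i = 0 := fun i hi => by
      change σ (v i) = 0
      rw [hv i hi, map_zero]
    have hlp : levelPart c.index k (v ᵥ* U.val) ∘ c.embedding k =
        (v ∘ c.embedding k) ᵥ* W.val := by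
      rw [hW, ← vecMul_embedding hv]
      ext a
      simp [levelPart]
    have hl : ∀ i, c.index i ≠ k → levelPart c.index k (v ᵥ* U.val) i = 0 := fun i hi => if_neg hi
    refine ⟨β, ?_, ?_⟩
    · have h3 := mulVec_embedding hσv V.val
      have h4 : (fun i => σ (v i)) ∘ c.embedding k = X := by rw [hXv]; rfl
      rw [h4] at h3
      rw [← h3]
      conv_rhs => rw [hXv, conjT_mulVec hp.toIsInvol, hW, ← vecMul_embedding hv]
      ext a
      exact h1 _ (c.index_embedding k a)
    · rw [rowForm_level c P' k hv, rowForm_level c P k hl, hlp] at h2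
      rw [starForm_eq_rowForm hp]
      conv_rhs => rw [hXv, starForm_conjT_mulVec hp]
      rw [← hvX]
      exact h2
  let T₁ := colMap F (V.val.submatrix (c.embedding k) (c.embedding k))
  let T₂ := colMap F (conjT σ W.val)
  have hT₂ : ∀ X, T₂ X ≠ 0 → X ≠ 0 := by
    rintro X h rfl
    exact h (map_zero T₂)
  have hT₂' : ∀ X, X ≠ 0 → T₂ X ≠ 0 := by
    intro X hX h0
    have h1 : conjT σ W⁻¹.val *ᵥ (conjT σ W.val *ᵥ X) = 0 := by
      change conjT σ W.val *ᵥ X = 0 at h0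
      rw [h0, mulVec_zero]
    rw [mulVec_mulVec, ← conjT_mul hp.toIsInvol, Units.mul_inv, conjT_one hp.toIsInvol,
      one_mulVec] at h1
    exact hX h1
  have hT : ∀ X, T₂ X ≠ 0 → ∃ a : F, T₁ X = a • T₂ X := fun X hX => by
    obtain ⟨β, hβ, -⟩ := key X (hT₂ X hX)
    exact ⟨β, hβ⟩
  let X₀ : Fin (c.blocksFun k) → D := Pi.single ⟨0, c.one_le_blocksFun k⟩ 1
  have hX₀ : X₀ ≠ 0 := by simp [X₀]
  -- The factor β depends a priori on X. It is constant by `exists_eq_smul_of_forall`, unless T₂ has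
  -- rank one, when all columns are scalar multiples of X₀.
  obtain ⟨α, hα⟩ : ∃ α : F, ∀ X, T₁ X = α • T₂ X := by
    by_cases hrk : ∃ X, ∀ a : F, T₂ X ≠ a • T₂ X₀
    · obtain ⟨X, hX⟩ := hrk
      exact exists_eq_smul_of_forall T₁ T₂ hT (hT₂' _ hX₀) hX
    · push Not at hrk
      obtain ⟨α, hα⟩ := hT X₀ (hT₂' _ hX₀)
      refine ⟨α, fun X => ?_⟩
      obtain ⟨a, ha⟩ := hrk X
      have h1 : X = a • X₀ := by
        by_contra hne
        exact hT₂' _ (sub_ne_zero.2 hne) (by rw [map_sub, ha, map_smul, sub_self])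
      rw [h1, map_smul, map_smul, hα, smul_comm]
  have hform : ∀ X, starForm σ e (P'.submatrix (c.embedding k) (c.embedding k)) X =
      α * starForm σ e (P.submatrix (c.embedding k) (c.embedding k)) (conjT σ W.val *ᵥ X) := by
    intro X
    by_cases hX : X = 0
    · simp [hX, starForm]
    obtain ⟨β, hβ, h1⟩ := key X hX
    have h2 : β = α := by
      have h3 : β • T₂ X = α • T₂ X := hβ.symm.trans (hα X)
      exact smul_left_injective F (hT₂' X hX) h3
    rw [h1, h2]
  have hα0 : α ≠ 0 := by
    rintro rfl
    have h1 := hform X₀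
    rw [zero_mul] at h1
    exact (isLevelNonisotropic_iff hp hP'.diag).1 hP' k X₀ hX₀ h1
  exact ⟨unitConjT hp.toIsInvol W, Units.mk0 α hα0, hform⟩

end Blocks

end InvertibleAffine

namespace InvertibleAffine

/-! ### Equivalences built from blockwise forms, and the three statements. -/

section Classification

open Matrix

variable {F D : Type*} [Field F] [DivisionRing D] [Algebra F D]
variable {σ : D →ₗ[F] D} {e : D →ₗ[F] F} {n : ℕ}

theorem diagJoin_mul (c : Composition n)
    (M N : ∀ i, Matrix (Fin (c.blocksFun i)) (Fin (c.blocksFun i)) D) :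
    diagJoin c M * diagJoin c N = diagJoin c fun k => M k * N k := by
  rw [diagJoin, diagJoin, submatrix_mul_equiv, ← blockDiagonal'_mul]
  rfl

theorem diagJoin_one (c : Composition n) :
    diagJoin c (fun k => (1 : Matrix (Fin (c.blocksFun k)) (Fin (c.blocksFun k)) D)) = 1 := by
  have h : blockDiagonal' (fun k => (1 : Matrix (Fin (c.blocksFun k)) (Fin (c.blocksFun k)) D)) =
      1 := blockDiagonal'_one
  rw [diagJoin, h, submatrix_one_equiv]

/-- The block-diagonal matrix with prescribed invertible diagonal blocks. -/
def diagUnit (c : Composition n) (N : InvertibleFamily D c) : (Matrix (Fin n) (Fin n) D)ˣ where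
  val := diagJoin c fun k => (N k).val
  inv := diagJoin c fun k => (N k)⁻¹.val
  val_inv := by
    rw [diagJoin_mul]
    simp_rw [Units.mul_inv]
    exact diagJoin_one c
  inv_val := by
    rw [diagJoin_mul]
    simp_rw [Units.inv_mul]
    exact diagJoin_one c

variable {c : Composition n}

theorem diagJoin_submatrix (N : ∀ i, Matrix (Fin (c.blocksFun i)) (Fin (c.blocksFun i)) D)
    (k : Fin c.length) : (diagJoin c N).submatrix (c.embedding k) (c.embedding k) = N k := by
  ext a b
  exact diagJoin_embedding c N k a b

theorem diagJoin_submatrix_embedding {P : Matrix (Fin n) (Fin n) D}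
    (hP : ∀ i j, c.index i ≠ c.index j → P i j = 0) :
    diagJoin c (fun k => P.submatrix (c.embedding k) (c.embedding k)) = P := by
  ext i j
  by_cases h : c.index i = c.index j
  · obtain ⟨k, hk⟩ : ∃ k, c.index j = k := ⟨_, rfl⟩
    obtain ⟨a, rfl⟩ := exists_embedding (h.trans hk)
    obtain ⟨b, rfl⟩ := exists_embedding hk
    exact diagJoin_embedding c _ k a b
  · rw [diagJoin_of_ne c _ h, hP i j h]

theorem vecMul_diag_level {N : Matrix (Fin n) (Fin n) D}
    (hN : ∀ i j, c.index i ≠ c.index j → N i j = 0) {k : Fin c.length} {u : Fin n → D}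
    (hu : ∀ i, c.index i ≠ k → u i = 0) (j : Fin n) (hj : c.index j ≠ k) : (u ᵥ* N) j = 0 := by
  change ∑ i, u i * N i j = 0
  refine Finset.sum_eq_zero fun i _ => ?_
  by_cases hi : c.index i = k
  · rw [hN i j (by rw [hi]; exact Ne.symm hj), mul_zero]
  · rw [hu i hi, zero_mul]

theorem mulVec_diag_level {N : Matrix (Fin n) (Fin n) D}
    (hN : ∀ i j, c.index i ≠ c.index j → N i j = 0) {k : Fin c.length} {u : Fin n → D}
    (hu : ∀ i, c.index i ≠ k → u i = 0) (j : Fin n) (hj : c.index j ≠ k) : (N *ᵥ u) j = 0 := by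
  change ∑ i, N j i * u i = 0
  refine Finset.sum_eq_zero fun i _ => ?_
  by_cases hi : c.index i = k
  · rw [hN j i (by rw [hi]; exact hj), zero_mul]
  · rw [hu i hi, mul_zero]

theorem triangular_mul {κ : Type*} [Preorder κ] {g : Fin n → κ} {A M B : Matrix (Fin n) (Fin n) D}
    (hA : ∀ i j, g i ≠ g j → A i j = 0) (hM : ∀ i j, g j < g i → M i j = 0)
    (hB : ∀ i j, g i ≠ g j → B i j = 0) (i j : Fin n) (h : g j < g i) : (A * M * B) i j = 0 := by
  rw [mul_apply]
  refine Finset.sum_eq_zero fun b _ => ?_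
  by_cases hb : g b = g j
  · rw [mul_apply, Finset.sum_eq_zero, zero_mul]
    intro a _
    by_cases ha : g i = g a
    · rw [hM a b (by rwa [hb, ← ha]), mul_zero]
    · rw [hA i a ha, zero_mul]
  · rw [hB b j hb, mul_zero]

theorem rowForm_sub (M P : Matrix (Fin n) (Fin n) D) (u w : Fin n → D) :
    rowForm σ e (M - P) u w = rowForm σ e M u w - rowForm σ e P u w := by
  rw [rowForm, vecMul_sub, sub_dotProduct, map_sub]
  rfl

/-- The elements of `flat σ e g P` are the block-triangular matrices with the same forms as `P` on
all the levels. -/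
theorem sub_mem_flatDir_of_rowForm (hp : IsPair σ e) {κ : Type*} [LinearOrder κ] {g : Fin n → κ}
    {N : Matrix (Fin n) (Fin n) D} (htri : ∀ i j, g j < g i → N i j = 0)
    (h : ∀ (l : κ) (u : Fin n → D), (∀ i, g i ≠ l → u i = 0) → rowForm σ e N u u = 0) :
    N ∈ flatDir σ e g := by
  have key : ∀ l, (∀ i j, g i = l → g j = l → σ (N j i) = -N i j) ∧
      ∀ i, g i = l → e (N i i) = 0 := by
    intro l
    -- The matrix truncated to level l has an alternating form on all rows, not only on those of
    -- level l.
    have h1 := skew_of_rowForm hp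
      (N := Matrix.of fun i j => if g i = l ∧ g j = l then N i j else 0) (fun u => by
        rw [← h l (levelPart g l u) fun i hi => if_neg hi, rowForm_eq_sum, rowForm_eq_sum]
        refine Finset.sum_congr rfl fun p _ => ?_
        by_cases hi : g p.1 = l <;> by_cases hj : g p.2 = l <;> simp [levelPart, hi, hj])
    refine ⟨fun i j hi hj => ?_, fun i hi => ?_⟩
    · have h2 := h1.1 i j
      simpa [hi, hj] using h2
    · have h2 := h1.2 i
      simpa [hi] using h2
  exact mem_flatDir.2 ⟨htri, fun i j hij => (key _).1 i j hij rfl, fun i => (key _).2 i rfl⟩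

/-- With U = diag(Q_k⋆) and V = diag(α_k Q_k), the form of U M V at a row u of level k is α_k times
that of M at uU, which is the form of P'_k. Forms on the levels and triangularity characterize
membership. -/
theorem mul_mul_mem_flat (hp : IsPair σ e) {P P' : InvertibleFamily D c}
    {Q : InvertibleFamily D c} {α : Fin c.length → Fˣ}
    (h : ∀ k X, starForm σ e (P' k).val X = α k * starForm σ e (P k).val ((Q k).val *ᵥ X))
    {M : Matrix (Fin n) (Fin n) D}
    (hM : M ∈ flat σ e c.index (diagJoin c fun k => (P k).val)) :
    (diagUnit c fun k => unitConjT hp.toIsInvol (Q k)).val * M *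
      (diagUnit c fun k => α k • Q k).val ∈
        flat σ e c.index (diagJoin c fun k => (P' k).val) := by
  have hd : ∀ N : ∀ i, Matrix (Fin (c.blocksFun i)) (Fin (c.blocksFun i)) D, ∀ i j,
      c.index i ≠ c.index j → diagJoin c N i j = 0 := fun N i j => diagJoin_of_ne c N
  rw [mem_flat_iff (hd _)] at hM ⊢
  have hMtri : ∀ i j, c.index j < c.index i → M i j = 0 := fun i j hij => by
    have := (mem_flatDir.1 hM).1 i j hij
    rwa [Matrix.sub_apply, hd _ i j hij.ne', sub_zero] at this
  refine sub_mem_flatDir_of_rowForm hp (fun i j hij => ?_) fun k u hu => ?_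
  · rw [Matrix.sub_apply, hd _ i j hij.ne', sub_zero]
    exact triangular_mul (hd _) hMtri (hd _) i j hij
  have hσu : ∀ i, c.index i ≠ k → (fun i => σ (u i)) i = 0 := fun i hi => by
    change σ (u i) = 0
    rw [hu i hi, map_zero]
  set U := (diagUnit c fun k => unitConjT hp.toIsInvol (Q k)).val with hU
  set V := (diagUnit c fun k => α k • Q k).val with hV
  have hUl := vecMul_diag_level (N := U) (hd _) hu
  have hue : (u ᵥ* U) ∘ c.embedding k = (u ∘ c.embedding k) ᵥ* conjT σ (Q k).val := by
    rw [vecMul_embedding hu]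
    congr 1
    exact diagJoin_submatrix _ k
  have hQu : (Q k).val *ᵥ ((fun i => σ (u i)) ∘ c.embedding k) =
      fun a => σ (((u ᵥ* U) ∘ c.embedding k) a) := by
    rw [hue, ← conjT_mulVec hp.toIsInvol, conjT_conjT hp.toIsInvol]
    rfl
  have hVu : (V *ᵥ fun i => σ (u i)) = (α k : F) • fun j => σ ((u ᵥ* U) j) := by
    ext j
    by_cases hj : c.index j = k
    · obtain ⟨a, rfl⟩ := exists_embedding hj
      have h1 := congrFun (mulVec_embedding hσu V) a
      have h2 : V.submatrix (c.embedding k) (c.embedding k) = (α k : F) • (Q k).val :=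
        diagJoin_submatrix _ k
      rw [h2, smul_mulVec, hQu] at h1
      exact h1
    · rw [mulVec_diag_level (N := V) (hd _) hσu j hj, Pi.smul_apply, hUl j hj, map_zero, smul_zero]
  have h1 := rowForm_self_eq_zero_of_mem hp hM hUl
  rw [rowForm_sub, sub_eq_zero] at h1
  rw [rowForm_sub, sub_eq_zero, rowForm_mul_mul, hVu, mulVec_smul, dotProduct_smul, map_smul,
    dotProduct_mulVec]
  change (α k : F) • rowForm σ e M (u ᵥ* U) (u ᵥ* U) = _
  rw [h1, rowForm_level c _ k hUl, rowForm_level c _ k hu, diagJoin_submatrix, diagJoin_submatrix]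
  have h2 := h k ((fun i => σ (u i)) ∘ c.embedding k)
  rw [hQu, starForm_eq_rowForm hp, starForm_eq_rowForm hp] at h2
  simp only [Function.comp_apply, hp.invol] at h2
  exact h2.symm

theorem matEquivalent_of_forms (hp : IsPair σ e) {P P' : InvertibleFamily D c}
    {Q : InvertibleFamily D c} {α : Fin c.length → Fˣ}
    (h : ∀ k X, starForm σ e (P' k).val X = α k * starForm σ e (P k).val ((Q k).val *ᵥ X)) :
    MatEquivalent (flat σ e c.index (diagJoin c fun k => (P k).val))
      (flat σ e c.index (diagJoin c fun k => (P' k).val)) := by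
  have h' : ∀ k X, starForm σ e (P k).val X =
      (α k)⁻¹.val * starForm σ e (P' k).val ((Q k)⁻¹.val *ᵥ X) := by
    intro k X
    rw [h, mulVec_mulVec, Units.mul_inv, one_mulVec, Units.inv_mul_cancel_left]
  refine ⟨diagUnit c fun k => unitConjT hp.toIsInvol (Q k), diagUnit c fun k => α k • Q k,
    Set.Subset.antisymm (fun M' hM' => ?_) ?_⟩
  · refine ⟨_, mul_mul_mem_flat hp (Q := fun k => (Q k)⁻¹) (α := fun k => (α k)⁻¹) h' hM', ?_⟩
    have h1 : (diagUnit c fun k => unitConjT hp.toIsInvol (Q k)⁻¹) =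
        (diagUnit c fun k => unitConjT hp.toIsInvol (Q k))⁻¹ := Units.ext rfl
    have h2 : (diagUnit c fun k => (α k)⁻¹ • (Q k)⁻¹) = (diagUnit c fun k => α k • Q k)⁻¹ :=
      Units.ext rfl
    change _ * (_ * M' * _) * _ = M'
    rw [h1, h2, ← Matrix.mul_assoc, ← Matrix.mul_assoc, Units.mul_inv, Matrix.one_mul,
      Matrix.mul_assoc, Units.inv_mul, Matrix.mul_one]
  · rintro - ⟨M, hM, rfl⟩
    exact mul_mul_mem_flat hp h hM

theorem IsLevelNonisotropic.of_lt_iff {κ κ' : Type*} [LinearOrder κ] [LinearOrder κ']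
    {g : Fin n → κ} {g' : Fin n → κ'} {P : Matrix (Fin n) (Fin n) D}
    (hP : IsLevelNonisotropic σ e g P) (h : ∀ i j, g' i = g' j ↔ g i = g j) :
    IsLevelNonisotropic σ e g' P := by
  refine ⟨fun i j hij => hP.diag i j fun h' => hij ((h i j).2 h'), fun l u hu h0 => ?_⟩
  by_contra hu0
  obtain ⟨i, hi⟩ := Function.ne_iff.1 hu0
  have hil : g' i = l := by
    by_contra hne
    exact hi (hu i hne)
  refine hu0 (hP.nonisotropic (g i) u (fun j hj => hu j fun h' => hj ?_) h0)
  rw [← h, h', hil]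

theorem flat_eq_of_lt_iff {κ κ' : Type*} [LinearOrder κ] [LinearOrder κ'] {g : Fin n → κ}
    {g' : Fin n → κ'} (h : ∀ i j, g' i < g' j ↔ g i < g j) (h' : ∀ i j, g' i = g' j ↔ g i = g j)
    (P : Matrix (Fin n) (Fin n) D) : flat σ e g' P = flat σ e g P := by
  ext M
  simp only [flat, h, h']

theorem isLevelNonisotropic_diagJoin (hp : IsPair σ e) {P : InvertibleFamily D c} :
    IsLevelNonisotropic σ e c.index (diagJoin c fun k => (P k).val) ↔
      ∀ k, IsNonisotropic σ e (P k).val := by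
  rw [isLevelNonisotropic_iff hp fun i j => diagJoin_of_ne c _]
  simp_rw [diagJoin_submatrix]

theorem IsNonisotropic.isUnit (hp : IsPair σ e) {m : ℕ} {P : Matrix (Fin m) (Fin m) D}
    (hP : IsNonisotropic σ e P) : IsUnit P := by
  refine isUnit_of_forall_vecMul fun x hx => (isNonisotropic_iff hp).1 hP x ?_
  rw [rowForm, hx, zero_dotProduct, map_zero]

variable [FiniteDimensional F D]

theorem exists_jointTranslate (hp : IsPair σ e) (s : Finset F)
    (hs : n * Module.finrank F D ≤ s.card) {A : AffineSubspace F (Matrix (Fin n) (Fin n) D)}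
    (hA : IsOptimalAffineInvertible A) :
    ∃ (c : Composition n) (P : InvertibleFamily D c), (∀ i, IsNonisotropic σ e (P i).val) ∧
      MatEquivalent (A : Set (Matrix (Fin n) (Fin n) D)) (jointTranslate σ e c P) := by
  obtain ⟨h, P, hm, hP, hE⟩ := hA.exists_flat hp s hs
  obtain ⟨c, hc⟩ := exists_composition_of_monotone hm
  have hc' : ∀ i j, c.index i = c.index j ↔ h i = h j := fun i j => by
    rw [le_antisymm_iff, le_antisymm_iff, ← not_lt, ← not_lt, ← not_lt, ← not_lt, hc, hc]
  have hPc : IsLevelNonisotropic σ e c.index P := hP.of_lt_iff hc'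
  have hPk := (isLevelNonisotropic_iff hp hPc.diag).1 hPc
  choose Q hQ using fun k => (hPk k).isUnit hp
  refine ⟨c, Q, fun k => by rw [hQ]; exact hPk k, ?_⟩
  rw [jointTranslate_eq_flat]
  simp_rw [hQ]
  rwa [diagJoin_submatrix_embedding hPc.diag, flat_eq_of_lt_iff hc hc']

end Classification

end InvertibleAffine

theorem mainTheorem10 {F D : Type*} [Field F] [DivisionRing D] [Algebra F D]
    [FiniteDimensional F D] (n : ℕ) (hn : 1 ≤ n)
    (hcard : ((n * Module.finrank F D : ℕ) : Cardinal) ≤ Cardinal.mk F)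
    (σ : D → D) (e : D →ₗ[F] F) (hpair : IsAssociatedPair σ e) :
    -- every optimal space is equivalent to a joint of the standard spaces
    (∀ A : AffineSubspace F (Matrix (Fin n) (Fin n) D), IsOptimalAffineInvertible A →
      ∃ (c : Composition n) (P : InvertibleFamily D c),
        (∀ i, IsNonisotropic σ e (P i).val) ∧
        MatEquivalent (A : Set (Matrix (Fin n) (Fin n) D)) (jointTranslate σ e c P)) ∧
    -- every such joint is an optimal space
    (∀ (c : Composition n) (P : InvertibleFamily D c),
      (∀ i, IsNonisotropic σ e (P i).val) →
      ∃ A : AffineSubspace F (Matrix (Fin n) (Fin n) D),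
        (A : Set (Matrix (Fin n) (Fin n) D)) = jointTranslate σ e c P ∧
        IsOptimalAffineInvertible A) ∧
    -- classification up to equivalence
    (∀ (c c' : Composition n) (P : InvertibleFamily D c) (P' : InvertibleFamily D c'),
      (∀ i, IsNonisotropic σ e (P i).val) → (∀ i, IsNonisotropic σ e (P' i).val) →
      (MatEquivalent (jointTranslate σ e c P) (jointTranslate σ e c' P') ↔
        ∃ h : c' = c, ∀ k : Fin c.length,
          ∃ (Q : (Matrix (Fin (c.blocksFun k)) (Fin (c.blocksFun k)) D)ˣ) (α : Fˣ),
            ∀ X : Fin (c.blocksFun k) → D,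
              starForm σ e ((h ▸ P' : InvertibleFamily D c) k).val X =
                (α : F) * starForm σ e (P k).val (Q.val.mulVec X))) := by
  classical
  obtain ⟨σ', hσ', hp⟩ := hpair.exists_isPair
  obtain rfl : σ = σ' := (funext hσ').symm
  -- Only finitely many scalars are ever needed, so finite and infinite fields are treated alike.
  obtain ⟨s, hs⟩ := Cardinal.exists_finset_le_card F _ hcard
  refine ⟨fun A hA => exists_jointTranslate hp s hs hA, fun c P hP => ?_, fun c c' P P' hP hP' => ?_⟩
  · have h := (isLevelNonisotropic_diagJoin hp).2 hP
    exact ⟨flatSpace σ' e c.index (diagJoin c fun k => (P k).val),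
      by rw [coe_flatSpace h, jointTranslate_eq_flat], isOptimal_flatSpace hp h s hs⟩
  · have h := (isLevelNonisotropic_diagJoin hp).2 hP
    have h' := (isLevelNonisotropic_diagJoin hp).2 hP'
    rw [jointTranslate_eq_flat, jointTranslate_eq_flat]
    constructor
    · rintro ⟨U, V, hUV⟩
      obtain rfl := composition_eq_of_equivalent hp h h' hUV
      refine ⟨rfl, fun k => ?_⟩
      obtain ⟨Q, α, hQ⟩ := exists_block_of_equivalent hp h h' hUV k
      rw [diagJoin_submatrix, diagJoin_submatrix] at hQ
      exact ⟨Q, α, hQ⟩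
    · rintro ⟨rfl, hk⟩
      choose Q α hQ using hk
      exact matEquivalent_of_forms hp hQ
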